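/- **Setting.** Let $G,K$ be groups. Consider a translation-invariant matrix product density operator (MPDO) on periodic chains of every length $L$, $\rho_L=\sum_{i,j}\operatorname{tr}(A^{i_1j_1}\cdots A^{i_Lj_L})\,|i_1\dots i_L\rangle\langle j_1\dots j_L|$, with $\chi\times\chi$ matrices $A^{ij}$, $1\le i,j\le d$, and $\rho_L\ge 0$ for all $L$; write $\langle O\rangle=\operatorname{tr}(\rho_LO)/\operatorname{tr}\rho_L$. It is *strong injective*: $X\mapsto(\sum_{a,b}A^{ij}_{ab}X_{ab})_{ij}$ is injective on $\chi\times\chi$ matrices, and $T=\sum_iA^{ii}$ has a unique largest eigenvalue, i.e. a real, algebraically simple eigenvalue $\lambda$ with $|\mu|<\lambda$ for every other eigenvalue $\mu$. Let $U,W$ be commuting unitary representations of $G,K$ on $\mathbb C^d$. Assume $G$ is a strong symmetry ($U_g^{\otimes L}\rho_L=e^{i\theta}\rho_L$ and $\rho_L(U_g^{\otimes L})^\dagger=e^{-i\theta}\rho_L$ with a phase $\theta=\theta_{g,L}$) and $K$ is a weak symmetry ($W_k^{\otimes L}\rho_L(W_k^{\otimes L})^\dagger=\rho_L$). The doubled state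 has the symmetry $\mathbb G=(G_l\times G_r\times K)\rtimes\mathbb Z_2^{\mathbb H}$, where $(g,h,k)$ acts on the tensor by $U_gW_k$ on the ket index $i$ and by $\overline{U_hW_k}$ on the bra index $j$, and the anti-unitary $\mathbb H$ acts by $A^{ij}\mapsto\overline{A^{ji}}$ and exchanges $G_l$ and $G_r$. A *virtual representation* is a family of invertible matrices $V_x$ with $x\cdot A^{ij}=\kappa(x)V_x^{-1}A^{ij}V_x$, $|\kappa(x)|=1$, and $V_x\,{}^xV_y=\omega(x,y)V_{xy}$ with $\omega(x,y)\in U(1)$, where ${}^x$ is complex conjugation if $x$ is anti-unitary and trivial otherwise. The SPT phase is the class of $\omega$ in $H^2(\mathbb G,U_T(1))$, where anti-unitary elements act on $U(1)$ by conjugation. For $g\in G$ and $p=(s,k)\in G\times K$ put $i_g\omega(p)=\omega(p,g)/\omega(g,p)$, with $g$ read as $(g,e,e)$ and $p$ as $(s,e,k)$ in $\mathbb G$. For $g\in G$ and operators $R',R$ on one site let $\mathcal O(x_1,x_2)=R'(x_1)\big(\prod_{x_1<x<x_2}U_g(x)\big)R(x_2)$. For a subgroup $G'\le G\times K$ and a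 character $e^{i\alpha}:G'\to U(1)$, $R$ *has charge $\alpha$* if $u_pR\,u_p^\dagger=e^{i\alpha(p)}R$ for all $p=(s,k)\in G'$, where $u_p=U_sW_k$. *String order $(g,\alpha)$ is present* if for some $R'=R_{\alpha^*}$ of charge $-\alpha$ and some $R=R_\alpha$ of charge $\alpha$ there is $c>0$ with $|\langle\mathcal O(x_1,x_2)\rangle|\to c$ as $x_2-x_1\to\infty$ and $L-(x_2-x_1)\to\infty$. It *vanishes* if for all such $R',R$ this limit is $0$. **Theorem.** A virtual representation $(V,\omega)$ exists. For every virtual representation: 1. Let $G_1\le G$ and $G'\le G\times K$ be subgroups such that $gs=sg$ for all $g\in G_1$ and $(s,k)\in G'$. Then $i_g\omega(p)$ is multiplicative in $g\in G_1$ and in $p\in G'$. For every $g\in G_1$ (whether or not $i_g\omega$ is trivial on $G'$) and every character $e^{i\alpha}$ of $G'$, string order $(g,\alpha)$ is present if $e^{-i\alpha(\cdot)}=i_g\omega(\cdot)$ on $G'$, and it vanishes otherwise. 2. (Strong Abelian symmetry.) If $G$ is Abelian, the conclusions of 1 hold with $G_1=G'=G$. Moreover, with only the strong Abelian symmetry $G$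 ($K$ trivial), two such MPDOs (with possibly different $d,\chi,A,U$) are in the same SPT phase, i.e. have the same class in $H^2(\mathbb G,U_T(1))$, if and only if string order is present in both for the same pairs $(g,\alpha)$, where $g\in G$ and $e^{i\alpha}$ is a character of $G$. 3. (Strong $G$, weak $K$, arbitrary groups.) The conclusions of 1 hold with $G_1=G$ and $G'=K$; in particular $g\mapsto i_g\omega|_K$ is an element of $\operatorname{Hom}(G,\operatorname{Hom}(K,U(1)))=H^1(G,H^1(K,U(1)))$. Two such MPDOs have the same element of this group if and only if string order is present in both for the same pairs $(g,\alpha)$, where $g\in G$ and $e^{i\alpha}$ is a character of $K$. If moreover their cocycles $\omega_L(g,h)=\omega((g,e,e),(h,e,e))$ have the same class in $H^2(G,U(1))$, this holds if and only if they have the same class in $H^2(\mathbb G,U_T(1))$. -/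

import Mathlib

open scoped Matrix BigOperators ComplexOrder

noncomputable section

namespace MixedSPT

/-- A local MPDO tensor: `A i j` is a `χ × χ` matrix, `i` the ket index and `j` the bra index. -/
abbrev Tensor (d χ : ℕ) : Type := Fin d → Fin d → Matrix (Fin χ) (Fin χ) ℂ

/-- Many-body operators on a chain of `L` sites with local dimension `d`. -/
abbrev ChainOp (d L : ℕ) : Type := Matrix (Fin L → Fin d) (Fin L → Fin d) ℂ

/-- The (unnormalized) matrix product density operator on a periodic chain of `L` sites:
`ρ_L = ∑_{i,j} tr (A^{i_1 j_1} ⋯ A^{i_L j_L}) |i⟩⟨j|`. -/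
def mpdo {d χ : ℕ} (A : Tensor d χ) (L : ℕ) : ChainOp d L :=
  Matrix.of fun i j => ((List.ofFn fun x => A (i x) (j x)).prod).trace

/-- The tensor product `⨂ₓ O x` of on-site operators. -/
def siteProd {d L : ℕ} (O : Fin L → Matrix (Fin d) (Fin d) ℂ) : ChainOp d L :=
  Matrix.of fun i j => ∏ x, O x (i x) (j x)

/-- The global on-site action `⨂ₓ u` of a single-site unitary `u`. -/
def globalOp {d : ℕ} (u : Matrix.unitaryGroup (Fin d) ℂ) (L : ℕ) : ChainOp d L :=
  siteProd fun _ => (u : Matrix (Fin d) (Fin d) ℂ)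

/-- The transfer matrix `T = ∑ᵢ A^{ii}`. -/
def transfer {d χ : ℕ} (A : Tensor d χ) : Matrix (Fin χ) (Fin χ) ℂ := ∑ i, A i i

/-- Strong injectivity: the tensor is injective as a map from the virtual space to the doubled
physical space, and the transfer matrix has a unique largest eigenvalue, which is real:
it is an algebraically simple root of the characteristic polynomial and strictly exceeds the
modulus of every other root. -/
structure StrongInjective {d χ : ℕ} (A : Tensor d χ) : Prop where
  injective : Function.Injective
    fun (X : Matrix (Fin χ) (Fin χ) ℂ) (i j : Fin d) => ∑ a, ∑ b, A i j a b * X a b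
  gap : ∃ l : ℝ, (transfer A).charpoly.rootMultiplicity (l : ℂ) = 1 ∧
    ∀ m : ℂ, (transfer A).charpoly.IsRoot m → m ≠ (l : ℂ) → ‖m‖ < l

/-- Strong symmetry: `U_g ρ = e^{iθ} ρ` and `ρ U_g† = e^{-iθ} ρ` for every chain length. -/
def StronglySymmetric {d χ : ℕ} (A : Tensor d χ) {G : Type*} [Group G]
    (U : G →* Matrix.unitaryGroup (Fin d) ℂ) : Prop :=
  ∀ (L : ℕ) (g : G), ∃ c : Circle,
    globalOp (U g) L * mpdo A L = (c : ℂ) • mpdo A L ∧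
    mpdo A L * (globalOp (U g) L)ᴴ = ((c⁻¹ : Circle) : ℂ) • mpdo A L

/-- Weak symmetry: `W_k ρ W_k† = ρ` for every chain length. -/
def WeaklySymmetric {d χ : ℕ} (A : Tensor d χ) {K : Type*} [Group K]
    (W : K →* Matrix.unitaryGroup (Fin d) ℂ) : Prop :=
  ∀ (L : ℕ) (k : K), globalOp (W k) L * mpdo A L * (globalOp (W k) L)ᴴ = mpdo A L

/-- A translation-invariant strong injective MPDO with an on-site unitary symmetry `G × K`,
where `G` is a strong and `K` a weak symmetry. -/
structure SymmetricMPDO (G K : Type*) [Group G] [Group K] where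
  d : ℕ
  χ : ℕ
  A : Tensor d χ
  posSemidef : ∀ L, (mpdo A L).PosSemidef
  strongInjective : StrongInjective A
  U : G →* Matrix.unitaryGroup (Fin d) ℂ
  W : K →* Matrix.unitaryGroup (Fin d) ℂ
  commute : ∀ g k, Commute (U g) (W k)
  strong : StronglySymmetric A U
  weak : WeaklySymmetric A W

/-- The on-site representation `(g, k) ↦ U_g W_k` of the physical symmetry `G × K`. -/
def SymmetricMPDO.onSite {G K : Type*} [Group G] [Group K] (ρ : SymmetricMPDO G K) :
    G × K →* Matrix.unitaryGroup (Fin ρ.d) ℂ :=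
  ρ.U.noncommCoprod ρ.W ρ.commute

/-! ### The symmetry group of the doubled state -/

/-- The Hermiticity symmetry exchanges the left and the right copy of `G` and fixes `K`. -/
def swapAut (G K : Type*) [Group G] [Group K] : MulAut (G × G × K) where
  toFun p := (p.2.1, p.1, p.2.2)
  invFun p := (p.2.1, p.1, p.2.2)
  left_inv _ := rfl
  right_inv _ := rfl
  map_mul' _ _ := rfl

theorem swapAut_mul_self (G K : Type*) [Group G] [Group K] :
    swapAut G K * swapAut G K = 1 := rfl

/-- The action of `ℤ₂ = {1, -1}`, generated by the Hermiticity symmetry, on `G × G × K`. -/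
def hermAction (G K : Type*) [Group G] [Group K] : ℤˣ →* MulAut (G × G × K) where
  toFun s := if s = 1 then 1 else swapAut G K
  map_one' := by simp
  map_mul' s t := by
    rcases Int.units_eq_one_or s with rfl | rfl <;> rcases Int.units_eq_one_or t with rfl | rfl <;>
      simp [swapAut_mul_self]

/-- The symmetry group `(G_l × G_r × K) ⋊ ℤ₂` of the doubled state. -/
abbrev DoubledGroup (G K : Type*) [Group G] [Group K] : Type _ :=
  SemidirectProduct (G × G × K) ℤˣ (hermAction G K)

/-- `1` on unitary and `-1` on anti-unitary elements. -/
abbrev antiSign (G K : Type*) [Group G] [Group K] : DoubledGroup G K →* ℤˣ :=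
  SemidirectProduct.rightHom

/-- The element `(g, e, k)` of the doubled group: `g` acts on the ket space only, and `k` is the
weak symmetry, acting on both spaces. -/
def ketElt {G K : Type*} [Group G] [Group K] (p : G × K) : DoubledGroup G K :=
  SemidirectProduct.inl (p.1, 1, p.2)

/-- The Hermiticity symmetry on tensors: `A^{ij} ↦ (A^{ji})^*` (entrywise conjugation). -/
def hermTensor {d χ : ℕ} (A : Tensor d χ) : Tensor d χ :=
  fun i j => (A j i).map (starRingEnd ℂ)

/-- The action of the doubled group on the local tensor: `(g, h, k)` acts on the ket index by
`U_g W_k` and on the bra index by the complex conjugate of `U_h W_k`, after the Hermiticity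
symmetry in case of an anti-unitary element. -/
def SymmetricMPDO.act {G K : Type*} [Group G] [Group K] (ρ : SymmetricMPDO G K)
    (x : DoubledGroup G K) : Tensor ρ.d ρ.χ := fun i j =>
  ∑ i', ∑ j',
    ((ρ.onSite (x.left.1, x.left.2.2) : Matrix (Fin ρ.d) (Fin ρ.d) ℂ) i i' *
      starRingEnd ℂ
        ((ρ.onSite (x.left.2.1, x.left.2.2) : Matrix (Fin ρ.d) (Fin ρ.d) ℂ) j j')) •
      (if antiSign G K x = 1 then ρ.A i' j' else hermTensor ρ.A i' j')

/-- `ᵍV`: complex conjugation of an invertible virtual matrix for an anti-unitary element. -/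
def twist {G K : Type*} [Group G] [Group K] {χ : ℕ} (x : DoubledGroup G K)
    (V : GL (Fin χ) ℂ) : GL (Fin χ) ℂ :=
  if antiSign G K x = 1 then V else Matrix.GeneralLinearGroup.map (starRingEnd ℂ) V

/-- `V` is the projective representation on the virtual space by which the symmetry of the doubled
state acts on the local tensor, `g · A = κ(g) V_g⁻¹ A V_g` with a phase `κ(g)`, and `ω` is its
`U(1)`-valued 2-cocycle, `V_g ᵍV_h = ω(g,h) V_{gh}`. -/
structure SymmetricMPDO.IsProjectiveAction {G K : Type*} [Group G] [Group K]
    (ρ : SymmetricMPDO G K) (V : DoubledGroup G K → GL (Fin ρ.χ) ℂ)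
    (ω : DoubledGroup G K → DoubledGroup G K → Circle) : Prop where
  gauge : ∃ κ : DoubledGroup G K → Circle, ∀ x i j,
    ρ.act x i j = (κ x : ℂ) • (((V x)⁻¹ : GL (Fin ρ.χ) ℂ).val * ρ.A i j * (V x).val)
  projective : ∀ x y, (V x * twist x (V y)).val = (ω x y : ℂ) • (V (x * y)).val

/-- Two `U(1)`-valued 2-cocycles of `Γ` differ by a coboundary, i.e. define the same class in
`H²(Γ, U_T(1))`, where `x` acts on `U(1)` by complex conjugation if `σ x = -1`. -/
def Cohomologous {Γ : Type*} [Group Γ] (σ : Γ →* ℤˣ) (ω₁ ω₂ : Γ → Γ → Circle) : Prop :=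
  ∃ φ : Γ → Circle, ∀ x y,
    ω₂ x y = ω₁ x y * (φ (x * y) / (φ x * φ y ^ ((σ x : ℤˣ) : ℤ)))

/-- The slant product `i_g ω(g') = ω(g', g) / ω(g, g')`. -/
def slant {Γ : Type*} (ω : Γ → Γ → Circle) (g g' : Γ) : Circle := ω g' g / ω g g'

/-- The cocycle of the left symmetry, `ω_L(g, h) = ω(g^l, h^l)`. -/
def ketCocycle {G K : Type*} [Group G] [Group K]
    (ω : DoubledGroup G K → DoubledGroup G K → Circle) (g h : G) : Circle :=
  ω (ketElt (g, 1)) (ketElt (h, 1))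

/-! ### String order -/

/-- The string operator `R'(x₁) (∏_{x₁ < x < x₂} u(x)) R(x₂)` on a chain of `L` sites. -/
def stringOp {d L : ℕ} (u R' R : Matrix (Fin d) (Fin d) ℂ) (x₁ x₂ : Fin L) : ChainOp d L :=
  siteProd fun x =>
    if x = x₁ then R' else if x = x₂ then R else if x₁ < x ∧ x < x₂ then u else 1

/-- The expectation value `tr (ρ_L O) / tr ρ_L`. -/
def expect {d χ : ℕ} (A : Tensor d χ) {L : ℕ} (O : ChainOp d L) : ℂ :=
  (mpdo A L * O).trace / (mpdo A L).trace

/-- The modulus of the expectation value of the string operator converges to `c` when both arcs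
between the end points of the string on the periodic chain become long. -/
def StringLimit {d χ : ℕ} (A : Tensor d χ) (u R' R : Matrix (Fin d) (Fin d) ℂ) (c : ℝ) : Prop :=
  ∀ ε > 0, ∃ N : ℕ, ∀ (L : ℕ) (x₁ x₂ : Fin L),
    (x₁ : ℕ) + N ≤ x₂ → (x₂ : ℕ) + N ≤ L + x₁ → |‖expect A (stringOp u R' R x₁ x₂)‖ - c| < ε

/-- `R` carries the charge `α` of the group `H` acting on a site by `u`:
`u_h R u_h† = α(h) R`. -/
def Carries {d : ℕ} {H : Type*} [Group H] (u : H →* Matrix.unitaryGroup (Fin d) ℂ)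
    (α : H →* Circle) (R : Matrix (Fin d) (Fin d) ℂ) : Prop :=
  ∀ h, (u h : Matrix (Fin d) (Fin d) ℂ) * R * (u h : Matrix (Fin d) (Fin d) ℂ)ᴴ = (α h : ℂ) • R

/-- Some string operator with string `U_g`, `g` in the strong symmetry group, and with end operators
of charges `α*` and `α` under `u` has a non-decaying expectation value. -/
def SymmetricMPDO.HasStringOrder {G K : Type*} [Group G] [Group K] (ρ : SymmetricMPDO G K)
    {H : Type*} [Group H] (u : H →* Matrix.unitaryGroup (Fin ρ.d) ℂ) (g : G)
    (α : H →* Circle) : Prop :=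
  ∃ R' R : Matrix (Fin ρ.d) (Fin ρ.d) ℂ, Carries u α⁻¹ R' ∧ Carries u α R ∧
    ∃ c : ℝ, 0 < c ∧ StringLimit ρ.A (ρ.U g).val R' R c

/-- Every string operator with string `U_g` and with end operators of charges `α*` and `α` under `u`
has an expectation value that vanishes in the limit of a long string. -/
def SymmetricMPDO.StringOrderVanishes {G K : Type*} [Group G] [Group K] (ρ : SymmetricMPDO G K)
    {H : Type*} [Group H] (u : H →* Matrix.unitaryGroup (Fin ρ.d) ℂ) (g : G)
    (α : H →* Circle) : Prop :=
  ∀ R' R : Matrix (Fin ρ.d) (Fin ρ.d) ℂ, Carries u α⁻¹ R' → Carries u α R →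
    StringLimit ρ.A (ρ.U g).val R' R 0

end MixedSPT

end

open scoped Matrix BigOperators ComplexOrder
open Filter Topology

/-! Everything is read off from the map O ↦ ∑ O_{ji} A^{ij} (`opTransfer`), which sends on-site
operators to virtual matrices. Traces of ρ_L against product operators are traces of words in its
values, and injectivity of A makes it surjective with a covariant right inverse `liftOp`.

Existence of V. The transformed tensor generates the same ρ_L up to a phase. Comparing chains of two
and three sites yields an automorphism of the full matrix algebra up to a phase, hence an inner one
(`exists_gauge`). Schur's lemma makes V projective, and |det V| = 1 makes ω unimodular.

String order. The gap makes (T/l)^k converge to a rank-one projection r sᵀ, so a long string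
factorizes into two end-point numbers (`expect_stringOp_tendsto`). The diagonal elements (s,s,k)
preserve T and therefore commute with r sᵀ. Conjugating an end-point number by them multiplies it by
a phase, which gives the selection rule; lifting V_g and V_g⁻¹ to on-site operators saturates it.

The selection rule involves the diagonal element (s,s,k), while i_gω is evaluated at (s,e,k). The
difference is the commutator phase of the left and right copies of G, and it is trivial because ρ_L
≥ 0: Gram matrices of distant half-infinite strings force (H g_l)² r to be a positive multiple of r
(`IsProjectiveAction.pos`), and comparing this for g, g' and gg' removes the phase
(`slant_ket_bra`).

Classification. Since H and K fix r up to scalars, they can be rescaled to fix it exactly, and the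
right copy of G can be taken as the H-conjugate of the left one. The resulting normal form has a
cocycle depending only on ω_L and on the pairing of G with K (`cohomologous_normalCocycle`). For
Abelian G the slant product determines the class of ω_L, because a symmetric cocycle with values in
the divisible group U(1) is a coboundary. -/

namespace MixedSPT

/-! ### Powers of matrices and the dominant eigenvalue -/

section PowersToZero

attribute [local instance] Matrix.linftyOpNormedRing Matrix.linftyOpNormedAlgebra

/-- Gelfand's formula: any c between the spectral radius and 1 eventually gives ‖a^k‖ ≤ c^k, and the
ℓ^∞ operator norm dominates every entry. -/
theorem tendsto_pow_apply_of_spectrum_lt_one {n : ℕ} (a : Matrix (Fin n) (Fin n) ℂ)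
    (h : ∀ z ∈ spectrum ℂ a, ‖z‖ < 1) (i j : Fin n) :
    Tendsto (fun k : ℕ => (a ^ k) i j) atTop (𝓝 0) := by
  have : Nonempty (Fin n) := ⟨i⟩
  have : Nontrivial (Matrix (Fin n) (Fin n) ℂ) := inferInstance
  have : CompleteSpace (Matrix (Fin n) (Fin n) ℂ) := FiniteDimensional.complete ℂ _
  have hr : spectralRadius ℂ a < (1 : NNReal) :=
    spectrum.spectralRadius_lt_of_forall_lt a (fun z hz => by
      have := h z hz
      exact_mod_cast this)
  obtain ⟨c, hc1, hc2⟩ := ENNReal.lt_iff_exists_nnreal_btwn.1 hr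
  have hc2' : c < 1 := by exact_mod_cast hc2
  have h1 := (spectrum.pow_nnnorm_pow_one_div_tendsto_nhds_spectralRadius a).eventually
    (gt_mem_nhds hc1)
  have hgeo : Tendsto (fun k : ℕ => (c : ℝ) ^ k) atTop (𝓝 0) :=
    tendsto_pow_atTop_nhds_zero_of_lt_one c.2 (by exact_mod_cast hc2')
  refine squeeze_zero_norm' ?_ hgeo
  filter_upwards [h1, eventually_gt_atTop 0] with k hk hk0
  have h2 : (‖a ^ k‖₊ : ENNReal) ≤ (c : ENNReal) ^ k := by
    have := ENNReal.rpow_le_rpow hk.le (by positivity : (0 : ℝ) ≤ k)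
    rwa [← ENNReal.rpow_mul, one_div, inv_mul_cancel₀ (by positivity), ENNReal.rpow_one,
      ENNReal.rpow_natCast] at this
  have h3 : ‖a ^ k‖₊ ≤ c ^ k := by exact_mod_cast h2
  have h4 : ‖(a ^ k) i j‖₊ ≤ ‖a ^ k‖₊ := by
    rw [Matrix.linfty_opNNNorm_def]
    exact (Finset.single_le_sum (f := fun j => ‖(a ^ k) i j‖₊) (fun _ _ => zero_le)
      (Finset.mem_univ j)).trans (Finset.le_sup (f := fun i => ∑ j, ‖(a ^ k) i j‖₊)
        (Finset.mem_univ i))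
  exact_mod_cast h4.trans h3

end PowersToZero

/-- `l > 0` is the simple dominant eigenvalue of `T`, with right eigenvector `r` and left
eigenvector `s`, normalized such that the powers of `T / l` converge to the projection `r sᵀ`. -/
structure Dominant {n : ℕ} (T : Matrix (Fin n) (Fin n) ℂ) (l : ℝ) (r s : Fin n → ℂ) : Prop where
  pos : 0 < l
  eig : T *ᵥ r = (l : ℂ) • r
  dot : s ⬝ᵥ r = 1
  unique : ∀ v, T *ᵥ v = (l : ℂ) • v → ∃ c : ℂ, v = c • r
  max : ∀ (m : ℂ) v, v ≠ 0 → T *ᵥ v = m • v → l ≤ ‖m‖ → m = l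
  tendsto : Tendsto (fun k : ℕ => ((l : ℂ)⁻¹ • T) ^ k) atTop (𝓝 (Matrix.vecMulVec r s))

theorem aeval_mulVec_of_eigen {n : ℕ} {T : Matrix (Fin n) (Fin n) ℂ} {m : ℂ} {v : Fin n → ℂ}
    (h : T *ᵥ v = m • v) (q : Polynomial ℂ) :
    (Polynomial.aeval T q) *ᵥ v = q.eval m • v := by
  have hp : ∀ k : ℕ, (T ^ k) *ᵥ v = m ^ k • v := by
    intro k
    induction k with
    | zero => simp
    | succ k ih => rw [pow_succ, ← Matrix.mulVec_mulVec, h, Matrix.mulVec_smul, ih, smul_smul,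
        pow_succ, mul_comm]
  induction q using Polynomial.induction_on' with
  | add p q hp hq => simp [Matrix.add_mulVec, hp, hq, add_smul]
  | monomial k c =>
    rw [Polynomial.aeval_monomial, ← Algebra.smul_def, Matrix.smul_mulVec, hp, smul_smul,
      Polynomial.eval_monomial]

/-- Write the characteristic polynomial as (X - l) q with q(l) ≠ 0. By Cayley–Hamilton P = q(T)/q(l)
is the spectral projection onto the eigenline of l, and N = T/l - P is annihilated by P on both
sides and has spectral radius below 1, so T/l converges to P under powers. -/
theorem exists_dominant {n : ℕ} {T : Matrix (Fin n) (Fin n) ℂ} {l : ℝ} (hl : 0 < l)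
    (hmult : T.charpoly.rootMultiplicity (l : ℂ) = 1)
    (hgap : ∀ m : ℂ, T.charpoly.IsRoot m → m ≠ (l : ℂ) → ‖m‖ < l) :
    ∃ r s, Dominant T l r s := by
  have hlC : (l : ℂ) ≠ 0 := by exact_mod_cast hl.ne'
  have hroot : ∀ (m : ℂ) (v : Fin n → ℂ), v ≠ 0 → T *ᵥ v = m • v → T.charpoly.IsRoot m := by
    intro m v hv hm
    have h1 := aeval_mulVec_of_eigen hm T.charpoly
    rw [Matrix.aeval_self_charpoly, Matrix.zero_mulVec] at h1
    rcases smul_eq_zero.1 h1.symm with h | h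
    · exact h
    · exact absurd h hv
  have hmax : ∀ (m : ℂ) v, v ≠ 0 → T *ᵥ v = m • v → l ≤ ‖m‖ → m = l := by
    intro m v hv hm hle
    by_contra hne
    exact absurd (hgap m (hroot m v hv hm) hne) (not_lt.2 hle)
  obtain ⟨q, hq, hnd⟩ := Polynomial.exists_eq_pow_rootMultiplicity_mul_and_not_dvd T.charpoly
    (Matrix.charpoly_monic T).ne_zero (l : ℂ)
  rw [hmult, pow_one] at hq
  have hq0 : q.eval (l : ℂ) ≠ 0 := fun h => hnd (Polynomial.dvd_iff_isRoot.2 h)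
  set P := (q.eval (l : ℂ))⁻¹ • Polynomial.aeval T q with hP
  have hTP : T * P = (l : ℂ) • P := by
    have h1 := Matrix.aeval_self_charpoly T
    rw [hq, map_mul, map_sub, Polynomial.aeval_X, Polynomial.aeval_C, sub_mul, sub_eq_zero] at h1
    rw [hP, mul_smul_comm, h1, smul_comm, Algebra.smul_def (l : ℂ)]
  have hcomm : Commute T P := by
    have h := (Commute.all (Polynomial.X : Polynomial ℂ) q).map
      (Polynomial.aeval (R := ℂ) T)
    rw [Polynomial.aeval_X] at h
    exact h.smul_right _
  have hPT : P * T = (l : ℂ) • P := by rw [← hcomm.eq, hTP]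
  have hPv : ∀ v, T *ᵥ v = (l : ℂ) • v → P *ᵥ v = v := by
    intro v hv
    rw [hP, Matrix.smul_mulVec, aeval_mulVec_of_eigen hv, smul_smul, inv_mul_cancel₀ hq0, one_smul]
  have hTPv : ∀ v, T *ᵥ (P *ᵥ v) = (l : ℂ) • (P *ᵥ v) := by
    intro v
    rw [Matrix.mulVec_mulVec, hTP, Matrix.smul_mulVec]
  have hPP : P * P = P := by
    refine Matrix.ext_of_mulVec_single fun i => ?_
    rw [← Matrix.mulVec_mulVec]
    exact hPv _ (hTPv _)
  have hev : Module.End.HasEigenvalue (Matrix.toLin' T) (l : ℂ) := by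
    rw [Module.End.hasEigenvalue_iff_isRoot_charpoly, Matrix.charpoly_toLin', hq]
    simp
  obtain ⟨r, hr⟩ := hev.exists_hasEigenvector
  have hTr : T *ᵥ r = (l : ℂ) • r := by simpa using hr.apply_eq_smul
  -- The geometric multiplicity is at most the algebraic one, so the eigenspace is a line.
  have hfin : Module.finrank ℂ (Module.End.eigenspace (Matrix.toLin' T) (l : ℂ)) ≤ 1 := by
    have := LinearMap.finrank_eigenspace_le (Matrix.toLin' T) (l : ℂ)
    rwa [Matrix.charpoly_toLin', hmult] at this
  have huniq : ∀ v, T *ᵥ v = (l : ℂ) • v → ∃ c : ℂ, v = c • r := by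
    intro v hv
    have hv' : v ∈ Module.End.eigenspace (Matrix.toLin' T) (l : ℂ) := by
      rw [Module.End.mem_eigenspace_iff]; simpa using hv
    obtain ⟨c, hc⟩ := exists_smul_eq_of_finrank_eq_one
      (le_antisymm hfin (Submodule.one_le_finrank_iff.2
        (Submodule.ne_bot_iff _ |>.2 ⟨r, hr.1, hr.2⟩)))
      (x := ⟨r, hr.1⟩) (by simpa [Subtype.ext_iff] using hr.2) ⟨v, hv'⟩
    exact ⟨c, by simpa [Subtype.ext_iff, eq_comm] using hc⟩
  -- Each column of P lies on the eigenline; its coefficient along r is the corresponding entry of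
  -- s.
  choose s hs using fun j => huniq (P *ᵥ Pi.single j 1) (hTPv _)
  have hPrs : P = Matrix.vecMulVec r s := by
    ext i j
    have := congrFun (hs j) i
    simp only [Matrix.mulVec_single_one, Matrix.col_apply, Pi.smul_apply, smul_eq_mul] at this
    rw [this, Matrix.vecMulVec_apply, mul_comm]
  have hdot : s ⬝ᵥ r = 1 := by
    have h1 := hPv r hTr
    rw [hPrs, Matrix.vecMulVec_mulVec] at h1
    obtain ⟨i, hi⟩ := Function.ne_iff.1 hr.2
    have := congrFun h1 i
    simp only [Pi.smul_apply, MulOpposite.smul_eq_mul_unop, MulOpposite.unop_op] at this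
    exact mul_left_cancel₀ hi (by rw [this, mul_one])
  refine ⟨r, s, hl, hTr, hdot, huniq, hmax, ?_⟩
  set N := (l : ℂ)⁻¹ • T - P with hN
  have hlT : (l : ℂ)⁻¹ • T = N + P := by rw [hN, sub_add_cancel]
  have hNP : N * P = 0 := by
    rw [hN, sub_mul, smul_mul_assoc, hTP, smul_smul, inv_mul_cancel₀ hlC, one_smul, hPP, sub_self]
  have hPN : P * N = 0 := by
    rw [hN, mul_sub, mul_smul_comm, hPT, smul_smul, inv_mul_cancel₀ hlC, one_smul, hPP, sub_self]
  -- The exponent is shifted by one because the identity fails for the zeroth power.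
  have hpow : ∀ k : ℕ, ((l : ℂ)⁻¹ • T) ^ (k + 1) = N ^ (k + 1) + P := by
    intro k
    induction k with
    | zero => simp [hlT]
    | succ k ih =>
      rw [pow_succ, ih, hlT, add_mul, mul_add, mul_add, hPN, hPP, ← pow_succ, pow_succ N k,
        mul_assoc, hNP, mul_zero]
      simp
  -- A nonzero eigenvalue z of N has an eigenvector killed by P, so l z is an eigenvalue of T; it
  -- differs from l because P fixes the eigenline of l.
  have hspec : ∀ z ∈ spectrum ℂ N, ‖z‖ < 1 := by
    intro z hz
    by_cases hz0 : z = 0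
    · simp [hz0]
    rw [← Matrix.spectrum_toLin', ← Module.End.hasEigenvalue_iff_mem_spectrum] at hz
    obtain ⟨v, hv⟩ := hz.exists_hasEigenvector
    have hNv : N *ᵥ v = z • v := by simpa using hv.apply_eq_smul
    have hPv0 : P *ᵥ v = 0 := by
      have h1 : P *ᵥ (N *ᵥ v) = 0 := by rw [Matrix.mulVec_mulVec, hPN, Matrix.zero_mulVec]
      rw [hNv, Matrix.mulVec_smul] at h1
      exact (smul_eq_zero.1 h1).resolve_left hz0
    have hTv : T *ᵥ v = ((l : ℂ) * z) • v := by
      rw [hN, Matrix.sub_mulVec, hPv0, sub_zero, Matrix.smul_mulVec] at hNv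
      rw [mul_smul, ← hNv, smul_smul, mul_inv_cancel₀ hlC, one_smul]
    have hne : (l : ℂ) * z ≠ l := by
      intro h
      rw [h] at hTv
      exact hv.2 (by rw [← hPv v hTv, hPv0])
    have := hgap _ (hroot _ v hv.2 hTv) hne
    rw [norm_mul, Complex.norm_real, Real.norm_of_nonneg hl.le] at this
    exact (mul_lt_iff_lt_one_right hl).1 this
  rw [← hPrs, ← tendsto_add_atTop_iff_nat 1]
  simp_rw [hpow]
  have hN0 : Tendsto (fun k : ℕ => N ^ (k + 1)) atTop (𝓝 0) := by
    refine tendsto_pi_nhds.2 fun i => tendsto_pi_nhds.2 fun j => ?_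
    exact (tendsto_pow_apply_of_spectrum_lt_one N hspec i j).comp (tendsto_add_atTop_nat 1)
  simpa using hN0.add_const P

/-! ### Expansion of ordered products of local sums -/

section Expansion

theorem prod_ofFn_sum {R ι : Type*} [Semiring R] [Fintype ι] {L : ℕ} (f : Fin L → ι → R) :
    (List.ofFn fun x => ∑ p, f x p).prod = ∑ p : Fin L → ι, (List.ofFn fun x => f x (p x)).prod := by
  induction L with
  | zero => simp
  | succ L ih =>
    rw [List.ofFn_succ, List.prod_cons, ih, ← (Fin.consEquiv fun _ => ι).sum_comp,
      Fintype.sum_prod_type, Finset.sum_mul]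
    refine Finset.sum_congr rfl fun a _ => ?_
    rw [Finset.mul_sum]
    refine Finset.sum_congr rfl fun p _ => ?_
    simp [Fin.consEquiv, List.ofFn_succ]

theorem prod_ofFn_smul {R : Type*} [Semiring R] [Algebra ℂ R] {L : ℕ} (c : Fin L → ℂ)
    (f : Fin L → R) :
    (List.ofFn fun x => c x • f x).prod = (∏ x, c x) • (List.ofFn f).prod := by
  induction L with
  | zero => simp
  | succ L ih =>
    rw [List.ofFn_succ, List.prod_cons, ih, List.ofFn_succ, List.prod_cons, Fin.prod_univ_succ,
      smul_mul_smul_comm]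

theorem prod_ofFn_sum_smul {R ι : Type*} [Semiring R] [Algebra ℂ R] [Fintype ι] {L : ℕ}
    (c : Fin L → ι → ℂ) (f : Fin L → ι → R) :
    (List.ofFn fun x => ∑ p, c x p • f x p).prod =
      ∑ p : Fin L → ι, (∏ x, c x (p x)) • (List.ofFn fun x => f x (p x)).prod := by
  rw [prod_ofFn_sum]
  exact Finset.sum_congr rfl fun p _ => prod_ofFn_smul _ _

/-- A sum over pairs of site configurations of products of local sums. -/
theorem prod_ofFn_sum_sum_smul {R ι κ : Type*} [Semiring R] [Algebra ℂ R] [Fintype ι] [Fintype κ]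
    {L : ℕ} (c : Fin L → ι → κ → ℂ) (f : Fin L → ι → κ → R) :
    (List.ofFn fun x => ∑ i, ∑ j, c x i j • f x i j).prod =
      ∑ i : Fin L → ι, ∑ j : Fin L → κ,
        (∏ x, c x (i x) (j x)) • (List.ofFn fun x => f x (i x) (j x)).prod := by
  simp_rw [← Fintype.sum_prod_type']
  rw [prod_ofFn_sum_smul (fun x (p : ι × κ) => c x p.1 p.2) (fun x p => f x p.1 p.2),
    ← (Equiv.arrowProdEquivProdArrow (Fin L) (fun _ => ι) (fun _ => κ)).sum_comp]
  rfl

end Expansion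

/-! ### Transfer matrices of on-site operators -/

variable {d χ : ℕ}

/-- The transfer matrix `∑ A^{ij} O_{ji}` of an on-site operator `O`. -/
noncomputable def opTransfer (A : Tensor d χ) (O : Matrix (Fin d) (Fin d) ℂ) :
    Matrix (Fin χ) (Fin χ) ℂ :=
  ∑ i, ∑ j, O j i • A i j

theorem opTransfer_one (A : Tensor d χ) : opTransfer A 1 = transfer A := by
  simp [opTransfer, transfer, Matrix.one_apply, ite_smul]

theorem opTransfer_smul (A : Tensor d χ) (c : ℂ) (O : Matrix (Fin d) (Fin d) ℂ) :
    opTransfer A (c • O) = c • opTransfer A O := by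
  simp [opTransfer, Finset.smul_sum, smul_smul]

theorem trace_mpdo_mul_siteProd (A : Tensor d χ) {L : ℕ} (O : Fin L → Matrix (Fin d) (Fin d) ℂ) :
    (mpdo A L * siteProd O).trace = ((List.ofFn fun x => opTransfer A (O x)).prod).trace := by
  simp only [opTransfer]
  rw [prod_ofFn_sum_sum_smul (fun x i j => O x j i) (fun _ => A)]
  simp [Matrix.trace, Matrix.mul_apply, mpdo, siteProd, Finset.sum_comm (s := Finset.univ (α := Fin χ)),
    Matrix.sum_apply, Finset.sum_mul, mul_comm]

theorem siteProd_one {L : ℕ} : siteProd (fun _ : Fin L => (1 : Matrix (Fin d) (Fin d) ℂ)) = 1 := by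
  ext i j
  simp [siteProd, Matrix.one_apply, Finset.prod_ite_zero, funext_iff]

theorem siteProd_mul {L : ℕ} (O O' : Fin L → Matrix (Fin d) (Fin d) ℂ) :
    siteProd O * siteProd O' = siteProd fun x => O x * O' x := by
  ext i j
  simp [siteProd, Matrix.mul_apply, Finset.prod_univ_sum, Finset.prod_mul_distrib]

theorem siteProd_conjTranspose {L : ℕ} (O : Fin L → Matrix (Fin d) (Fin d) ℂ) :
    (siteProd O)ᴴ = siteProd fun x => (O x)ᴴ := by
  ext i j
  simp [siteProd, Matrix.conjTranspose_apply]

theorem trace_mpdo (A : Tensor d χ) (L : ℕ) :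
    (mpdo A L).trace = (transfer A ^ L).trace := by
  have h := trace_mpdo_mul_siteProd A (L := L) (fun _ => 1)
  rw [siteProd_one, mul_one] at h
  rw [h, opTransfer_one]
  simp [List.ofFn_const, List.prod_replicate]

/-- The action of a pair of on-site matrices on the ket and on the bra index. -/
noncomputable def leftRight (u v : Matrix (Fin d) (Fin d) ℂ) (A : Tensor d χ) : Tensor d χ := fun i j =>
  ∑ i', ∑ j', (u i i' * starRingEnd ℂ (v j j')) • A i' j'

theorem mpdo_leftRight (u v : Matrix (Fin d) (Fin d) ℂ) (A : Tensor d χ) (L : ℕ) :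
    mpdo (leftRight u v A) L = siteProd (fun _ => u) * mpdo A L * (siteProd fun _ => v)ᴴ := by
  ext i j
  simp only [mpdo, leftRight, Matrix.of_apply]
  rw [prod_ofFn_sum_sum_smul (fun x i' j' => u (i x) i' * starRingEnd ℂ (v (j x) j')) (fun _ => A),
    Matrix.trace_sum]
  simp only [Matrix.trace_sum, Matrix.trace_smul, Matrix.mul_apply, siteProd, Matrix.of_apply,
    Matrix.conjTranspose_apply, Finset.sum_mul, smul_eq_mul, star_prod, Finset.prod_mul_distrib]
  rw [Finset.sum_comm]
  refine Finset.sum_congr rfl fun i' _ => Finset.sum_congr rfl fun j' _ => ?_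
  simp only [starRingEnd_apply]
  ring

theorem mpdo_hermTensor (A : Tensor d χ) (L : ℕ) : mpdo (hermTensor A) L = (mpdo A L)ᴴ := by
  ext i j
  simp only [mpdo, hermTensor, Matrix.of_apply, Matrix.conjTranspose_apply]
  have h : (List.ofFn fun x => (A (j x) (i x)).map (starRingEnd ℂ)) =
      (List.ofFn fun x => A (j x) (i x)).map (RingHom.mapMatrix (m := Fin χ) (starRingEnd ℂ)) := by
    rw [List.map_ofFn]; rfl
  rw [h, ← map_list_prod]
  simp [Matrix.trace]

/-- The transfer matrix of a transformed tensor. -/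
theorem opTransfer_leftRight (u v O : Matrix (Fin d) (Fin d) ℂ) (A : Tensor d χ) :
    opTransfer (leftRight u v A) O = opTransfer A (vᴴ * O * u) := by
  simp only [opTransfer, leftRight, Finset.smul_sum, smul_smul, Matrix.mul_apply, Finset.sum_mul,
    Finset.sum_smul, Matrix.conjTranspose_apply, starRingEnd_apply]
  calc _ = ∑ i, ∑ i', ∑ j, ∑ j', (O j i * (u i i' * star (v j j'))) • A i' j' :=
        Finset.sum_congr rfl fun i _ => Finset.sum_comm
    _ = ∑ i', ∑ i, ∑ j', ∑ j, (O j i * (u i i' * star (v j j'))) • A i' j' := by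
        rw [Finset.sum_comm]
        exact Finset.sum_congr rfl fun i' _ => Finset.sum_congr rfl fun i _ => Finset.sum_comm
    _ = ∑ i', ∑ j', ∑ i, ∑ j, (O j i * (u i i' * star (v j j'))) • A i' j' :=
        Finset.sum_congr rfl fun i' _ => Finset.sum_comm
    _ = _ := by
        refine Finset.sum_congr rfl fun i' _ => Finset.sum_congr rfl fun j' _ =>
          Finset.sum_congr rfl fun i _ => Finset.sum_congr rfl fun j _ => ?_
        congr 1; ring

theorem opTransfer_hermTensor (A : Tensor d χ) (O : Matrix (Fin d) (Fin d) ℂ) :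
    opTransfer (hermTensor A) O = (opTransfer A Oᴴ).map (starRingEnd ℂ) := by
  ext a b
  simp only [opTransfer, hermTensor, Matrix.sum_apply, Matrix.smul_apply, Matrix.map_apply,
    map_sum, Matrix.conjTranspose_apply, smul_eq_mul, map_mul, starRingEnd_apply, star_star]
  rw [Finset.sum_comm]

theorem opTransfer_gauge {A B : Tensor d χ} {c : ℂ} {V W : Matrix (Fin χ) (Fin χ) ℂ}
    (h : ∀ i j, B i j = c • (W * A i j * V)) (O : Matrix (Fin d) (Fin d) ℂ) :
    opTransfer B O = c • (W * opTransfer A O * V) := by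
  simp only [opTransfer, h, Finset.mul_sum, Finset.sum_mul, Finset.smul_sum, mul_smul_comm,
    smul_mul_assoc]
  refine Finset.sum_congr rfl fun i _ => Finset.sum_congr rfl fun j _ => smul_comm _ _ _

/-! ### A covariant right inverse of `opTransfer` -/

variable {d χ : ℕ}

theorem opTransfer_add (A : Tensor d χ) (O O' : Matrix (Fin d) (Fin d) ℂ) :
    opTransfer A (O + O') = opTransfer A O + opTransfer A O' := by
  simp [opTransfer, add_smul, Finset.sum_add_distrib]

theorem opTransfer_single (A : Tensor d χ) (i j : Fin d) :
    opTransfer A (Matrix.single j i 1) = A i j := by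
  simp only [opTransfer, Matrix.single_apply, ite_smul, one_smul, zero_smul]
  rw [Finset.sum_eq_single i, Finset.sum_eq_single j] <;> simp +contextual [eq_comm]

/-- The adjoint of `opTransfer A` with respect to the Hilbert–Schmidt inner products. -/
noncomputable def dualOp (A : Tensor d χ) (Y : Matrix (Fin χ) (Fin χ) ℂ) : Matrix (Fin d) (Fin d) ℂ :=
  Matrix.of fun j i => ((A i j)ᴴ * Y).trace

theorem dualOp_add (A : Tensor d χ) (Y Z : Matrix (Fin χ) (Fin χ) ℂ) :
    dualOp A (Y + Z) = dualOp A Y + dualOp A Z := by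
  ext; simp [dualOp, mul_add]

theorem dualOp_smul (A : Tensor d χ) (c : ℂ) (Y : Matrix (Fin χ) (Fin χ) ℂ) :
    dualOp A (c • Y) = c • dualOp A Y := by
  ext; simp [dualOp]

theorem dualOp_leftRight (u v : Matrix (Fin d) (Fin d) ℂ) (A : Tensor d χ)
    (Y : Matrix (Fin χ) (Fin χ) ℂ) :
    dualOp (leftRight u v A) Y = v * dualOp A Y * uᴴ := by
  ext j i
  simp only [dualOp, leftRight, Matrix.of_apply, Matrix.conjTranspose_sum, Matrix.mul_apply (M := v * _),
    Matrix.mul_apply (M := v), Matrix.conjTranspose_smul, Matrix.trace_sum, Finset.sum_mul,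
    smul_mul_assoc, Matrix.trace_smul, Matrix.conjTranspose_apply, smul_eq_mul, star_mul',
    starRingEnd_apply, star_star]
  refine Finset.sum_congr rfl fun i' _ => Finset.sum_congr rfl fun j' _ => ?_
  ring

theorem dualOp_gauge {A B : Tensor d χ} {c : ℂ} {V W : Matrix (Fin χ) (Fin χ) ℂ}
    (h : ∀ i j, B i j = c • (W * A i j * V)) (Y : Matrix (Fin χ) (Fin χ) ℂ) :
    dualOp B Y = dualOp A (star c • (Wᴴ * Y * Vᴴ)) := by
  ext j i
  simp only [dualOp, Matrix.of_apply, h, Matrix.conjTranspose_smul, Matrix.conjTranspose_mul,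
    smul_mul_assoc, mul_smul_comm, Matrix.trace_smul]
  congr 1
  rw [mul_assoc, Matrix.trace_mul_comm]
  simp only [mul_assoc]

theorem trace_conjTranspose_opTransfer (A : Tensor d χ) (O : Matrix (Fin d) (Fin d) ℂ)
    (Y : Matrix (Fin χ) (Fin χ) ℂ) :
    ((opTransfer A O)ᴴ * Y).trace = ∑ i, ∑ j, star (O j i) * dualOp A Y j i := by
  simp [opTransfer, Matrix.conjTranspose_sum, Matrix.conjTranspose_smul, Finset.sum_mul,
    Matrix.trace_sum, dualOp]

theorem dualOp_eq_zero {A : Tensor d χ} (h : StrongInjective A) {Y : Matrix (Fin χ) (Fin χ) ℂ}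
    (hY : dualOp A Y = 0) : Y = 0 := by
  -- `dualOp` pairs Y with (A^{ij})ᴴ, so injectivity of A is applied to the entrywise conjugate of
  -- Y.
  have h1 := @h.injective (Y.map star) 0 (by
    ext i j
    have := congrArg star (congrFun (congrFun hY j) i)
    simp only [dualOp, Matrix.of_apply, Matrix.trace, Matrix.diag_apply, Matrix.mul_apply,
      Matrix.conjTranspose_apply, Matrix.zero_apply, star_sum, star_mul', star_star, star_zero] at this
    simp only [Matrix.map_apply, Matrix.zero_apply, mul_zero, Finset.sum_const_zero]
    rw [Finset.sum_comm]
    exact this)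
  ext a b
  simpa using congrArg star (congrFun (congrFun h1 a) b)

/-- By adjointness, pairing `opTransfer A (dualOp A Y)` with Y gives the squared Hilbert–Schmidt
norm of `dualOp A Y`. -/
theorem opTransfer_dualOp_eq_zero {A : Tensor d χ} (h : StrongInjective A)
    {Y : Matrix (Fin χ) (Fin χ) ℂ} (hY : opTransfer A (dualOp A Y) = 0) : Y = 0 := by
  refine dualOp_eq_zero h ?_
  have h1 := trace_conjTranspose_opTransfer A (dualOp A Y) Y
  rw [hY, Matrix.conjTranspose_zero, zero_mul, Matrix.trace_zero] at h1
  have h2 : ∑ i, ∑ j, ‖dualOp A Y j i‖ ^ 2 = 0 := by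
    have h3 : ((∑ i, ∑ j, ‖dualOp A Y j i‖ ^ 2 : ℝ) : ℂ) = 0 := by
      rw [h1]
      push_cast
      refine Finset.sum_congr rfl fun i _ => Finset.sum_congr rfl fun j _ => ?_
      exact (Complex.conj_mul' _).symm
    exact_mod_cast h3
  ext j i
  rw [Finset.sum_eq_zero_iff_of_nonneg (fun _ _ => by positivity)] at h2
  have h3 := h2 i (Finset.mem_univ _)
  rw [Finset.sum_eq_zero_iff_of_nonneg (fun _ _ => by positivity)] at h3
  simpa using h3 j (Finset.mem_univ _)

/-- The linear automorphism `opTransfer A ∘ dualOp A` of the virtual matrices. -/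
noncomputable def gramEquiv {A : Tensor d χ} (h : StrongInjective A) :
    Matrix (Fin χ) (Fin χ) ℂ ≃ₗ[ℂ] Matrix (Fin χ) (Fin χ) ℂ :=
  LinearEquiv.ofInjectiveEndo
    { toFun := fun Y => opTransfer A (dualOp A Y)
      map_add' := fun Y Z => by rw [dualOp_add, opTransfer_add]
      map_smul' := fun c Y => by rw [dualOp_smul, opTransfer_smul]; rfl }
    ((injective_iff_map_eq_zero _).2 fun _ hY => opTransfer_dualOp_eq_zero h hY)

theorem gramEquiv_apply {A : Tensor d χ} (h : StrongInjective A) (Y : Matrix (Fin χ) (Fin χ) ℂ) :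
    gramEquiv h Y = opTransfer A (dualOp A Y) := rfl

/-- The operator of minimal norm with a given transfer matrix. -/
noncomputable def liftOp {A : Tensor d χ} (h : StrongInjective A) (X : Matrix (Fin χ) (Fin χ) ℂ) :
    Matrix (Fin d) (Fin d) ℂ := dualOp A ((gramEquiv h).symm X)

theorem opTransfer_liftOp {A : Tensor d χ} (h : StrongInjective A) (X : Matrix (Fin χ) (Fin χ) ℂ) :
    opTransfer A (liftOp h X) = X := by
  rw [liftOp, ← gramEquiv_apply h, LinearEquiv.apply_symm_apply]

/-- A general preimage of X need not carry a charge. The range of `dualOp A` is stable under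
conjugation by u, because the tensor is covariant, and `opTransfer A` is injective on it; hence the
charge can be checked on the transfer matrix. -/
theorem liftOp_charge {A : Tensor d χ} (h : StrongInjective A) {u : Matrix (Fin d) (Fin d) ℂ}
    (hu : uᴴ * u = 1) {V : GL (Fin χ) ℂ}
    (hV : ∀ i j, leftRight u u A i j = V⁻¹.val * A i j * V.val)
    {X : Matrix (Fin χ) (Fin χ) ℂ} {a : ℂ} (hX : V.val * X * V⁻¹.val = a • X) :
    u * liftOp h X * uᴴ = a • liftOp h X := by
  have hV' : ∀ i j, leftRight u u A i j = (1 : ℂ) • (V⁻¹.val * A i j * V.val) := by simpa using hV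
  set Y := (gramEquiv h).symm X with hY
  obtain ⟨Z, hZ⟩ : ∃ Z, u * dualOp A Y * uᴴ = dualOp A Z :=
    ⟨_, (dualOp_leftRight u u A Y).symm.trans (dualOp_gauge hV' Y)⟩
  have h1 : opTransfer A (dualOp A Y) = X := opTransfer_liftOp h X
  have h2 : gramEquiv h Z = gramEquiv h (a • Y) := by
    have h3 := opTransfer_leftRight u u (u * dualOp A Y * uᴴ) A
    rw [opTransfer_gauge hV', one_smul] at h3
    have h4 : uᴴ * (u * dualOp A Y * uᴴ) * u = dualOp A Y := by
      calc _ = (uᴴ * u) * dualOp A Y * (uᴴ * u) := by simp only [mul_assoc]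
        _ = _ := by rw [hu, one_mul, mul_one]
    rw [h4, h1, hZ] at h3
    rw [map_smul, gramEquiv_apply, gramEquiv_apply, h1, ← hX, ← h3]
    simp [mul_assoc]
  rw [liftOp, ← hY, hZ, (gramEquiv h).injective h2, dualOp_smul]

/-! ### Fundamental theorem for injective tensors -/

section FundamentalTheorem

theorem trace_opTransfer_two {A B : Tensor d χ} {c : ℂ} (h : mpdo B 2 = c • mpdo A 2)
    (O₁ O₂ : Matrix (Fin d) (Fin d) ℂ) :
    (opTransfer B O₁ * opTransfer B O₂).trace = c * (opTransfer A O₁ * opTransfer A O₂).trace := by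
  have h1 := trace_mpdo_mul_siteProd B ![O₁, O₂]
  have h2 := trace_mpdo_mul_siteProd A ![O₁, O₂]
  rw [h, smul_mul_assoc, Matrix.trace_smul, h2] at h1
  simpa [List.ofFn_succ] using h1.symm

theorem trace_opTransfer_three {A B : Tensor d χ} {c : ℂ} (h : mpdo B 3 = c • mpdo A 3)
    (O₁ O₂ O₃ : Matrix (Fin d) (Fin d) ℂ) :
    (opTransfer B O₁ * opTransfer B O₂ * opTransfer B O₃).trace =
      c * (opTransfer A O₁ * opTransfer A O₂ * opTransfer A O₃).trace := by
  have h1 := trace_mpdo_mul_siteProd B ![O₁, O₂, O₃]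
  have h2 := trace_mpdo_mul_siteProd A ![O₁, O₂, O₃]
  rw [h, smul_mul_assoc, Matrix.trace_smul, h2] at h1
  simpa [List.ofFn_succ, mul_assoc] using h1.symm

theorem eq_of_trace_mul_eq {X Y : Matrix (Fin χ) (Fin χ) ℂ}
    (h : ∀ Z, (X * Z).trace = (Y * Z).trace) : X = Y :=
  Matrix.ext_iff_trace_mul_right.2 h

/-- A bijective multiplicative linear endomorphism of a matrix algebra is inner. -/
theorem exists_conj_of_multiplicative (Φ : Matrix (Fin χ) (Fin χ) ℂ ≃ₗ[ℂ] Matrix (Fin χ) (Fin χ) ℂ)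
    (hΦ : ∀ X Y, Φ (X * Y) = Φ X * Φ Y) :
    ∃ V : GL (Fin χ) ℂ, ∀ X, Φ X = V⁻¹.val * X * V.val := by
  -- Unitality is not assumed; it follows from multiplicativity and surjectivity.
  have h1 : Φ 1 = 1 := by
    obtain ⟨E, hE⟩ := Φ.surjective 1
    have := hΦ 1 E
    rw [one_mul, hE, mul_one] at this
    exact this.symm
  let e : Matrix (Fin χ) (Fin χ) ℂ ≃ₐ[ℂ] Matrix (Fin χ) (Fin χ) ℂ :=
    AlgEquiv.ofLinearEquiv Φ h1 hΦ
  obtain ⟨T, hT⟩ := AlgEquiv.eq_linearEquivConjAlgEquiv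
    ((Matrix.toLinAlgEquiv' (R := ℂ) (n := Fin χ)).symm.trans (e.trans Matrix.toLinAlgEquiv'))
  -- Skolem–Noether gives T X T⁻¹, whereas the gauge convention is V⁻¹ X V; hence V is the matrix of
  -- T⁻¹.
  let V : GL (Fin χ) ℂ :=
    { val := LinearMap.toMatrix' T.symm.toLinearMap
      inv := LinearMap.toMatrix' T.toLinearMap
      val_inv := by rw [← LinearMap.toMatrix'_comp]; simp
      inv_val := by rw [← LinearMap.toMatrix'_comp]; simp }
  refine ⟨V, fun X => ?_⟩
  have h2 := DFunLike.congr_fun hT (Matrix.toLinAlgEquiv' X)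
  have h3 : Matrix.toLin' (Φ X) = T.toLinearMap ∘ₗ Matrix.toLin' X ∘ₗ T.symm.toLinearMap := by
    simpa [LinearEquiv.conjAlgEquiv_apply, e] using! h2
  have h4 := congrArg LinearMap.toMatrix' h3
  rw [LinearMap.toMatrix'_toLin', LinearMap.toMatrix'_comp, LinearMap.toMatrix'_comp,
    LinearMap.toMatrix'_toLin', ← mul_assoc] at h4
  exact h4

/-- **Fundamental theorem** for injective tensors that generate the same operators on two and
three sites up to phases. -/
theorem exists_gauge {A B : Tensor d χ} (hA : StrongInjective A) {c₂ c₃ : Circle}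
    (h₂ : mpdo B 2 = (c₂ : ℂ) • mpdo A 2) (h₃ : mpdo B 3 = (c₃ : ℂ) • mpdo A 3) :
    ∃ (κ : Circle) (V : GL (Fin χ) ℂ), ∀ i j, B i j = (κ : ℂ) • (V⁻¹.val * A i j * V.val) := by
  let Φ₀ : Matrix (Fin χ) (Fin χ) ℂ →ₗ[ℂ] Matrix (Fin χ) (Fin χ) ℂ :=
    { toFun := fun X => opTransfer B (liftOp hA X)
      map_add' := fun X Y => by simp only [liftOp, map_add, dualOp_add, opTransfer_add]
      map_smul' := fun c X => by simp only [liftOp, map_smul, dualOp_smul, opTransfer_smul]; rfl }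
  have hΦ₀ : ∀ X, Φ₀ X = opTransfer B (liftOp hA X) := fun _ => rfl
  have htr : ∀ O X, (opTransfer B O * Φ₀ X).trace = c₂ * (opTransfer A O * X).trace := by
    intro O X
    rw [hΦ₀, trace_opTransfer_two h₂, opTransfer_liftOp]
  have hinj : Function.Injective Φ₀ := by
    refine (injective_iff_map_eq_zero _).2 fun X hX => eq_of_trace_mul_eq fun Z => ?_
    have := htr (liftOp hA X) Z
    rw [← hΦ₀, hX, opTransfer_liftOp] at this
    simpa using this.symm
  let Φ := LinearEquiv.ofInjectiveEndo Φ₀ hinj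
  have hΦ : ∀ X, Φ X = Φ₀ X := fun _ => rfl
  -- Independence of the chosen preimage: two sites show that both sides have the same trace against
  -- every Φ Y, and these exhaust the matrices.
  have hlift : ∀ O, opTransfer B O = Φ (opTransfer A O) := by
    intro O
    refine eq_of_trace_mul_eq fun Z => ?_
    obtain ⟨Y, rfl⟩ := Φ.surjective Z
    rw [hΦ, htr, hΦ, hΦ₀ (opTransfer A O), htr, opTransfer_liftOp]
  -- Three sites compare Φ X Φ Y with Φ (XY), two sites normalize the pairing; the defect is the
  -- constant phase c₃/c₂, and dividing Φ by it yields an algebra homomorphism.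
  have hmul : ∀ X Y, Φ X * Φ Y = ((c₃ / c₂ : Circle) : ℂ) • Φ (X * Y) := by
    intro X Y
    refine eq_of_trace_mul_eq fun Z => ?_
    obtain ⟨W, rfl⟩ := Φ.surjective Z
    rw [smul_mul_assoc, Matrix.trace_smul, smul_eq_mul, hΦ (X * Y), hΦ₀, hΦ W, htr,
      opTransfer_liftOp, hΦ, hΦ, hΦ₀, hΦ₀, hΦ₀, trace_opTransfer_three h₃]
    simp only [opTransfer_liftOp]
    rw [Circle.coe_div]
    field_simp [Circle.coe_ne_zero c₂]
  set κ : Circle := c₃ / c₂ with hκ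
  have hκ0 : (κ : ℂ) ≠ 0 := Circle.coe_ne_zero κ
  obtain ⟨V, hV⟩ := exists_conj_of_multiplicative
    (Φ.trans (LinearEquiv.smulOfNeZero ℂ _ (κ : ℂ)⁻¹ (inv_ne_zero hκ0))) (fun X Y => by
      simp only [LinearEquiv.trans_apply, LinearEquiv.smulOfNeZero_apply]
      rw [smul_mul_smul_comm, hmul, smul_smul, mul_assoc, inv_mul_cancel₀ hκ0, mul_one])
  refine ⟨κ, V, fun i j => ?_⟩
  rw [← hV, ← opTransfer_single A, ← opTransfer_single B, hlift]
  simp only [LinearEquiv.trans_apply, LinearEquiv.smulOfNeZero_apply]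
  rw [smul_smul, mul_inv_cancel₀ hκ0, one_smul]

end FundamentalTheorem

/-! ### Composition rules for the ket, bra and Hermiticity actions -/

section LeftRight

variable {d χ : ℕ}

theorem leftRight_apply (u v : Matrix (Fin d) (Fin d) ℂ) (A : Tensor d χ) (i j : Fin d)
    (a b : Fin χ) :
    leftRight u v A i j a b = (u * (Matrix.of fun i j => A i j a b) * vᴴ) i j := by
  simp only [leftRight, Matrix.sum_apply, Matrix.smul_apply, Matrix.mul_apply, Matrix.of_apply,
    Matrix.conjTranspose_apply, Finset.sum_mul, smul_eq_mul, starRingEnd_apply]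
  rw [Finset.sum_comm]
  exact Finset.sum_congr rfl fun _ _ => Finset.sum_congr rfl fun _ _ => by ring

theorem leftRight_leftRight (u v u' v' : Matrix (Fin d) (Fin d) ℂ) (A : Tensor d χ) :
    leftRight u v (leftRight u' v' A) = leftRight (u * u') (v * v') A := by
  ext i j a b
  have h : (Matrix.of fun i j => leftRight u' v' A i j a b) =
      u' * (Matrix.of fun i j => A i j a b) * v'ᴴ := by
    ext i j; rw [Matrix.of_apply, leftRight_apply]
  rw [leftRight_apply, leftRight_apply, h, Matrix.conjTranspose_mul]
  simp only [mul_assoc]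

theorem hermTensor_leftRight (u v : Matrix (Fin d) (Fin d) ℂ) (A : Tensor d χ) :
    hermTensor (leftRight u v A) = leftRight v u (hermTensor A) := by
  ext i j a b
  have h : (Matrix.of fun i j => hermTensor A i j a b) = (Matrix.of fun i j => A i j a b)ᴴ := by
    ext i j; rfl
  have h2 : hermTensor (leftRight u v A) i j a b = star (leftRight u v A j i a b) := rfl
  rw [h2, leftRight_apply, leftRight_apply, h, ← Matrix.conjTranspose_apply,
    Matrix.conjTranspose_mul, Matrix.conjTranspose_mul, Matrix.conjTranspose_conjTranspose, mul_assoc]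

theorem hermTensor_hermTensor (A : Tensor d χ) : hermTensor (hermTensor A) = A := by
  ext i j a b; simp [hermTensor]

theorem leftRight_gauge {A B : Tensor d χ} {c : ℂ} {V W : Matrix (Fin χ) (Fin χ) ℂ}
    (h : ∀ i j, B i j = c • (W * A i j * V)) (u v : Matrix (Fin d) (Fin d) ℂ) (i j : Fin d) :
    leftRight u v B i j = c • (W * leftRight u v A i j * V) := by
  simp only [leftRight, h, Finset.mul_sum, Finset.sum_mul, Finset.smul_sum, mul_smul_comm,
    smul_mul_assoc]
  exact Finset.sum_congr rfl fun i _ => Finset.sum_congr rfl fun j _ => smul_comm _ _ _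

theorem hermTensor_gauge {A B : Tensor d χ} {c : ℂ} {V : GL (Fin χ) ℂ}
    (h : ∀ i j, B i j = c • (V⁻¹.val * A i j * V.val)) (i j : Fin d) :
    hermTensor B i j = star c • ((Matrix.GeneralLinearGroup.map (starRingEnd ℂ) V)⁻¹.val *
      hermTensor A i j * (Matrix.GeneralLinearGroup.map (starRingEnd ℂ) V).val) := by
  have hs : ∀ (c : ℂ) (M : Matrix (Fin χ) (Fin χ) ℂ),
      (c • M).map (starRingEnd ℂ) = star c • M.map (starRingEnd ℂ) := by
    intro c M; ext; simp
  rw [hermTensor, h, hs, Matrix.map_mul, Matrix.map_mul, ← map_inv]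
  rfl

end LeftRight

/-! ### The virtual projective representation of the doubled group -/

section Doubled

variable {G K : Type*} [Group G] [Group K]

/-- The action of the doubled group on arbitrary tensors. -/
noncomputable def SymmetricMPDO.actOn (ρ : SymmetricMPDO G K) (x : DoubledGroup G K)
    {χ : ℕ} (B : Tensor ρ.d χ) : Tensor ρ.d χ :=
  leftRight (ρ.onSite (x.left.1, x.left.2.2)).val (ρ.onSite (x.left.2.1, x.left.2.2)).val
    (if antiSign G K x = 1 then B else hermTensor B)

theorem SymmetricMPDO.act_eq (ρ : SymmetricMPDO G K) (x : DoubledGroup G K) :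
    ρ.act x = ρ.actOn x ρ.A := by
  funext i j
  simp only [SymmetricMPDO.act, SymmetricMPDO.actOn, leftRight]
  split_ifs <;> rfl

/-- `hermTensor` exchanges the ket and bra matrices, which is precisely the twist by `swapAut` in
the semidirect product. -/
theorem SymmetricMPDO.actOn_mul (ρ : SymmetricMPDO G K) (x y : DoubledGroup G K)
    {χ : ℕ} (B : Tensor ρ.d χ) : ρ.actOn (x * y) B = ρ.actOn x (ρ.actOn y B) := by
  have hval : ∀ p q : G × K, (ρ.onSite p).val * (ρ.onSite q).val = (ρ.onSite (p * q)).val := by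
    intro p q; rw [map_mul]; rfl
  simp only [SymmetricMPDO.actOn, antiSign, SemidirectProduct.mul_left, SemidirectProduct.mul_right,
    SemidirectProduct.rightHom_eq_right]
  obtain ⟨⟨g, h, k⟩, s⟩ := x
  obtain ⟨⟨g', h', k'⟩, t⟩ := y
  rcases Int.units_eq_one_or s with rfl | rfl <;> rcases Int.units_eq_one_or t with rfl | rfl <;>
    simp [-SemidirectProduct.mk_eq_inl_mul_inr, hermAction, swapAut, hermTensor_leftRight, leftRight_leftRight,
      hval, hermTensor_hermTensor]

theorem globalOp_mul {d : ℕ} (u v : Matrix.unitaryGroup (Fin d) ℂ) (L : ℕ) :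
    globalOp (u * v) L = globalOp u L * globalOp v L := by
  simp [globalOp, siteProd_mul]

/-- H acts trivially because ρ_L is Hermitian, K by weak symmetry, and the two copies of G
contribute the phase of the ket and the inverse phase of the bra. -/
theorem SymmetricMPDO.mpdo_act (ρ : SymmetricMPDO G K) (x : DoubledGroup G K) (L : ℕ) :
    ∃ c : Circle, mpdo (ρ.act x) L = (c : ℂ) • mpdo ρ.A L := by
  have hherm : mpdo (hermTensor ρ.A) L = mpdo ρ.A L := by
    rw [mpdo_hermTensor]; exact (ρ.posSemidef L).isHermitian
  have hB : mpdo (if antiSign G K x = 1 then ρ.A else hermTensor ρ.A) L = mpdo ρ.A L := by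
    split_ifs
    · rfl
    · exact hherm
  have hon : ∀ g k, ρ.onSite (g, k) = ρ.U g * ρ.W k := fun g k => rfl
  obtain ⟨a, ha, -⟩ := ρ.strong L x.left.1
  obtain ⟨b, -, hb⟩ := ρ.strong L x.left.2.1
  refine ⟨a * b⁻¹, ?_⟩
  rw [ρ.act_eq, SymmetricMPDO.actOn, mpdo_leftRight, hB]
  change globalOp (ρ.onSite _) L * mpdo ρ.A L * (globalOp (ρ.onSite _) L)ᴴ = _
  rw [hon, hon, globalOp_mul, globalOp_mul, Matrix.conjTranspose_mul]
  calc _ = globalOp (ρ.U x.left.1) L * (globalOp (ρ.W x.left.2.2) L * mpdo ρ.A L *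
        (globalOp (ρ.W x.left.2.2) L)ᴴ) * (globalOp (ρ.U x.left.2.1) L)ᴴ := by
        simp only [mul_assoc]
    _ = _ := by
        rw [ρ.weak, ha, smul_mul_assoc, hb, smul_smul, Circle.coe_mul]

/-- For χ = 0 the characteristic polynomial is 1 and has no root of multiplicity one. -/
theorem StrongInjective.pos {d χ : ℕ} {A : Tensor d χ} (h : StrongInjective A) : 0 < χ := by
  obtain ⟨l, hl, -⟩ := h.gap
  rcases Nat.eq_zero_or_pos χ with rfl | h0
  · rw [Matrix.charpoly, Matrix.det_isEmpty, ← Polynomial.C_1, Polynomial.rootMultiplicity_C] at hl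
    exact absurd hl zero_ne_one
  · exact h0

theorem exists_scalar_of_commute {n : ℕ} {M : Matrix (Fin n) (Fin n) ℂ}
    (h : ∀ X, M * X = X * M) : ∃ c : ℂ, M = c • 1 := by
  obtain ⟨c, hc⟩ := Matrix.mem_range_scalar_iff_commute_single'.2
    fun i j => (h (Matrix.single i j 1)).symm
  exact ⟨c, by rw [← hc, Matrix.scalar_apply, Matrix.smul_one_eq_diagonal]⟩

/-- V_x ˣV_y and V_{xy} implement the same transformation of A up to scalars. Since the transfer
matrices of A fill the whole matrix algebra, conjugation by their quotient M is a scalar map; it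
fixes 1, so M is central. -/
theorem SymmetricMPDO.exists_projective (ρ : SymmetricMPDO G K)
    {V : DoubledGroup G K → GL (Fin ρ.χ) ℂ} {κ : DoubledGroup G K → Circle}
    (hV : ∀ x i j, ρ.act x i j = (κ x : ℂ) • ((V x)⁻¹.val * ρ.A i j * (V x).val))
    (x y : DoubledGroup G K) : ∃ c : ℂ, (V x * twist x (V y)).val = c • (V (x * y)).val := by
  have hinj := ρ.strongInjective
  have : Nonempty (Fin ρ.χ) := ⟨⟨0, hinj.pos⟩⟩
  obtain ⟨k₁, hk₁, h1⟩ : ∃ k₁ : ℂ, k₁ ≠ 0 ∧ ∀ i j, ρ.act (x * y) i j =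
      k₁ • ((V x * twist x (V y))⁻¹.val * ρ.A i j * (V x * twist x (V y)).val) := by
    have hxy : ρ.act (x * y) = ρ.actOn x (ρ.act y) := by rw [ρ.act_eq, ρ.actOn_mul, ← ρ.act_eq]
    have hA := ρ.act_eq x
    have hcomb : ∀ (c : ℂ) (W : GL (Fin ρ.χ) ℂ), (∀ i j, ρ.act (x * y) i j =
          c • (W⁻¹.val * ρ.act x i j * W.val)) → ∀ i j, ρ.act (x * y) i j =
          (c * κ x) • ((V x * W)⁻¹.val * ρ.A i j * (V x * W).val) := by
      intro c W h i j
      rw [h, hV, mul_smul_comm, smul_mul_assoc, smul_smul, mul_inv_rev]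
      simp only [Units.val_mul, mul_assoc]
    rw [SymmetricMPDO.actOn] at hA hxy
    by_cases hs : antiSign G K x = 1
    · rw [if_pos hs] at hA hxy
      refine ⟨κ y * κ x, by simp, hcomb _ _ fun i j => ?_⟩
      rw [hxy, hA, twist, if_pos hs]
      exact leftRight_gauge (hV y) _ _ i j
    · rw [if_neg hs] at hA hxy
      refine ⟨star (κ y : ℂ) * κ x, by simp, hcomb _ _ fun i j => ?_⟩
      rw [hxy, hA, twist, if_neg hs]
      exact leftRight_gauge (hermTensor_gauge (hV y)) _ _ i j
  set W := V x * twist x (V y) with hW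
  set M := W * (V (x * y))⁻¹ with hM
  have hκ0 : (κ (x * y) : ℂ) ≠ 0 := Circle.coe_ne_zero _
  have h2 : ∀ X, M⁻¹.val * X * M.val = (κ (x * y) / k₁ : ℂ) • X := by
    intro X
    rw [← opTransfer_liftOp hinj X]
    have e1 := opTransfer_gauge h1 (liftOp hinj X)
    have e2 := opTransfer_gauge (hV (x * y)) (liftOp hinj X)
    rw [e1] at e2
    set Z := opTransfer ρ.A (liftOp hinj X)
    have e3 : W⁻¹.val * Z * W.val = (κ (x * y) / k₁ : ℂ) • ((V (x * y))⁻¹.val * Z * (V (x * y)).val) := by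
      rw [div_eq_inv_mul, mul_smul, ← e2, smul_smul, inv_mul_cancel₀ hk₁, one_smul]
    calc M⁻¹.val * Z * M.val = (V (x * y)).val * (W⁻¹.val * Z * W.val) * (V (x * y))⁻¹.val := by
          rw [hM, mul_inv_rev, inv_inv]; simp only [Units.val_mul, mul_assoc]
      _ = _ := by
          rw [e3, mul_smul_comm, smul_mul_assoc]
          congr 1
          simp [mul_assoc]
  have h3 : (κ (x * y) / k₁ : ℂ) = 1 := by
    have := h2 1
    rw [mul_one, Units.inv_mul] at this
    have h4 := congrFun (congrFun this ⟨0, hinj.pos⟩) ⟨0, hinj.pos⟩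
    simpa using h4.symm
  obtain ⟨c, hc⟩ := exists_scalar_of_commute (M := M.val) fun X => by
    have := h2 X
    rw [h3, one_smul] at this
    calc M.val * X = M.val * (M⁻¹.val * X * M.val) := by rw [this]
      _ = _ := by simp [mul_assoc]
  refine ⟨c, ?_⟩
  calc W.val = M.val * (V (x * y)).val := by rw [hM]; simp
    _ = _ := by rw [hc, smul_mul_assoc, one_mul]

theorem SymmetricMPDO.exists_isProjectiveAction (ρ : SymmetricMPDO G K) :
    ∃ (V : DoubledGroup G K → GL (Fin ρ.χ) ℂ) (ω : DoubledGroup G K → DoubledGroup G K → Circle),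
      ρ.IsProjectiveAction V ω := by
  have hinj := ρ.strongInjective
  have hχ := hinj.pos
  have hg : ∀ x, ∃ (κ : Circle) (V : GL (Fin ρ.χ) ℂ), ∀ i j,
      ρ.act x i j = (κ : ℂ) • (V⁻¹.val * ρ.A i j * V.val) := by
    intro x
    obtain ⟨c₂, h₂⟩ := ρ.mpdo_act x 2
    obtain ⟨c₃, h₃⟩ := ρ.mpdo_act x 3
    exact exists_gauge hinj h₂ h₃
  choose κ V₀ hV₀ using hg
  have hdet0 : ∀ x, (V₀ x).val.det ≠ 0 := fun x => ((Matrix.isUnit_iff_isUnit_det _).1 (V₀ x).isUnit).ne_zero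
  -- Rescaling by |det V₀|^{-1/χ} makes |det V| = 1. Taking determinants in V_x ˣV_y = c V_{xy} then
  -- gives |c|^χ = 1, so c is a phase.
  let z : DoubledGroup G K → ℂˣ := fun x =>
    Units.mk0 (((‖(V₀ x).val.det‖ ^ (-(1 / ρ.χ : ℝ)) : ℝ)) : ℂ) (by
      have := hdet0 x
      exact_mod_cast (Real.rpow_pos_of_pos (norm_pos_iff.2 this) _).ne')
  let V : DoubledGroup G K → GL (Fin ρ.χ) ℂ := fun x =>
    Units.map (algebraMap ℂ (Matrix (Fin ρ.χ) (Fin ρ.χ) ℂ)).toMonoidHom (z x) * V₀ x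
  have hVval : ∀ x, (V x).val = (z x : ℂ) • (V₀ x).val := fun x => (Algebra.smul_def _ _).symm
  have hVinv : ∀ x, (V x)⁻¹.val = ((z x)⁻¹ : ℂ) • (V₀ x)⁻¹.val := by
    intro x
    refine Units.inv_eq_of_mul_eq_one_right ?_
    rw [hVval, smul_mul_smul_comm, mul_inv_cancel₀ (z x).ne_zero, one_smul, Units.mul_inv]
  have hV : ∀ x i j, ρ.act x i j = (κ x : ℂ) • ((V x)⁻¹.val * ρ.A i j * (V x).val) := by
    intro x i j
    rw [hV₀, hVval, hVinv, smul_mul_assoc, smul_mul_smul_comm, inv_mul_cancel₀ (z x).ne_zero,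
      one_smul]
  have hdet : ∀ x, ‖(V x).val.det‖ = 1 := by
    intro x
    have h0 := norm_pos_iff.2 (hdet0 x)
    have hz : ‖(z x : ℂ)‖ = ‖(V₀ x).val.det‖ ^ (-(1 / ρ.χ : ℝ)) := by
      change ‖((‖(V₀ x).val.det‖ ^ (-(1 / ρ.χ : ℝ)) : ℝ) : ℂ)‖ = _
      rw [Complex.norm_real, Real.norm_of_nonneg (Real.rpow_nonneg h0.le _)]
    have hχ' : (ρ.χ : ℝ) ≠ 0 := by exact_mod_cast hχ.ne'
    rw [hVval, Matrix.det_smul, norm_mul, norm_pow, hz, Fintype.card_fin, ← Real.rpow_natCast,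
      ← Real.rpow_mul h0.le, neg_mul, one_div, inv_mul_cancel₀ hχ', Real.rpow_neg_one,
      inv_mul_cancel₀ h0.ne']
  have hdet' : ∀ (x y : DoubledGroup G K), ‖(twist x (V y)).val.det‖ = 1 := by
    intro x y
    rw [twist]
    split_ifs
    · exact hdet y
    · rw [← hdet y, ← Complex.norm_conj (V y).val.det, RingHom.map_det]
      rfl
  choose c hc using ρ.exists_projective hV
  have hnorm : ∀ x y, ‖c x y‖ = 1 := by
    intro x y
    have h1 := congrArg (fun M : Matrix (Fin ρ.χ) (Fin ρ.χ) ℂ => ‖M.det‖) (hc x y)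
    simp only [Units.val_mul, Matrix.det_mul, norm_mul, Matrix.det_smul, hdet, hdet', norm_pow,
      Fintype.card_fin, mul_one] at h1
    exact (pow_eq_one_iff_of_nonneg (norm_nonneg _) hχ.ne').1 h1.symm
  refine ⟨V, fun x y => ⟨c x y, mem_sphere_zero_iff_norm.2 (hnorm x y)⟩, ⟨κ, hV⟩, hc⟩

end Doubled

/-! ### The dominant eigenvector and its behaviour under gauge transformations -/

section Dominance

/-- Only positivity of l is missing. If l ≤ 0, no other root can have modulus below l, so χ = 1 and
tr ρ_1 = l; positivity of ρ_1 forces l = 0 and ρ_1 = 0, contradicting injectivity. -/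
theorem SymmetricMPDO.exists_dominant {G K : Type*} [Group G] [Group K] (ρ : SymmetricMPDO G K) :
    ∃ l r s, Dominant (transfer ρ.A) l r s := by
  have hinj := ρ.strongInjective
  obtain ⟨l, hmult, hgap⟩ := hinj.gap
  suffices hl : 0 < l by
    obtain ⟨r, s, h⟩ := MixedSPT.exists_dominant hl hmult hgap
    exact ⟨l, r, s, h⟩
  by_contra hneg
  have hroots : ∀ m ∈ (transfer ρ.A).charpoly.roots, m = (l : ℂ) := by
    intro m hm
    by_contra hne
    exact absurd ((norm_nonneg m).trans_lt (hgap m (Polynomial.isRoot_of_mem_roots hm) hne)) hneg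
  have hrep := Multiset.eq_replicate_card.2 hroots
  have hcard : (transfer ρ.A).charpoly.roots.card = 1 := by
    rw [← hmult, ← Polynomial.count_roots]
    conv_rhs => rw [hrep]
    rw [Multiset.count_replicate_self]
  have htr : (transfer ρ.A).trace = l := by
    rw [Matrix.trace_eq_sum_roots_charpoly, hrep, hcard]
    simp
  have hχ : ρ.χ = 1 := by
    have h1 := (IsAlgClosed.splits (transfer ρ.A).charpoly).natDegree_eq_card_roots
    rw [hcard, Matrix.charpoly_natDegree_eq_dim, Fintype.card_fin] at h1
    exact h1
  have hps := ρ.posSemidef 1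
  have htr1 : (mpdo ρ.A 1).trace = l := by rw [trace_mpdo, pow_one, htr]
  have hl0 : (l : ℂ) = 0 := by
    have h1 := hps.trace_nonneg
    rw [htr1] at h1
    have h2 : (0 : ℝ) ≤ l := by exact_mod_cast h1
    exact_mod_cast le_antisymm (not_lt.1 hneg) h2
  have hzero : mpdo ρ.A 1 = 0 := hps.trace_eq_zero_iff.1 (htr1.trans hl0)
  have h1 := @hinj.injective 1 0 (by
    ext i j
    have h2 := congrFun (congrFun hzero (fun _ => i)) (fun _ => j)
    simp only [mpdo, Matrix.of_apply, List.ofFn_succ, List.ofFn_zero, List.prod_cons, List.prod_nil,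
      mul_one, Matrix.zero_apply] at h2
    simp only [Matrix.zero_apply, mul_zero, Finset.sum_const_zero]
    rw [← h2, Matrix.trace]
    simp [Matrix.one_apply])
  have h2 := congrFun (congrFun h1 ⟨0, hinj.pos⟩) ⟨0, hinj.pos⟩
  simp at h2

variable {n : ℕ} {T T' : Matrix (Fin n) (Fin n) ℂ} {l : ℝ} {r s r' s' : Fin n → ℂ}

theorem Dominant.right_ne_zero (h : Dominant T l r s) : r ≠ 0 := by
  rintro rfl
  simpa using h.dot

/-- Conjugation keeps the dominant eigenvalue because l is real; this is what lets the Hermiticity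
symmetry be treated by the same gauge argument. -/
theorem Dominant.map_conj (h : Dominant T l r s) :
    Dominant (T.map (starRingEnd ℂ)) l (fun i => starRingEnd ℂ (r i))
      (fun i => starRingEnd ℂ (s i)) := by
  have hmv : ∀ v : Fin n → ℂ, T.map (starRingEnd ℂ) *ᵥ v =
      fun i => starRingEnd ℂ ((T *ᵥ fun i => starRingEnd ℂ (v i)) i) := by
    intro v; ext i; simp [Matrix.mulVec, dotProduct]
  have hback : ∀ (m : ℂ) v, T.map (starRingEnd ℂ) *ᵥ v = m • v →
      (T *ᵥ fun i => starRingEnd ℂ (v i)) = starRingEnd ℂ m • fun i => starRingEnd ℂ (v i) := by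
    intro m v hv
    rw [hmv] at hv
    ext i
    have := congrArg (starRingEnd ℂ) (congrFun hv i)
    simpa using this
  refine ⟨h.pos, ?_, ?_, ?_, ?_, ?_⟩
  · rw [hmv]
    ext i
    simp [h.eig]
  · have := congrArg (starRingEnd ℂ) h.dot
    simpa [dotProduct] using this
  · intro v hv
    have h1 := hback _ _ hv
    rw [Complex.conj_ofReal] at h1
    obtain ⟨c, hc⟩ := h.unique _ h1
    refine ⟨starRingEnd ℂ c, ?_⟩
    ext i
    have := congrArg (starRingEnd ℂ) (congrFun hc i)
    simpa using this
  · intro m v hv0 hv hle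
    have h1 := h.max _ (fun i => starRingEnd ℂ (v i)) (by
      intro h0
      refine hv0 ?_
      ext i
      simpa using congrFun h0 i) (hback _ _ hv) (by simpa using hle)
    simpa using congrArg (starRingEnd ℂ) h1
  · have hpow : ∀ k : ℕ, ((l : ℂ)⁻¹ • T.map (starRingEnd ℂ)) ^ k =
        (((l : ℂ)⁻¹ • T) ^ k).map (starRingEnd ℂ) := by
      intro k
      have h1 : (l : ℂ)⁻¹ • T.map (starRingEnd ℂ) =
          RingHom.mapMatrix (starRingEnd ℂ) ((l : ℂ)⁻¹ • T) := by
        ext i j; simp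
      rw [h1, ← map_pow]
      rfl
    simp_rw [hpow]
    refine tendsto_pi_nhds.2 fun i => tendsto_pi_nhds.2 fun j => ?_
    have h1 := (tendsto_pi_nhds.1 (tendsto_pi_nhds.1 h.tendsto i)) j
    have h2 := (Complex.continuous_conj.tendsto _).comp h1
    simpa [Matrix.vecMulVec_apply] using! h2

/-- A gauge transformation up to a phase between matrices with the same dominant eigenvalue has
trivial phase and maps dominant eigenvector to dominant eigenvector. -/
theorem Dominant.gauge (h : Dominant T l r s) (h' : Dominant T' l r' s') {κ : Circle}
    {V : GL (Fin n) ℂ} (hT : T' = (κ : ℂ) • (V⁻¹.val * T * V.val)) :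
    κ = 1 ∧ (∃ c : ℂ, c ≠ 0 ∧ V.val *ᵥ r' = c • r) ∧
      V.val * Matrix.vecMulVec r' s' = Matrix.vecMulVec r s * V.val := by
  have hκ0 : (κ : ℂ) ≠ 0 := Circle.coe_ne_zero κ
  have hVT : V.val * T' = (κ : ℂ) • (T * V.val) := by
    rw [hT, mul_smul_comm, ← mul_assoc, ← mul_assoc, Units.mul_inv, one_mul]
  have hVr0 : V.val *ᵥ r' ≠ 0 := by
    intro h0
    apply h'.right_ne_zero
    rw [← Matrix.one_mulVec r', ← Units.inv_mul V, ← Matrix.mulVec_mulVec, h0, Matrix.mulVec_zero]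
  have heig : T *ᵥ (V.val *ᵥ r') = ((κ : ℂ)⁻¹ * l) • (V.val *ᵥ r') := by
    have h1 := congrArg (· *ᵥ r') hVT
    simp only [← Matrix.mulVec_mulVec, h'.eig, Matrix.smul_mulVec, Matrix.mulVec_smul] at h1
    rw [mul_smul, h1, smul_smul, inv_mul_cancel₀ hκ0, one_smul]
  -- κ⁻¹ l has modulus l, and l is the only eigenvalue of T of modulus at least l.
  have hκ : (κ : ℂ)⁻¹ * l = l := h.max _ _ hVr0 heig (by
    rw [norm_mul, norm_inv, Circle.norm_coe, inv_one, one_mul, Complex.norm_real]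
    exact le_abs_self l)
  have hl0 : (l : ℂ) ≠ 0 := by exact_mod_cast h.pos.ne'
  have hκ1 : (κ : ℂ) = 1 := by
    have := mul_right_cancel₀ hl0 (hκ.trans (one_mul _).symm)
    simpa using this
  refine ⟨Circle.ext (by simpa using hκ1), ?_, ?_⟩
  · rw [hκ] at heig
    obtain ⟨c, hc⟩ := h.unique _ heig
    refine ⟨c, ?_, hc⟩
    rintro rfl
    exact hVr0 (by rw [hc, zero_smul])
  · rw [hκ1, one_smul] at hVT
    -- V intertwines all powers, hence also their limits, the rank-one projections.
    have hpow : ∀ k : ℕ, V.val * ((l : ℂ)⁻¹ • T') ^ k = ((l : ℂ)⁻¹ • T) ^ k * V.val := by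
      intro k
      have hs : SemiconjBy V.val ((l : ℂ)⁻¹ • T') ((l : ℂ)⁻¹ • T) := by
        rw [SemiconjBy, mul_smul_comm, hVT, smul_mul_assoc]
      exact hs.pow_right k
    have h1 : Tendsto (fun k : ℕ => V.val * ((l : ℂ)⁻¹ • T') ^ k) atTop
        (𝓝 (V.val * Matrix.vecMulVec r' s')) := h'.tendsto.const_mul _
    have h2 : Tendsto (fun k : ℕ => ((l : ℂ)⁻¹ • T) ^ k * V.val) atTop
        (𝓝 (Matrix.vecMulVec r s * V.val)) := h.tendsto.mul_const _
    simp_rw [hpow] at h1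
    exact tendsto_nhds_unique h1 h2

theorem trace_vecMulVec_mul (r s : Fin n → ℂ) (X Y : Matrix (Fin n) (Fin n) ℂ) :
    (Matrix.vecMulVec r s * X * Matrix.vecMulVec r s * Y).trace =
      (s ⬝ᵥ (X *ᵥ r)) * (s ⬝ᵥ (Y *ᵥ r)) := by
  rw [Matrix.vecMulVec_mul, Matrix.vecMulVec_mul_vecMulVec, Matrix.vecMulVec_mul, Matrix.trace_vecMulVec,
    Matrix.smul_vecMul, dotProduct_smul, dotProduct_comm r, ← Matrix.dotProduct_mulVec,
    ← Matrix.dotProduct_mulVec]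
  simp

theorem trace_vecMulVec_mul' (r s : Fin n → ℂ) (X : Matrix (Fin n) (Fin n) ℂ) :
    (Matrix.vecMulVec r s * X).trace = s ⬝ᵥ (X *ᵥ r) := by
  rw [Matrix.vecMulVec_mul, Matrix.trace_vecMulVec, dotProduct_comm r, ← Matrix.dotProduct_mulVec]

end Dominance

/-! ### Long-string asymptotics -/

section Strings

variable {d χ : ℕ}

theorem prod_range_string {M : Type*} [Monoid M] (F : ℕ → M) (a n b : ℕ) {t x u y : M}
    (h1 : ∀ i < a, F i = t) (h2 : F a = x) (h3 : ∀ i < n, F (a + 1 + i) = u)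
    (h4 : F (a + 1 + n) = y) (h5 : ∀ i < b, F (a + 1 + n + 1 + i) = t) :
    ((List.range (a + 1 + n + 1 + b)).map F).prod = t ^ a * x * u ^ n * y * t ^ b := by
  have hc : ∀ (f : ℕ → M) (c : M) (m : ℕ), (∀ i < m, f i = c) →
      ((List.range m).map f).prod = c ^ m := by
    intro f c m h
    rw [List.map_congr_left (g := fun _ => c) (fun i hi => h i (List.mem_range.1 hi))]
    simp [List.prod_replicate]
  rw [List.range_add, List.map_append, List.prod_append, List.range_succ, List.map_append,
    List.prod_append, List.range_add, List.map_append, List.prod_append, List.range_succ,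
    List.map_append, List.prod_append, List.map_map, List.map_map, hc _ _ _ h1,
    hc (F ∘ fun x => a + 1 + x) _ _ h3, hc (F ∘ fun x => a + 1 + n + 1 + x) _ _ h5]
  simp [h2, h4]

/-- Cyclicity of the trace merges the sites left of x₁ with those right of x₂ into one power of the
transfer matrix. -/
theorem trace_mpdo_stringOp (A : Tensor d χ) (u R' R : Matrix (Fin d) (Fin d) ℂ) {L : ℕ}
    (x₁ x₂ : Fin L) (h : x₁ < x₂) :
    (mpdo A L * stringOp u R' R x₁ x₂).trace =
      (transfer A ^ (x₁ + (L - 1 - x₂) : ℕ) * opTransfer A R' *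
        opTransfer A u ^ (x₂ - x₁ - 1 : ℕ) * opTransfer A R).trace := by
  obtain ⟨a, ha⟩ := x₁
  obtain ⟨c, hc⟩ := x₂
  have hac : a < c := h
  obtain ⟨n, rfl⟩ : ∃ n, c = a + 1 + n := ⟨c - a - 1, by omega⟩
  obtain ⟨b, rfl⟩ : ∃ b, L = a + 1 + n + 1 + b := ⟨L - (a + 1 + n + 1), by omega⟩
  let F : ℕ → Matrix (Fin χ) (Fin χ) ℂ := fun x => opTransfer A
    (if x = a then R' else if x = a + 1 + n then R else if a < x ∧ x < a + 1 + n then u else 1)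
  have hF : (List.ofFn fun x : Fin (a + 1 + n + 1 + b) => opTransfer A
      (if x = ⟨a, ha⟩ then R' else if x = ⟨a + 1 + n, hc⟩ then R
        else if ⟨a, ha⟩ < x ∧ x < ⟨a + 1 + n, hc⟩ then u else 1)) =
      (List.range (a + 1 + n + 1 + b)).map F := by
    rw [List.ofFn_eq_map, ← List.map_coe_finRange_eq_range, List.map_map]
    simp only [Fin.ext_iff, Fin.lt_def, F]
    rfl
  rw [stringOp, trace_mpdo_mul_siteProd, hF, prod_range_string F a n b (t := transfer A)
    (x := opTransfer A R') (u := opTransfer A u) (y := opTransfer A R)]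
  · rw [Matrix.trace_mul_comm, pow_add, show a + 1 + n - a - 1 = n by omega,
      show a + 1 + n + 1 + b - 1 - (a + 1 + n) = b by omega, ← pow_add, add_comm a b, pow_add]
    simp only [mul_assoc]
  · intro i hi
    simp only [F]
    rw [if_neg (by omega), if_neg (by omega), if_neg (by omega), opTransfer_one]
  · simp [F]
  · intro i hi
    simp only [F]
    rw [if_neg (by omega), if_neg (by omega), if_pos (by omega)]
  · simp only [F]
    rw [if_neg (by omega), if_pos trivial]
  · intro i hi
    simp only [F]
    rw [if_neg (by omega), if_neg (by omega), if_neg (by omega), opTransfer_one]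

/-- The limit of a string expectation value, up to the phases accumulated along the string. -/
noncomputable def stringValue (A : Tensor d χ) (l : ℝ) (r s : Fin χ → ℂ) (V : GL (Fin χ) ℂ)
    (R' R : Matrix (Fin d) (Fin d) ℂ) : ℂ :=
  (s ⬝ᵥ ((opTransfer A R' * V⁻¹.val) *ᵥ r)) * (s ⬝ᵥ ((V.val * opTransfer A R) *ᵥ r)) / l ^ 2

/-- Inside the string each transfer matrix is κ V⁻¹ T V, so the V's cancel except at the ends, and
with T/l powers tending to r sᵀ on both arcs the trace splits into two factors. The phase κ^n need
not converge and is kept explicitly. -/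
theorem expect_stringOp_tendsto {A : Tensor d χ} {l : ℝ} {r s : Fin χ → ℂ}
    (hD : Dominant (transfer A) l r s) {u : Matrix (Fin d) (Fin d) ℂ} {κ : ℂ} (hκ : ‖κ‖ = 1)
    {V : GL (Fin χ) ℂ} (hu : opTransfer A u = κ • (V⁻¹.val * transfer A * V.val))
    (R' R : Matrix (Fin d) (Fin d) ℂ) :
    ∀ ε > 0, ∃ N : ℕ, ∀ (L : ℕ) (x₁ x₂ : Fin L), (x₁ : ℕ) + N ≤ x₂ → (x₂ : ℕ) + N ≤ L + x₁ →
      ‖expect A (stringOp u R' R x₁ x₂) - κ ^ (x₂ - x₁ - 1 : ℕ) * stringValue A l r s V R' R‖ < ε := by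
  have hl0 : (l : ℂ) ≠ 0 := by exact_mod_cast hD.pos.ne'
  set t := (l : ℂ)⁻¹ • transfer A with ht
  have hTt : transfer A = (l : ℂ) • t := by rw [ht, smul_smul, mul_inv_cancel₀ hl0, one_smul]
  -- With L = p.1 + p.2 + 2, the two end sites carry no factor of T in the numerator; they account
  -- for l² in the denominator.
  let F : ℕ × ℕ → ℂ := fun p => (t ^ p.1 * (opTransfer A R' * V⁻¹.val) * t ^ p.2 *
    (V.val * opTransfer A R)).trace / ((l : ℂ) ^ 2 * (t ^ (p.1 + p.2 + 2)).trace)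
  have hF : Tendsto F (atTop ×ˢ atTop) (𝓝 (stringValue A l r s V R' R)) := by
    have h1 : Tendsto (fun p : ℕ × ℕ => t ^ p.1) (atTop ×ˢ atTop) (𝓝 (Matrix.vecMulVec r s)) :=
      hD.tendsto.comp tendsto_fst
    have h2 : Tendsto (fun p : ℕ × ℕ => t ^ p.2) (atTop ×ˢ atTop) (𝓝 (Matrix.vecMulVec r s)) :=
      hD.tendsto.comp tendsto_snd
    have h3 : Tendsto (fun p : ℕ × ℕ => t ^ (p.1 + p.2 + 2)) (atTop ×ˢ atTop)
        (𝓝 (Matrix.vecMulVec r s)) := by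
      refine hD.tendsto.comp (tendsto_atTop_mono (f := fun p : ℕ × ℕ => p.1) (fun p => by omega) tendsto_fst)
    have hc : Continuous (fun M : Matrix (Fin χ) (Fin χ) ℂ => M.trace) := continuous_id.matrix_trace
    have h4 := (hc.tendsto _).comp (((h1.mul_const (opTransfer A R' * V⁻¹.val)).mul h2).mul_const
      (V.val * opTransfer A R))
    have h5 := ((hc.tendsto _).comp h3).const_mul ((l : ℂ) ^ 2)
    have h6 := h4.div h5 (by
      rw [Matrix.trace_vecMulVec, dotProduct_comm, hD.dot, mul_one]
      exact pow_ne_zero 2 hl0)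
    rw [Matrix.trace_vecMulVec, dotProduct_comm, hD.dot, mul_one, trace_vecMulVec_mul] at h6
    exact h6
  intro ε hε
  obtain ⟨⟨N₁, N₂⟩, hN⟩ := (eventually_atTop.1 (by
    rw [prod_atTop_atTop_eq] at hF
    exact (Metric.tendsto_nhds.1 hF) ε hε))
  refine ⟨N₁ + N₂ + 2, fun L x₁ x₂ h12 h21 => ?_⟩
  have hlt : x₁ < x₂ := by rw [Fin.lt_def]; omega
  have hx2 := x₂.isLt
  set m := (x₁ + (L - 1 - x₂) : ℕ) with hm
  set n := (x₂ - x₁ - 1 : ℕ) with hn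
  have hL : L = m + n + 2 := by rw [hm, hn]; have : (x₁ : ℕ) < x₂ := hlt; omega
  have hval : expect A (stringOp u R' R x₁ x₂) = κ ^ n * F (m, n) := by
    have hpow : opTransfer A u ^ n = (κ ^ n * l ^ n) • (V⁻¹.val * t ^ n * V.val) := by
      have hconj : ∀ k : ℕ, (V⁻¹.val * t * V.val) ^ k = V⁻¹.val * t ^ k * V.val := by
        intro k
        exact Units.conj_pow' V t k
      rw [hu, hTt, mul_smul_comm, smul_mul_assoc, smul_smul, smul_pow, hconj, mul_pow]
    have hden : (mpdo A L).trace = l ^ (m + n) * (l ^ 2 * (t ^ (m + n + 2)).trace) := by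
      rw [trace_mpdo, hTt, smul_pow, Matrix.trace_smul, hL, smul_eq_mul, pow_add _ (m + n) 2, mul_assoc]
    rw [expect, trace_mpdo_stringOp _ _ _ _ _ _ hlt, hden, ← hm, ← hn, hpow, hTt, smul_pow]
    have hnum : ((l : ℂ) ^ m • t ^ m * opTransfer A R' *
        ((κ ^ n * l ^ n) • (V⁻¹.val * t ^ n * V.val)) * opTransfer A R).trace =
        l ^ (m + n) * (κ ^ n * (t ^ m * (opTransfer A R' * V⁻¹.val) * t ^ n *
          (V.val * opTransfer A R)).trace) := by
      simp only [smul_mul_assoc, mul_smul_comm, smul_smul, Matrix.trace_smul, smul_eq_mul, mul_assoc]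
      ring
    rw [hnum, mul_div_mul_left _ _ (pow_ne_zero _ hl0), mul_div_assoc]
  rw [hval, ← mul_sub, norm_mul, norm_pow, hκ, one_pow, one_mul, ← dist_eq_norm]
  exact hN (m, n) ⟨by simp only; omega, by simp only; omega⟩

theorem stringLimit_norm_stringValue {A : Tensor d χ} {l : ℝ} {r s : Fin χ → ℂ}
    (hD : Dominant (transfer A) l r s) {u : Matrix (Fin d) (Fin d) ℂ} {κ : ℂ} (hκ : ‖κ‖ = 1)
    {V : GL (Fin χ) ℂ} (hu : opTransfer A u = κ • (V⁻¹.val * transfer A * V.val))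
    (R' R : Matrix (Fin d) (Fin d) ℂ) :
    StringLimit A u R' R ‖stringValue A l r s V R' R‖ := by
  intro ε hε
  obtain ⟨N, hN⟩ := expect_stringOp_tendsto hD hκ hu R' R ε hε
  refine ⟨N, fun L x₁ x₂ h1 h2 => lt_of_le_of_lt ?_ (hN L x₁ x₂ h1 h2)⟩
  have h3 : ‖κ ^ (x₂ - x₁ - 1 : ℕ) * stringValue A l r s V R' R‖ = ‖stringValue A l r s V R' R‖ := by
    rw [norm_mul, norm_pow, hκ, one_pow, one_mul]
  rw [← h3]
  exact abs_norm_sub_norm_le _ _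

theorem StringLimit.unique {A : Tensor d χ} {u R' R : Matrix (Fin d) (Fin d) ℂ} {c c' : ℝ}
    (h : StringLimit A u R' R c) (h' : StringLimit A u R' R c') : c = c' := by
  by_contra hne
  have hpos : 0 < |c - c'| / 2 := by have := abs_pos.2 (sub_ne_zero.2 hne); positivity
  obtain ⟨N, hN⟩ := h _ hpos
  obtain ⟨N', hN'⟩ := h' _ hpos
  -- One chain on which both arcs are long enough for both estimates.
  let L := 2 * (N + N') + 1
  have h1 := hN L ⟨0, by omega⟩ ⟨N + N', by omega⟩ (by simp) (by simp [L]; omega)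
  have h2 := hN' L ⟨0, by omega⟩ ⟨N + N', by omega⟩ (by simp) (by simp [L]; omega)
  have h3 := abs_sub_le c ‖expect A (stringOp u R' R (L := L) ⟨0, by omega⟩ ⟨N + N', by omega⟩)‖ c'
  rw [abs_sub_comm c ‖_‖] at h3
  linarith

end Strings

/-! ### Consequences of positivity of the density operators -/

section Gram

/-- The limiting Gram matrix of string operators whose end points are far apart. -/
noncomputable def gramEntry (m C : ℂ) (a b : ℕ) : ℂ :=
  if a = b then m else if a < b then C else starRingEnd ℂ C

theorem re_sum_gramEntry (m C : ℂ) (M : ℕ) :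
    (∑ a ∈ Finset.range M, ∑ b ∈ Finset.range M, gramEntry m C a b).re =
      M * m.re + M * (M - 1) * C.re := by
  induction M with
  | zero => simp
  | succ M ih =>
    have h1 : ∑ a ∈ Finset.range M, gramEntry m C a M = M * C := by
      rw [Finset.sum_congr rfl (g := fun _ => C)]
      · simp
      · intro a ha
        have := Finset.mem_range.1 ha
        rw [gramEntry, if_neg this.ne, if_pos this]
    have h2 : ∑ b ∈ Finset.range M, gramEntry m C M b = M * starRingEnd ℂ C := by
      rw [Finset.sum_congr rfl (g := fun _ => starRingEnd ℂ C)]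
      · simp
      · intro b hb
        have := Finset.mem_range.1 hb
        rw [gramEntry, if_neg this.ne', if_neg this.not_gt]
    simp_rw [Finset.sum_range_succ]
    rw [Finset.sum_add_distrib, h1, h2, gramEntry, if_pos rfl]
    have h3 : ((M : ℂ) * C).re = M * C.re := by simp
    have h4 : ((M : ℂ) * starRingEnd ℂ C).re = M * C.re := by simp
    simp only [Complex.add_re, ih, h3, h4]
    push_cast
    ring

/-- If all limiting Gram matrices are positive semidefinite, then the off-diagonal entry is real and
nonnegative. -/
theorem norm_le_re_of_gram {m C : ℂ}
    (h : ∀ (K : ℕ) (v : ℕ → ℂ), 0 ≤ (∑ a ∈ Finset.range K, ∑ b ∈ Finset.range K,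
      starRingEnd ℂ (v a) * v b * gramEntry m C a b).re) : ‖C‖ ≤ C.re := by
  rcases eq_or_ne C 0 with rfl | hC
  · simp
  have hC' : (‖C‖ : ℂ) ≠ 0 := by exact_mod_cast (norm_ne_zero_iff.2 hC)
  -- The test vector is 1 on the first M indices and z on the next M, with the phase of z chosen so
  -- that z C = -‖C‖ makes the cross terms as negative as possible.
  set z : ℂ := -(starRingEnd ℂ C / ‖C‖) with hz
  have hzC : z * C = -‖C‖ := by
    rw [hz, neg_mul, div_mul_eq_mul_div, Complex.conj_mul', sq, mul_div_assoc, div_self hC', mul_one]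
  have hzz : starRingEnd ℂ z * z = 1 := by
    rw [Complex.conj_mul', hz, norm_neg, norm_div, Complex.norm_conj, Complex.norm_real, norm_norm,
      div_self (norm_ne_zero_iff.2 hC)]
    simp
  have key : ∀ M : ℕ, 0 ≤ 2 * (M * m.re + M * (M - 1) * C.re) - 2 * (M * M * ‖C‖) := by
    intro M
    have h1 := h (M + M) (fun a => if a < M then 1 else z)
    have hin : ∀ a < M, (if a < M then (1 : ℂ) else z) = 1 := fun a ha => if_pos ha
    have hout : ∀ a, (if M + a < M then (1 : ℂ) else z) = z := fun a => if_neg (by omega)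
    have hsplit : ∑ a ∈ Finset.range (M + M), ∑ b ∈ Finset.range (M + M),
        starRingEnd ℂ (if a < M then 1 else z) * (if b < M then 1 else z) * gramEntry m C a b =
        (∑ a ∈ Finset.range M, ∑ b ∈ Finset.range M, gramEntry m C a b) + M * M * (z * C) +
        (M * M * starRingEnd ℂ (z * C) +
          ∑ a ∈ Finset.range M, ∑ b ∈ Finset.range M, gramEntry m C a b) := by
      simp_rw [Finset.sum_range_add _ M M, Finset.sum_add_distrib, hout]
      congr 2
      · refine Finset.sum_congr rfl fun a ha => Finset.sum_congr rfl fun b hb => ?_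
        rw [hin a (Finset.mem_range.1 ha), hin b (Finset.mem_range.1 hb)]
        simp
      · rw [Finset.sum_congr rfl (g := fun _ => M * (z * C))]
        · simp [mul_assoc]
        · intro a ha
          rw [Finset.sum_congr rfl (g := fun _ => z * C)]
          · simp
          · intro b _
            have ha' := Finset.mem_range.1 ha
            rw [hin a ha', gramEntry, if_neg (by omega), if_pos (by omega)]
            simp
      · rw [Finset.sum_congr rfl (g := fun _ => M * starRingEnd ℂ (z * C))]
        · simp [mul_assoc]
        · intro a _
          rw [Finset.sum_congr rfl (g := fun _ => starRingEnd ℂ (z * C))]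
          · simp
          · intro b hb
            have hb' := Finset.mem_range.1 hb
            rw [hin b hb', gramEntry, if_neg (by omega), if_neg (by omega)]
            simp
      · refine Finset.sum_congr rfl fun a _ => Finset.sum_congr rfl fun b _ => ?_
        rw [hzz, one_mul, gramEntry, gramEntry]
        simp
    rw [hsplit, hzC] at h1
    simp only [Complex.add_re, re_sum_gramEntry] at h1
    have h2 : ((M : ℂ) * M * -(‖C‖ : ℂ)).re = -(M * M * ‖C‖) := by
      rw [← Complex.ofReal_natCast, ← Complex.ofReal_neg, ← Complex.ofReal_mul,
        ← Complex.ofReal_mul, Complex.ofReal_re]; ring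
    have h3 : ((M : ℂ) * M * starRingEnd ℂ (-(‖C‖ : ℂ))).re = -(M * M * ‖C‖) := by
      rw [← h2, map_neg, Complex.conj_ofReal]
    rw [h2, h3] at h1
    linarith
  -- The form is 2M²(Re C - ‖C‖) plus a term linear in M, so a strict inequality would make it
  -- negative for large M.
  by_contra hlt
  push Not at hlt
  obtain ⟨M, hM⟩ := exists_nat_gt ((m.re - C.re) / (‖C‖ - C.re))
  have hd : 0 < ‖C‖ - C.re := sub_pos.2 hlt
  rw [div_lt_iff₀ hd] at hM
  have h1 := key (M + 1)
  push_cast at h1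
  have h2 : 0 ≤ 2 * ((M : ℝ) + 1) * (m.re + M * C.re - (M + 1) * ‖C‖) := by nlinarith
  have h3 : (0 : ℝ) < 2 * ((M : ℝ) + 1) := by positivity
  have h4 := nonneg_of_mul_nonneg_right h2 h3
  nlinarith [norm_nonneg C]

variable {d χ : ℕ}

theorem expect_sum {A : Tensor d χ} {L : ℕ} {ι : Type*} (t : Finset ι) (O : ι → ChainOp d L) :
    expect A (∑ i ∈ t, O i) = ∑ i ∈ t, expect A (O i) := by
  simp [expect, Finset.mul_sum, Matrix.trace_sum, Finset.sum_div]

theorem expect_smul {A : Tensor d χ} {L : ℕ} (c : ℂ) (O : ChainOp d L) :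
    expect A (c • O) = c * expect A O := by
  simp [expect, mul_div_assoc]

theorem expect_conjTranspose {A : Tensor d χ} (hA : ∀ L, (mpdo A L).PosSemidef) {L : ℕ}
    (O : ChainOp d L) : expect A Oᴴ = starRingEnd ℂ (expect A O) := by
  have h1 : (mpdo A L * Oᴴ).trace = star ((mpdo A L * O).trace) := by
    rw [← Matrix.trace_conjTranspose, Matrix.conjTranspose_mul, (hA L).isHermitian.eq,
      Matrix.trace_mul_comm]
  have h2 : star (mpdo A L).trace = (mpdo A L).trace := by
    rw [← Matrix.trace_conjTranspose, (hA L).isHermitian.eq]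
  rw [expect, expect, h1, starRingEnd_apply, star_div₀, h2]

theorem expect_conjTranspose_mul_self_nonneg {A : Tensor d χ} (hA : ∀ L, (mpdo A L).PosSemidef)
    {L : ℕ} (O : ChainOp d L) : 0 ≤ (expect A (Oᴴ * O)).re := by
  have h1 : 0 ≤ (mpdo A L * (Oᴴ * O)).trace := by
    rw [← mul_assoc, Matrix.trace_mul_comm, ← mul_assoc]
    exact ((hA L).mul_mul_conjTranspose_same O).trace_nonneg
  have h2 : 0 ≤ (mpdo A L).trace := (hA L).trace_nonneg
  have h3 : 0 ≤ expect A (Oᴴ * O) := div_nonneg h1 h2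
  exact (Complex.nonneg_iff.1 h3).1

/-- The half-infinite string operator `(∏_{y < x} u(y)) R(x)`. -/
noncomputable def halfString {L : ℕ} (u R : Matrix (Fin d) (Fin d) ℂ) (x : Fin L) : ChainOp d L :=
  siteProd fun y => if y < x then u else if y = x then R else 1

/-- The common part of the two strings cancels by unitarity, leaving a string on the interval from x
to y with left end Rᴴ u. -/
theorem halfString_mul_of_lt {L : ℕ} {u R : Matrix (Fin d) (Fin d) ℂ} (hu : uᴴ * u = 1)
    {x y : Fin L} (h : x < y) :
    (halfString u R x)ᴴ * halfString u R y = stringOp u (Rᴴ * u) R x y := by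
  rw [halfString, halfString, siteProd_conjTranspose, siteProd_mul, stringOp]
  congr 1
  funext z
  rcases lt_trichotomy z x with hz | rfl | hz
  · simp [hz, hz.trans h, hz.ne, (hz.trans h).ne, hz.not_gt, hu]
  · simp [h]
  · rcases lt_trichotomy z y with hzy | rfl | hzy
    · simp [hz.not_gt, hz.ne', hzy, hzy.ne, hz]
    · simp [h.not_gt, h.ne']
    · simp [hz.not_gt, hz.ne', hzy.not_gt, hzy.ne']

/-- The product is local at x; it is written as a trivial string to an auxiliary site y so that the
same limit theorem computes its expectation value. -/
theorem halfString_mul_self {L : ℕ} {u R : Matrix (Fin d) (Fin d) ℂ} (hu : uᴴ * u = 1)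
    {x y : Fin L} (h : x < y) :
    (halfString u R x)ᴴ * halfString u R x = stringOp 1 (Rᴴ * R) 1 x y := by
  rw [halfString, siteProd_conjTranspose, siteProd_mul, stringOp]
  congr 1
  funext z
  rcases lt_trichotomy z x with hz | rfl | hz
  · simp [hz, hz.ne, hu]
  · simp
  · simp [hz.not_gt, hz.ne']

/-- Positivity of the density operators forces the string values `⟨γ_x† γ_y⟩`, `x < y`, of
half-infinite string operators to be real and nonnegative. -/
theorem norm_stringValue_le_re {A : Tensor d χ} (hA : ∀ L, (mpdo A L).PosSemidef) {l : ℝ}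
    {r s : Fin χ → ℂ} (hD : Dominant (transfer A) l r s) {u : Matrix (Fin d) (Fin d) ℂ}
    (hu : uᴴ * u = 1) {V : GL (Fin χ) ℂ} (hV : opTransfer A u = V⁻¹.val * transfer A * V.val)
    (R : Matrix (Fin d) (Fin d) ℂ) :
    ‖stringValue A l r s V (Rᴴ * u) R‖ ≤ (stringValue A l r s V (Rᴴ * u) R).re := by
  set C := stringValue A l r s V (Rᴴ * u) R with hC
  set m := stringValue A l r s 1 (Rᴴ * R) 1 with hm
  refine norm_le_re_of_gram (m := m) fun K v => ?_
  have hlim1 := expect_stringOp_tendsto hD (κ := 1) norm_one (by rw [one_smul]; exact hV) (Rᴴ * u) R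
  have hlim2 := expect_stringOp_tendsto hD (κ := 1) (V := 1) (u := 1) norm_one
    (by simp [opTransfer_one]) (Rᴴ * R) 1
  simp only [one_pow, one_mul] at hlim1 hlim2
  have hpos : ∀ n : ℕ, ∀ a ≤ K, a * (n + 1) < (K + 1) * (n + 1) := fun n a ha =>
    Nat.mul_lt_mul_of_pos_right (by omega) (by omega)
  -- Equally spaced end points at distance n + 1. The chain has room for K + 1 of them: the spare
  -- one separates the points around the periodic closure and is the auxiliary site for the last
  -- diagonal entry.
  let x : ∀ n : ℕ, ℕ → Fin ((K + 1) * (n + 1)) := fun n a =>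
    if h : a ≤ K then ⟨a * (n + 1), hpos n a h⟩ else ⟨0, by positivity⟩
  have hx : ∀ n, ∀ a ≤ K, ((x n a : Fin _) : ℕ) = a * (n + 1) := fun n a ha => by
    simp only [x, dif_pos ha]
  have hsep : ∀ N n : ℕ, N ≤ n → ∀ a b, a < b → b ≤ K →
      (x n a : ℕ) + N ≤ x n b ∧ (x n b : ℕ) + N ≤ (K + 1) * (n + 1) + x n a := by
    intro N n hN a b hab hb
    rw [hx n a (by omega), hx n b hb]
    have h1 : (a + 1) * (n + 1) ≤ b * (n + 1) := Nat.mul_le_mul_right _ hab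
    have h2 : b * (n + 1) ≤ K * (n + 1) := Nat.mul_le_mul_right _ hb
    constructor <;> nlinarith
  have hxlt : ∀ n a b, a < b → b ≤ K → x n a < x n b := by
    intro n a b hab hb
    rw [Fin.lt_def, hx n a (by omega), hx n b hb]
    exact Nat.mul_lt_mul_of_pos_right hab (by omega)
  let γ : ∀ n a, ChainOp d ((K + 1) * (n + 1)) := fun n a => halfString u R (x n a)
  have htend_lt : ∀ a b, a < b → b < K → Tendsto (fun n => expect A ((γ n a)ᴴ * γ n b)) atTop (𝓝 C) := by
    intro a b hab hb
    rw [Metric.tendsto_atTop]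
    intro ε hε
    obtain ⟨N, hN⟩ := hlim1 ε hε
    refine ⟨N, fun n hn => ?_⟩
    obtain ⟨h1, h2⟩ := hsep N n hn a b hab hb.le
    rw [dist_eq_norm]
    simp only [γ]
    rw [halfString_mul_of_lt hu (hxlt n a b hab hb.le)]
    exact hN _ _ _ h1 h2
  have htend : ∀ a b, a < K → b < K →
      Tendsto (fun n => expect A ((γ n a)ᴴ * γ n b)) atTop (𝓝 (gramEntry m C a b)) := by
    intro a b ha hb
    rw [gramEntry]
    split_ifs with h1 h2
    · subst h1
      rw [Metric.tendsto_atTop]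
      intro ε hε
      obtain ⟨N, hN⟩ := hlim2 ε hε
      refine ⟨N, fun n hn => ?_⟩
      obtain ⟨h1, h2⟩ := hsep N n hn a (a + 1) (by omega) (by omega)
      rw [dist_eq_norm]
      simp only [γ]
      rw [halfString_mul_self hu (hxlt n a (a + 1) (by omega) (by omega))]
      exact hN _ _ _ h1 h2
    · exact htend_lt a b h2 hb
    · have h3 := (Complex.continuous_conj.tendsto _).comp (htend_lt b a (by omega) ha)
      refine h3.congr fun n => ?_
      rw [Function.comp_apply, ← expect_conjTranspose hA, Matrix.conjTranspose_mul,
        Matrix.conjTranspose_conjTranspose]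
  have hsum : Tendsto (fun n => (∑ a ∈ Finset.range K, ∑ b ∈ Finset.range K,
      starRingEnd ℂ (v a) * v b * expect A ((γ n a)ᴴ * γ n b)).re) atTop
      (𝓝 (∑ a ∈ Finset.range K, ∑ b ∈ Finset.range K,
        starRingEnd ℂ (v a) * v b * gramEntry m C a b).re) := by
    refine (Complex.continuous_re.tendsto _).comp (tendsto_finsetSum _ fun a ha =>
      tendsto_finsetSum _ fun b hb => ?_)
    exact (htend a b (Finset.mem_range.1 ha) (Finset.mem_range.1 hb)).const_mul _
  refine ge_of_tendsto' hsum fun n => ?_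
  have h1 := expect_conjTranspose_mul_self_nonneg hA (∑ a ∈ Finset.range K, v a • γ n a)
  rw [Matrix.conjTranspose_sum, Finset.sum_mul_sum, expect_sum] at h1
  simp_rw [expect_sum, Matrix.conjTranspose_smul, smul_mul_smul_comm, expect_smul] at h1
  exact h1

end Gram

/-! ### Cocycles, slant products and elements of the doubled group -/

section Cocycles

variable {Γ : Type*} [Group Γ]

theorem Cohomologous.symm {σ : Γ →* ℤˣ} {ω₁ ω₂ : Γ → Γ → Circle} (h : Cohomologous σ ω₁ ω₂) :
    Cohomologous σ ω₂ ω₁ := by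
  obtain ⟨φ, hφ⟩ := h
  refine ⟨fun x => (φ x)⁻¹, fun x y => ?_⟩
  rw [hφ, inv_zpow, ← mul_inv, inv_div_inv, mul_assoc, div_mul_div_comm,
    mul_comm (φ x * _), div_self', mul_one]

theorem Cohomologous.trans {σ : Γ →* ℤˣ} {ω₁ ω₂ ω₃ : Γ → Γ → Circle}
    (h : Cohomologous σ ω₁ ω₂) (h' : Cohomologous σ ω₂ ω₃) : Cohomologous σ ω₁ ω₃ := by
  obtain ⟨φ, hφ⟩ := h
  obtain ⟨ψ, hψ⟩ := h'
  refine ⟨fun x => φ x * ψ x, fun x y => ?_⟩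
  rw [hψ, hφ, mul_zpow, mul_assoc, div_mul_div_comm, mul_mul_mul_comm]

/-- For commuting elements acting linearly the coboundary is symmetric and cancels in the quotient.
-/
theorem Cohomologous.slant_eq {σ : Γ →* ℤˣ} {ω₁ ω₂ : Γ → Γ → Circle} (h : Cohomologous σ ω₁ ω₂)
    {x y : Γ} (hx : σ x = 1) (hy : σ y = 1) (hxy : x * y = y * x) :
    slant ω₁ x y = slant ω₂ x y := by
  obtain ⟨φ, hφ⟩ := h
  rw [slant, slant, hφ, hφ, hx, hy, hxy]
  simp only [Units.val_one, zpow_one]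
  rw [mul_comm (φ y) (φ x), mul_div_mul_right_eq_div]

end Cocycles

theorem slant_inv {Γ : Type*} [Group Γ] (ω : Γ → Γ → Circle) (x y : Γ) :
    (slant ω x y)⁻¹ = slant ω y x := inv_div _ _

/-- The action of a sign on the scalars: complex conjugation for `-1`. -/
noncomputable def conjSign (s : ℤˣ) : ℂ →+* ℂ := if s = 1 then RingHom.id ℂ else starRingEnd ℂ

@[simp] theorem conjSign_one : conjSign 1 = RingHom.id ℂ := if_pos rfl

@[simp] theorem conjSign_neg_one : conjSign (-1) = starRingEnd ℂ := if_neg (by decide)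

theorem conjSign_circle (s : ℤˣ) (z : Circle) : conjSign s z = ((z ^ (s : ℤ) : Circle) : ℂ) := by
  rcases Int.units_eq_one_or s with rfl | rfl
  · simp
  · simp [← Circle.coe_inv_eq_conj]

theorem norm_conjSign (s : ℤˣ) (z : ℂ) : ‖conjSign s z‖ = ‖z‖ := by
  rcases Int.units_eq_one_or s with rfl | rfl <;> simp

variable {G K : Type*} [Group G] [Group K]

/-- The element `(e, h, e)` of the doubled group. -/
def braElt (K : Type*) [Group K] {G : Type*} [Group G] (h : G) : DoubledGroup G K :=
  SemidirectProduct.inl (1, h, 1)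

/-- The diagonal element `(s, s, k)`, acting on operators by conjugation with `U_s W_k`. -/
def diagElt (p : G × K) : DoubledGroup G K := SemidirectProduct.inl (p.1, p.1, p.2)

/-- The Hermiticity symmetry. -/
def hermElt (G K : Type*) [Group G] [Group K] : DoubledGroup G K := SemidirectProduct.inr (-1)

theorem ketElt_mul (p q : G × K) : ketElt p * ketElt q = ketElt (p * q) := by
  rw [ketElt, ketElt, ← map_mul, ketElt]; simp

theorem ketElt_mul_braElt (p : G × K) : ketElt p * braElt K p.1 = diagElt p := by
  rw [ketElt, braElt, ← map_mul, diagElt]; simp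

theorem ketElt_braElt_comm (p : G × K) (h : G) :
    ketElt p * braElt K h = braElt K h * ketElt p := by
  rw [ketElt, braElt, ← map_mul, ← map_mul]; simp

theorem hermElt_mul_self : hermElt G K * hermElt G K = 1 := by
  rw [hermElt, ← map_mul]; simp

theorem hermElt_mul_inl (g h : G) (k : K) :
    hermElt G K * SemidirectProduct.inl (g, h, k) = SemidirectProduct.inl (h, g, k) * hermElt G K := by
  have h1 : hermAction G K (-1) (g, h, k) = (h, g, k) := by simp [hermAction, swapAut]
  rw [← h1, SemidirectProduct.inl_aut, hermElt, mul_assoc _ _ (SemidirectProduct.inr (-1)),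
    ← map_mul, inv_mul_cancel, map_one, mul_one]

theorem hermElt_ketElt_hermElt (g : G) :
    hermElt G K * (ketElt (g, 1) * hermElt G K) = braElt K g := by
  rw [← mul_assoc, ketElt, hermElt_mul_inl, mul_assoc, hermElt_mul_self, mul_one, braElt]

theorem hermElt_mul_ketElt_one (k : K) :
    hermElt G K * ketElt (1, k) = ketElt (1, k) * hermElt G K := by
  rw [ketElt, hermElt_mul_inl]

theorem antiSign_ketElt (p : G × K) : antiSign G K (ketElt p) = 1 := rfl
theorem antiSign_braElt (h : G) : antiSign G K (braElt K h) = 1 := rfl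
theorem antiSign_hermElt : antiSign G K (hermElt G K) = -1 := rfl

/-- A projective representation of the doubled group by semilinear maps, with a common eigenvector
`r` of the diagonal and the Hermiticity symmetry on which the left and the right copy of every
element of `G` are paired positively. -/
structure PositiveRep {E : Type*} [AddCommGroup E] [Module ℂ E]
    (S : DoubledGroup G K → E → E) (ω : DoubledGroup G K → DoubledGroup G K → Circle) (r : E) :
    Prop where
  map_smul : ∀ x (c : ℂ) v, S x (c • v) = conjSign (antiSign G K x) c • S x v
  map_mul : ∀ x y v, S x (S y v) = (ω x y : ℂ) • S (x * y) v
  map_one : ∀ v, S 1 v = (ω 1 1 : ℂ) • v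
  ne_zero : r ≠ 0
  diag : ∀ p, ∃ c : ℂ, c ≠ 0 ∧ S (diagElt p) r = c • r
  herm : ∃ c : ℂ, c ≠ 0 ∧ S (hermElt G K) r = c • r
  pos : ∀ g, ∃ t : ℝ, 0 < t ∧
    S (hermElt G K) (S (ketElt (g, 1)) (S (hermElt G K) (S (ketElt (g, 1)) r))) = (t : ℂ) • r

/-! ### Commutator phases and triviality of the left-right commutator -/

namespace PositiveRep

variable {E : Type*} [AddCommGroup E] [Module ℂ E] {S : DoubledGroup G K → E → E}
  {ω : DoubledGroup G K → DoubledGroup G K → Circle} {r : E}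

theorem map_smul_of_linear (h : PositiveRep S ω r) {x : DoubledGroup G K}
    (hx : antiSign G K x = 1) (c : ℂ) (v : E) : S x (c • v) = c • S x v := by
  rw [h.map_smul, hx, conjSign_one, RingHom.id_apply]

theorem ne_zero_of_ne_zero (h : PositiveRep S ω r) (x : DoubledGroup G K) {v : E} (hv : v ≠ 0) :
    S x v ≠ 0 := by
  intro h0
  have h1 := h.map_mul x⁻¹ x v
  have h2 : S x⁻¹ 0 = 0 := by simpa using h.map_smul x⁻¹ 0 0
  rw [h0, h2, inv_mul_cancel, h.map_one, smul_smul, eq_comm, smul_eq_zero] at h1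
  rcases h1 with h1 | h1
  · exact mul_ne_zero (Circle.coe_ne_zero _) (Circle.coe_ne_zero _) h1
  · exact hv h1

/-- Associativity evaluated on a nonzero vector; for x acting linearly the scalar ω(y,z) passes
through `S x` unchanged. -/
theorem cocycle (h : PositiveRep S ω r) {x : DoubledGroup G K} (hx : antiSign G K x = 1)
    (y z : DoubledGroup G K) : ω x y * ω (x * y) z = ω y z * ω x (y * z) := by
  have h1 : S x (S y (S z r)) = ((ω y z * ω x (y * z) : Circle) : ℂ) • S (x * (y * z)) r := by
    rw [h.map_mul y z, h.map_smul_of_linear hx, h.map_mul, smul_smul, Circle.coe_mul]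
  rw [h.map_mul x y, h.map_mul, smul_smul, mul_assoc x y z, ← Circle.coe_mul] at h1
  exact Circle.ext (smul_left_injective ℂ (h.ne_zero_of_ne_zero _ h.ne_zero) h1)

theorem slant_smul (h : PositiveRep S ω r) {x y : DoubledGroup G K} (hxy : x * y = y * x) (v : E) :
    S y (S x v) = (slant ω x y : ℂ) • S x (S y v) := by
  rw [h.map_mul, h.map_mul, smul_smul, ← Circle.coe_mul, slant, div_mul_cancel, hxy]

/-- The slant product is the commutator phase of `slant_smul`; multiplicativity combines three
instances of the cocycle identity. -/
theorem slant_mul_right (h : PositiveRep S ω r) {x y z : DoubledGroup G K}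
    (hx : antiSign G K x = 1) (hy : antiSign G K y = 1)
    (hxy : x * y = y * x) (hxz : x * z = z * x) :
    slant ω x (y * z) = slant ω x y * slant ω x z := by
  have e1 := h.cocycle hy z x
  have e2 := h.cocycle hy x z
  have e3 := h.cocycle hx y z
  rw [hxz] at e2
  rw [hxy] at e3
  have f1 : ω (y * z) x = ω z x * ω y (z * x) / ω y z := by rw [← e1, mul_div_cancel_left]
  have f2 : ω y (z * x) = ω y x * ω (y * x) z / ω x z := by rw [e2, mul_div_cancel_left]
  have f3 : ω x (y * z) = ω x y * ω (y * x) z / ω y z := by rw [e3, mul_div_cancel_left]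
  rw [slant, slant, slant, f1, f2, f3, ← Additive.ofMul.injective.eq_iff]
  simp only [ofMul_mul, ofMul_div]
  abel

theorem slant_mul_left (h : PositiveRep S ω r) {x y z : DoubledGroup G K}
    (hx : antiSign G K x = 1) (hxz : x * z = z * x) (hyz : y * z = z * y) (hz : antiSign G K z = 1) :
    slant ω (x * y) z = slant ω x z * slant ω y z := by
  rw [← slant_inv ω z, h.slant_mul_right hz hx hxz.symm hyz.symm, mul_inv, slant_inv, slant_inv]

theorem slant_one_right (h : PositiveRep S ω r) {x : DoubledGroup G K}
    (hx : antiSign G K x = 1) : slant ω x 1 = 1 := by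
  have h1 := h.slant_mul_right (x := x) (y := 1) (z := 1) hx (_root_.map_one _) (by simp) (by simp)
  rw [mul_one] at h1
  exact left_eq_mul.1 h1

/-- The eigenvalue of the Hermiticity symmetry on the distinguished vector. -/
noncomputable def hermScalar (h : PositiveRep S ω r) : ℂ := h.herm.choose

theorem hermScalar_ne_zero (h : PositiveRep S ω r) : h.hermScalar ≠ 0 := h.herm.choose_spec.1

theorem herm_self (h : PositiveRep S ω r) : S (hermElt G K) r = h.hermScalar • r :=
  h.herm.choose_spec.2

/-- The Hermiticity symmetry normalized to fix the distinguished vector. -/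
noncomputable def theta (h : PositiveRep S ω r) (v : E) : E :=
  h.hermScalar⁻¹ • S (hermElt G K) v

theorem herm_smul (h : PositiveRep S ω r) (c : ℂ) (v : E) :
    S (hermElt G K) (c • v) = starRingEnd ℂ c • S (hermElt G K) v := by
  rw [h.map_smul, antiSign_hermElt, conjSign_neg_one]

theorem theta_smul (h : PositiveRep S ω r) (c : ℂ) (v : E) :
    h.theta (c • v) = starRingEnd ℂ c • h.theta v := by
  rw [theta, h.herm_smul, theta, smul_comm]

theorem theta_self (h : PositiveRep S ω r) : h.theta r = r := by
  rw [theta, h.herm_self, smul_smul, inv_mul_cancel₀ h.hermScalar_ne_zero, one_smul]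

theorem eq_one_of_smul_self (h : PositiveRep S ω r) {c : ℂ} (hc : r = c • r) : c = 1 := by
  refine smul_left_injective ℂ h.ne_zero ?_
  simpa using hc.symm

/-- The square is a scalar, and the fixed vector r shows that the scalar is 1. The same device turns
the other projective relations among symmetries fixing r into exact ones. -/
theorem theta_theta (h : PositiveRep S ω r) (v : E) : h.theta (h.theta v) = v := by
  obtain ⟨e, he⟩ : ∃ e : ℂ, ∀ v, h.theta (h.theta v) = e • v := by
    refine ⟨h.hermScalar⁻¹ * starRingEnd ℂ h.hermScalar⁻¹ *
      (ω (hermElt G K) (hermElt G K) * ω 1 1), fun v => ?_⟩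
    rw [theta, theta, h.herm_smul, h.map_mul, hermElt_mul_self, h.map_one, smul_smul, smul_smul,
      smul_smul]
    congr 1
    ring
  have h1 := he r
  rw [h.theta_self, h.theta_self] at h1
  rw [he, h.eq_one_of_smul_self h1, one_smul]

/-- The copy of `g` on the bra side, obtained from the one on the ket side by the Hermiticity
symmetry. -/
noncomputable def bra (h : PositiveRep S ω r) (g : G) (v : E) : E :=
  h.theta (S (ketElt (g, 1)) (h.theta v))

theorem ket_smul (h : PositiveRep S ω r) (p : G × K) (c : ℂ) (v : E) :
    S (ketElt p) (c • v) = c • S (ketElt p) v :=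
  h.map_smul_of_linear (antiSign_ketElt p) c v

theorem bra_smul (h : PositiveRep S ω r) (g : G) (c : ℂ) (v : E) :
    h.bra g (c • v) = c • h.bra g v := by
  simp [bra, h.theta_smul, h.ket_smul]

theorem ket_ket (h : PositiveRep S ω r) (g g' : G) (v : E) :
    S (ketElt (g, 1)) (S (ketElt (g', 1)) v) = (ketCocycle ω g g' : ℂ) • S (ketElt (g * g', 1)) v := by
  rw [h.map_mul, ketElt_mul, ketCocycle]
  simp

theorem bra_bra (h : PositiveRep S ω r) (g g' : G) (v : E) :
    h.bra g (h.bra g' v) = (((ketCocycle ω g g')⁻¹ : Circle) : ℂ) • h.bra (g * g') v := by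
  rw [bra, bra, bra, h.theta_theta, h.ket_ket, h.theta_smul, Circle.coe_inv_eq_conj]

/-- H g_l H = g_r in the doubled group, so the H-conjugate of the ket operator represents g_r up to
a scalar. -/
theorem exists_bra_eq (h : PositiveRep S ω r) (g : G) :
    ∃ c : ℂ, c ≠ 0 ∧ ∀ v, h.bra g v = c • S (braElt K g) v := by
  have hc := h.hermScalar_ne_zero
  refine ⟨h.hermScalar⁻¹ * starRingEnd ℂ h.hermScalar⁻¹ *
    (starRingEnd ℂ (ω (ketElt (g, 1)) (hermElt G K)) *
      ω (hermElt G K) (ketElt (g, 1) * hermElt G K)), ?_, fun v => ?_⟩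
  · simp [hc]
  · rw [bra, theta, theta, h.ket_smul, h.herm_smul, h.map_mul (ketElt _), h.herm_smul, h.map_mul,
      hermElt_ketElt_hermElt, smul_smul, smul_smul, smul_smul]
    congr 1
    ring

theorem exists_bra_ket_self (h : PositiveRep S ω r) (g : G) :
    ∃ t : ℝ, 0 < t ∧ h.bra g (S (ketElt (g, 1)) r) = (t : ℂ) • r := by
  obtain ⟨t, ht, h1⟩ := h.pos g
  have hc := h.hermScalar_ne_zero
  refine ⟨t * (‖h.hermScalar‖ ^ 2)⁻¹, by have := norm_pos_iff.2 hc; positivity, ?_⟩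
  rw [bra, theta, theta, h.ket_smul, h.herm_smul, h1, smul_smul, smul_smul]
  congr 1
  have h2 : ((‖h.hermScalar‖ ^ 2 : ℝ) : ℂ) = starRingEnd ℂ h.hermScalar * h.hermScalar := by
    rw [Complex.conj_mul']; push_cast; rfl
  rw [Complex.ofReal_mul, Complex.ofReal_inv, h2, map_inv₀, mul_inv]
  ring

/-- The left and the right copy of the strong symmetry commute on the virtual space. -/
theorem slant_ket_bra (h : PositiveRep S ω r) (g g' : G) :
    slant ω (ketElt (g, 1)) (braElt K g') = 1 := by
  set b : Circle := slant ω (ketElt (g, 1)) (braElt K g') with hb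
  have hcomm : ∀ v, h.bra g' (S (ketElt (g, 1)) v) = (b : ℂ) • S (ketElt (g, 1)) (h.bra g' v) := by
    intro v
    obtain ⟨c, -, hc⟩ := h.exists_bra_eq g'
    rw [hc, hc, h.ket_smul, h.slant_smul (ketElt_braElt_comm _ _), smul_comm]
  obtain ⟨t, ht, h1⟩ := h.exists_bra_ket_self g
  obtain ⟨t', ht', h2⟩ := h.exists_bra_ket_self g'
  obtain ⟨t'', ht'', h3⟩ := h.exists_bra_ket_self (g * g')
  -- The antilinear θ inverts the cocycle on the bra side, so the phases of the two products cancel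
  -- and only the positive number of g g' remains.
  have h4 : h.bra g (h.bra g' (S (ketElt (g, 1)) (S (ketElt (g', 1)) r))) = (t'' : ℂ) • r := by
    rw [h.ket_ket, h.bra_smul, h.bra_smul, h.bra_bra, smul_smul, ← Circle.coe_mul, mul_inv_cancel,
      Circle.coe_one, one_smul, h3]
  rw [hcomm, h2, h.ket_smul, h.bra_smul, h.bra_smul, h1, smul_smul, smul_smul] at h4
  -- Reordering the same expression instead yields b t t'; a phase with b t t' = t'' and all three
  -- numbers positive equals 1.
  have h5 : (b : ℂ) * (t' * t) = t'' := smul_left_injective ℂ h.ne_zero (by simpa [mul_assoc] using h4)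
  have h6 := congrArg norm h5
  rw [norm_mul, Circle.norm_coe, one_mul, ← Complex.ofReal_mul, Complex.norm_real,
    Complex.norm_real, Real.norm_of_nonneg (by positivity), Real.norm_of_nonneg ht''.le] at h6
  rw [← h6] at h5
  push_cast at h5
  have h7 : (t' * t : ℂ) ≠ 0 := by
    have : t' * t ≠ 0 := by positivity
    exact_mod_cast this
  exact Circle.ext (by simpa using mul_right_cancel₀ h7 (h5.trans (one_mul _).symm))

/-- Splitting (s,s,k) into its ket part and a bra part, the bra part contributes no phase. This
identifies the phase seen by end-point operators, on which (s,s,k) acts by conjugation, with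
i_gω(s,k). -/
theorem slant_diagElt (h : PositiveRep S ω r) (g : G) (p : G × K) (hgp : g * p.1 = p.1 * g) :
    slant ω (ketElt (g, 1)) (diagElt p) = slant ω (ketElt (g, 1)) (ketElt p) := by
  rw [← ketElt_mul_braElt, h.slant_mul_right rfl rfl, h.slant_ket_bra, mul_one]
  · rw [ketElt_mul, ketElt_mul]
    congr 1
    ext <;> simp [hgp]
  · exact ketElt_braElt_comm _ _

/-! ### Normal form of the representation and of its cocycle -/

section NormalForm

/-- The symmetry `k`, normalized to fix the distinguished vector. -/
noncomputable def weakScalar (h : PositiveRep S ω r) (k : K) : ℂ := (h.diag (1, k)).choose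

theorem weakScalar_ne_zero (h : PositiveRep S ω r) (k : K) : h.weakScalar k ≠ 0 :=
  (h.diag (1, k)).choose_spec.1

theorem weak_self (h : PositiveRep S ω r) (k : K) :
    S (ketElt (1, k)) r = h.weakScalar k • r := (h.diag (1, k)).choose_spec.2

/-- The weak symmetry normalized to fix the distinguished vector. -/
noncomputable def weak (h : PositiveRep S ω r) (k : K) (v : E) : E :=
  (h.weakScalar k)⁻¹ • S (ketElt (1, k)) v

theorem weak_smul (h : PositiveRep S ω r) (k : K) (c : ℂ) (v : E) :
    h.weak k (c • v) = c • h.weak k v := by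
  rw [weak, h.ket_smul, weak, smul_comm]

theorem weak_fix (h : PositiveRep S ω r) (k : K) : h.weak k r = r := by
  rw [weak, h.weak_self, smul_smul, inv_mul_cancel₀ (h.weakScalar_ne_zero k), one_smul]

theorem ket_eq_weak (h : PositiveRep S ω r) (k : K) (v : E) :
    S (ketElt (1, k)) v = h.weakScalar k • h.weak k v := by
  rw [weak, smul_smul, mul_inv_cancel₀ (h.weakScalar_ne_zero k), one_smul]

theorem weak_weak (h : PositiveRep S ω r) (k k' : K) (v : E) :
    h.weak k (h.weak k' v) = h.weak (k * k') v := by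
  obtain ⟨e, he⟩ : ∃ e : ℂ, ∀ v, h.weak k (h.weak k' v) = e • h.weak (k * k') v := by
    refine ⟨(h.weakScalar k)⁻¹ * (h.weakScalar k')⁻¹ * (ω (ketElt (1, k)) (ketElt (1, k')) *
      h.weakScalar (k * k')), fun v => ?_⟩
    have h1 : (ketElt (1, k) * ketElt (1, k') : DoubledGroup G K) = ketElt (1, k * k') := by
      rw [ketElt_mul]; simp
    rw [weak, weak, h.ket_smul, h.map_mul, h1, h.ket_eq_weak, smul_smul, smul_smul, smul_smul]
    congr 1
    ring
  have h1 := he r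
  rw [h.weak_fix, h.weak_fix, h.weak_fix] at h1
  rw [he, h.eq_one_of_smul_self h1, one_smul]

theorem theta_weak (h : PositiveRep S ω r) (k : K) (v : E) :
    h.theta (h.weak k v) = h.weak k (h.theta v) := by
  obtain ⟨e, he⟩ : ∃ e : ℂ, ∀ v, h.theta (h.weak k v) = e • h.weak k (h.theta v) := by
    refine ⟨starRingEnd ℂ (h.weakScalar k)⁻¹ * (ω (hermElt G K) (ketElt (1, k)) *
      (ω (ketElt (1, k)) (hermElt G K) : ℂ)⁻¹) * h.weakScalar k, fun v => ?_⟩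
    have h2 : S (hermElt G K) (S (ketElt (1, k)) v) = ((ω (hermElt G K) (ketElt (1, k)) *
        (ω (ketElt (1, k)) (hermElt G K) : ℂ)⁻¹)) • S (ketElt (1, k)) (S (hermElt G K) v) := by
      rw [h.map_mul, h.map_mul, hermElt_mul_ketElt_one, smul_smul, mul_assoc,
        inv_mul_cancel₀ (Circle.coe_ne_zero _), mul_one]
    rw [weak, h.theta_smul, theta, h2, h.ket_eq_weak k (S (hermElt G K) v), theta, h.weak_smul,
      smul_smul, smul_smul, smul_smul, smul_smul]
    congr 1
    ring
  have h1 := he r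
  rw [h.theta_self, h.weak_fix, h.theta_self] at h1
  rw [he, h.eq_one_of_smul_self h1, one_smul]

theorem weak_ket (h : PositiveRep S ω r) (k : K) (g : G) (v : E) :
    h.weak k (S (ketElt (g, 1)) v) =
      (slant ω (ketElt (g, 1)) (ketElt (1, k)) : ℂ) • S (ketElt (g, 1)) (h.weak k v) := by
  have h1 : (ketElt (g, 1) * ketElt (1, k) : DoubledGroup G K) = ketElt (1, k) * ketElt (g, 1) := by
    rw [ketElt_mul, ketElt_mul]; simp
  rw [weak, h.slant_smul h1, weak, h.ket_smul, smul_comm]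

/-- θ commutes with the weak symmetry and conjugates scalars, so the bra copy has the inverse
pairing. -/
theorem weak_bra (h : PositiveRep S ω r) (k : K) (g : G) (v : E) :
    h.weak k (h.bra g v) =
      (((slant ω (ketElt (g, 1)) (ketElt (1, k)))⁻¹ : Circle) : ℂ) • h.bra g (h.weak k v) := by
  rw [bra, ← h.theta_weak, h.weak_ket, h.theta_smul, ← h.theta_weak k v,
    Circle.coe_inv_eq_conj, bra]

theorem bra_ket (h : PositiveRep S ω r) (g g' : G) (v : E) :
    h.bra g' (S (ketElt (g, 1)) v) = S (ketElt (g, 1)) (h.bra g' v) := by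
  obtain ⟨c, -, hc⟩ := h.exists_bra_eq g'
  rw [hc, hc, h.ket_smul, h.slant_smul (ketElt_braElt_comm _ _), h.slant_ket_bra, Circle.coe_one,
    one_smul]

theorem theta_ket (h : PositiveRep S ω r) (g : G) (v : E) :
    h.theta (S (ketElt (g, 1)) v) = h.bra g (h.theta v) := by
  rw [bra, h.theta_theta]

theorem theta_bra (h : PositiveRep S ω r) (g : G) (v : E) :
    h.theta (h.bra g v) = S (ketElt (g, 1)) (h.theta v) := by
  rw [bra, h.theta_theta]

/-- The power of the normalized Hermiticity symmetry given by a sign. -/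
noncomputable def thetaPow (h : PositiveRep S ω r) (s : ℤˣ) (v : E) : E :=
  if s = 1 then v else h.theta v

/-- The unitary part of the normalized representation. -/
noncomputable def unitaryPart (h : PositiveRep S ω r) (n : G × G × K) (v : E) : E :=
  S (ketElt (n.1, 1)) (h.bra n.2.1 (h.weak n.2.2 v))

theorem thetaPow_thetaPow (h : PositiveRep S ω r) (s t : ℤˣ) (v : E) :
    h.thetaPow s (h.thetaPow t v) = h.thetaPow (s * t) v := by
  rcases Int.units_eq_one_or s with rfl | rfl <;> rcases Int.units_eq_one_or t with rfl | rfl <;>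
    simp [thetaPow, h.theta_theta]

theorem thetaPow_unitaryPart (h : PositiveRep S ω r) (s : ℤˣ) (n : G × G × K) (v : E) :
    h.thetaPow s (h.unitaryPart n v) = h.unitaryPart (hermAction G K s n) (h.thetaPow s v) := by
  rcases Int.units_eq_one_or s with rfl | rfl
  · simp [thetaPow]
  · have h1 : hermAction G K (-1) n = (n.2.1, n.1, n.2.2) := by simp [hermAction, swapAut]
    rw [h1]
    simp only [thetaPow, unitaryPart]
    rw [if_neg (by decide), if_neg (by decide), h.theta_ket, h.theta_bra, h.theta_weak, h.bra_ket]

end NormalForm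

end PositiveRep

/-- The cocycle of the doubled group determined by a cocycle `c` of `G` and a pairing `b` of `G`
and `K`. -/
noncomputable def normalCocycle (c : G → G → Circle) (b : G → K → Circle)
    (x y : DoubledGroup G K) : Circle :=
  b (hermAction G K x.right y.left).1 x.left.2.2 *
    (b (hermAction G K x.right y.left).2.1 x.left.2.2)⁻¹ *
    (c x.left.1 (hermAction G K x.right y.left).1 *
      (c x.left.2.1 (hermAction G K x.right y.left).2.1)⁻¹)

/-- A cochain f on G extends to f(g)/f(h) on (g,h,k): the bra side enters inversely, and exchanging
g and h inverts the value, as the anti-unitary action requires. -/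
theorem normalCocycle_cohomologous {c₁ c₂ : G → G → Circle} (b : G → K → Circle)
    (h : Cohomologous 1 c₁ c₂) :
    Cohomologous (antiSign G K) (normalCocycle c₁ b) (normalCocycle c₂ b) := by
  obtain ⟨f, hf⟩ := h
  refine ⟨fun x => f x.left.1 / f x.left.2.1, fun x y => ?_⟩
  simp only [MonoidHom.one_apply, Units.val_one, zpow_one] at hf
  obtain ⟨n, s⟩ := x
  obtain ⟨m, t⟩ := y
  have hσ : antiSign G K ⟨n, s⟩ = s := rfl
  have hleft : ((⟨n, s⟩ : DoubledGroup G K) * ⟨m, t⟩).left = n * hermAction G K s m := rfl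
  have hpow : (f m.1 / f m.2.1) ^ (s : ℤ) =
      f (hermAction G K s m).1 / f (hermAction G K s m).2.1 := by
    rcases Int.units_eq_one_or s with rfl | rfl <;> simp [hermAction, swapAut]
  simp only [normalCocycle, hf, hσ, hleft, Prod.fst_mul, Prod.snd_mul]
  rw [hpow]
  generalize (hermAction G K s m) = m'
  rw [← Additive.ofMul.injective.eq_iff]
  simp only [ofMul_mul, ofMul_div, ofMul_inv]
  abel

namespace PositiveRep

variable {E : Type*} [AddCommGroup E] [Module ℂ E] {S : DoubledGroup G K → E → E}
  {ω : DoubledGroup G K → DoubledGroup G K → Circle} {r : E}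

/-- The pairing of the strong and the weak symmetry. -/
noncomputable def pairing (ω : DoubledGroup G K → DoubledGroup G K → Circle) (g : G) (k : K) : Circle :=
  slant ω (ketElt (g, 1)) (ketElt (1, k))

theorem unitaryPart_unitaryPart (h : PositiveRep S ω r) (n m : G × G × K) (v : E) :
    h.unitaryPart n (h.unitaryPart m v) =
      ((pairing ω m.1 n.2.2 * (pairing ω m.2.1 n.2.2)⁻¹ *
        (ketCocycle ω n.1 m.1 * (ketCocycle ω n.2.1 m.2.1)⁻¹) : Circle) : ℂ) •
        h.unitaryPart (n * m) v := by
  simp only [unitaryPart, h.weak_ket, h.weak_bra, h.bra_smul, h.ket_smul, h.bra_ket, h.bra_bra,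
    h.ket_ket, h.weak_weak, smul_smul, Prod.fst_mul, Prod.snd_mul]
  congr 1
  simp only [pairing, Circle.coe_mul]
  ring

/-- The normalized representation. -/
noncomputable def normalRep (h : PositiveRep S ω r) (x : DoubledGroup G K) (v : E) : E :=
  h.unitaryPart x.left (h.thetaPow x.right v)

theorem normalRep_normalRep (h : PositiveRep S ω r) (x y : DoubledGroup G K) (v : E) :
    h.normalRep x (h.normalRep y v) =
      (normalCocycle (ketCocycle ω) (pairing ω) x y : ℂ) • h.normalRep (x * y) v := by
  rw [normalRep, normalRep, h.thetaPow_unitaryPart, h.unitaryPart_unitaryPart, h.thetaPow_thetaPow]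
  rfl

/-- Every element factors into ket, bra, weak and Hermiticity parts, each represented by its
normalized operator up to a nonzero scalar. -/
theorem exists_normalRep_eq (h : PositiveRep S ω r) (x : DoubledGroup G K) :
    ∃ c : ℂ, c ≠ 0 ∧ ∀ v, h.normalRep x v = c • S x v := by
  obtain ⟨n, s⟩ := x
  obtain ⟨a, ha, h1⟩ : ∃ a : ℂ, a ≠ 0 ∧ ∀ v, h.thetaPow s v =
      a • S (SemidirectProduct.inr s) v := by
    rcases Int.units_eq_one_or s with rfl | rfl
    · refine ⟨(ω 1 1 : ℂ)⁻¹, by simp, fun v => ?_⟩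
      rw [_root_.map_one, h.map_one, smul_smul, inv_mul_cancel₀ (Circle.coe_ne_zero _), one_smul]
      simp [thetaPow]
    · refine ⟨h.hermScalar⁻¹, inv_ne_zero h.hermScalar_ne_zero, fun v => ?_⟩
      simp [thetaPow, theta, hermElt]
  obtain ⟨b, hb, h2⟩ := h.exists_bra_eq n.2.1
  have hx : (⟨n, s⟩ : DoubledGroup G K) =
      ketElt (n.1, 1) * (braElt K n.2.1 * (ketElt (1, n.2.2) * SemidirectProduct.inr s)) := by
    rw [SemidirectProduct.mk_eq_inl_mul_inr, ketElt, ketElt, braElt, ← mul_assoc, ← mul_assoc,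
      ← _root_.map_mul, ← _root_.map_mul]
    simp
  refine ⟨(h.weakScalar n.2.2)⁻¹ * a * b * (ω (ketElt (1, n.2.2)) (SemidirectProduct.inr s) *
    ω (braElt K n.2.1) (ketElt (1, n.2.2) * SemidirectProduct.inr s) * ω (ketElt (n.1, 1))
      (braElt K n.2.1 * (ketElt (1, n.2.2) * SemidirectProduct.inr s))), ?_, fun v => ?_⟩
  · simp [ha, hb, h.weakScalar_ne_zero]
  · rw [normalRep, unitaryPart, weak, h1, h.ket_smul, h.bra_smul, h.bra_smul, h2, h.ket_smul,
      h.ket_smul, h.ket_smul, h.map_mul (ketElt _) (SemidirectProduct.inr s),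
      h.map_smul_of_linear (antiSign_braElt _), h.map_mul (braElt K _), h.ket_smul, h.ket_smul,
      h.map_mul, ← hx, smul_smul, smul_smul, smul_smul, smul_smul, smul_smul]
    congr 1
    ring

/-- The phase of a nonzero complex number. -/
noncomputable def phase (z : ℂ) (hz : z ≠ 0) : Circle :=
  ⟨z / ‖z‖, mem_sphere_zero_iff_norm.2 (by
    rw [norm_div, Complex.norm_real, norm_norm, div_self (norm_ne_zero_iff.2 hz)])⟩

theorem eq_norm_mul_phase (z : ℂ) (hz : z ≠ 0) : z = ‖z‖ * (phase z hz : ℂ) := by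
  have : (‖z‖ : ℂ) ≠ 0 := by exact_mod_cast norm_ne_zero_iff.2 hz
  change z = ‖z‖ * (z / ‖z‖)
  field_simp

/-- The class of the cocycle is determined by its restriction to the strong symmetry and the pairing
of the strong and the weak symmetry. -/
theorem cohomologous_normalCocycle (h : PositiveRep S ω r) :
    Cohomologous (antiSign G K) (normalCocycle (ketCocycle ω) (pairing ω)) ω := by
  choose c hc0 hc using h.exists_normalRep_eq
  refine ⟨fun x => phase (c x) (hc0 x), fun x y => ?_⟩
  set η := normalCocycle (ketCocycle ω) (pairing ω) x y
  have h1 : c x * (conjSign (antiSign G K x) (c y) * ω x y) = η * c (x * y) := by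
    refine smul_left_injective ℂ (h.ne_zero_of_ne_zero (x * y) h.ne_zero) ?_
    simp only [mul_smul]
    rw [← hc (x * y), ← h.normalRep_normalRep, ← h.map_mul, ← h.map_smul, ← hc, ← hc]
  -- Both cocycles are unimodular, so the moduli of the rescaling factors multiply exactly and the
  -- phases alone give the coboundary.
  have hn : ‖c x‖ * ‖c y‖ = ‖c (x * y)‖ := by
    have h2 := congrArg norm h1
    rwa [norm_mul, norm_mul, norm_mul, norm_conjSign, Circle.norm_coe, Circle.norm_coe, mul_one,
      one_mul] at h2
  have hn0 : (‖c (x * y)‖ : ℂ) ≠ 0 := by exact_mod_cast norm_ne_zero_iff.2 (hc0 (x * y))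
  have h2 : phase (c x) (hc0 x) * (phase (c y) (hc0 y) ^ ((antiSign G K x : ℤˣ) : ℤ) * ω x y) =
      η * phase (c (x * y)) (hc0 (x * y)) := by
    refine Circle.ext (mul_left_cancel₀ hn0 ?_)
    have e1 := eq_norm_mul_phase (c x) (hc0 x)
    have e2 := eq_norm_mul_phase (c y) (hc0 y)
    have e3 := eq_norm_mul_phase (c (x * y)) (hc0 (x * y))
    have e4 : conjSign (antiSign G K x) (c y) =
        ‖c y‖ * (phase (c y) (hc0 y) ^ ((antiSign G K x : ℤˣ) : ℤ) : Circle) := by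
      have hr : ∀ (s : ℤˣ) (t : ℝ), conjSign s t = t := by
        intro s t
        rcases Int.units_eq_one_or s with rfl | rfl <;> simp
      conv_lhs => rw [e2]
      rw [_root_.map_mul, hr, conjSign_circle]
    rw [e4] at h1
    simp only [Circle.coe_mul]
    calc _ = (‖c x‖ * (phase (c x) (hc0 x) : ℂ)) * (‖c y‖ *
          (phase (c y) (hc0 y) ^ ((antiSign G K x : ℤˣ) : ℤ) : Circle) * ω x y) := by
          rw [← hn]; push_cast; ring
      _ = η * c (x * y) := by rw [← e1, h1]
      _ = _ := by conv_lhs => rw [e3]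
                  ring
  rw [← mul_div_assoc, eq_div_iff_mul_eq', ← h2]
  exact mul_rotate' _ _ _

end PositiveRep

variable {G K : Type*} [Group G] [Group K]

/-! ### The virtual representation is positive -/

section Virtual

variable {n : ℕ}

/-- The semilinear action of the doubled group on the virtual space. -/
noncomputable def virtualAct (V : DoubledGroup G K → GL (Fin n) ℂ) (x : DoubledGroup G K)
    (v : Fin n → ℂ) : Fin n → ℂ :=
  (V x).val *ᵥ fun i => conjSign (antiSign G K x) (v i)

theorem virtualAct_of_linear (V : DoubledGroup G K → GL (Fin n) ℂ) {x : DoubledGroup G K}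
    (hx : antiSign G K x = 1) (v : Fin n → ℂ) : virtualAct V x v = (V x).val *ᵥ v := by
  simp [virtualAct, hx]

theorem virtualAct_hermElt (V : DoubledGroup G K → GL (Fin n) ℂ) (v : Fin n → ℂ) :
    virtualAct V (hermElt G K) v = (V (hermElt G K)).val *ᵥ fun i => starRingEnd ℂ (v i) := by
  simp [virtualAct, antiSign_hermElt]

theorem virtualAct_smul (V : DoubledGroup G K → GL (Fin n) ℂ) (x : DoubledGroup G K) (c : ℂ)
    (v : Fin n → ℂ) :
    virtualAct V x (c • v) = conjSign (antiSign G K x) c • virtualAct V x v := by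
  rw [virtualAct, virtualAct, ← Matrix.mulVec_smul]
  congr 1
  ext i
  simp

theorem virtualAct_injective (V : DoubledGroup G K → GL (Fin n) ℂ) (x : DoubledGroup G K) :
    Function.Injective (virtualAct V x) := by
  intro v w hvw
  have h1 := congrArg ((V x)⁻¹.val *ᵥ ·) hvw
  simp only [virtualAct, Matrix.mulVec_mulVec, Units.inv_mul, Matrix.one_mulVec] at h1
  ext i
  exact (conjSign (antiSign G K x)).injective (congrFun h1 i)

end Virtual

namespace SymmetricMPDO

theorem act_ketElt (ρ : SymmetricMPDO G K) (g : G) :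
    ρ.act (ketElt (g, 1)) = leftRight (ρ.U g).val 1 ρ.A := by
  rw [ρ.act_eq, actOn, if_pos (antiSign_ketElt _)]
  have h1 : ρ.onSite (g, 1) = ρ.U g := by simp [onSite]
  have h2 : ρ.onSite (1, 1) = 1 := map_one ρ.onSite
  simp only [ketElt, SemidirectProduct.left_inl]
  rw [h1, h2]
  rfl

theorem act_diagElt (ρ : SymmetricMPDO G K) (p : G × K) :
    ρ.act (diagElt p) = leftRight (ρ.onSite p).val (ρ.onSite p).val ρ.A := by
  rw [ρ.act_eq, actOn, if_pos (show antiSign G K (diagElt p) = 1 from rfl)]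
  rfl

theorem act_hermElt (ρ : SymmetricMPDO G K) : ρ.act (hermElt G K) = hermTensor ρ.A := by
  rw [ρ.act_eq, actOn, antiSign_hermElt, if_neg (by decide)]
  have h2 : ρ.onSite (1, 1) = 1 := map_one ρ.onSite
  have h3 : leftRight (1 : Matrix (Fin ρ.d) (Fin ρ.d) ℂ) 1 (hermTensor ρ.A) = hermTensor ρ.A := by
    ext i j a b
    rw [leftRight_apply]
    simp
  change leftRight (ρ.onSite (1, 1)).val (ρ.onSite (1, 1)).val _ = _
  rw [h2]
  exact h3

theorem unitary_mul (ρ : SymmetricMPDO G K) (u : Matrix.unitaryGroup (Fin ρ.d) ℂ) :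
    (u.val)ᴴ * u.val = 1 := Matrix.UnitaryGroup.star_mul_self u

namespace IsProjectiveAction

variable {ρ : SymmetricMPDO G K} {V : DoubledGroup G K → GL (Fin ρ.χ) ℂ}
  {ω : DoubledGroup G K → DoubledGroup G K → Circle} {l : ℝ} {r s : Fin ρ.χ → ℂ}

theorem virtualAct_mul (h : ρ.IsProjectiveAction V ω) (x y : DoubledGroup G K)
    (v : Fin ρ.χ → ℂ) :
    virtualAct V x (virtualAct V y v) = (ω x y : ℂ) • virtualAct V (x * y) v := by
  have h1 : (fun i => conjSign (antiSign G K x) (virtualAct V y v i)) =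
      (twist x (V y)).val *ᵥ fun i => conjSign (antiSign G K (x * y)) (v i) := by
    rw [map_mul, twist]
    rcases Int.units_eq_one_or (antiSign G K x) with hx | hx
    · rw [hx, if_pos rfl]
      simp [virtualAct]
    · rw [hx, if_neg (by decide)]
      ext i
      simp only [virtualAct, Matrix.mulVec, dotProduct, conjSign_neg_one, map_sum, map_mul]
      refine Finset.sum_congr rfl fun j _ => ?_
      rcases Int.units_eq_one_or (antiSign G K y) with hy | hy <;> simp [hy]
  rw [virtualAct, h1, Matrix.mulVec_mulVec, ← Units.val_mul, h.projective, Matrix.smul_mulVec]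
  rfl

theorem virtualAct_one (h : ρ.IsProjectiveAction V ω) (v : Fin ρ.χ → ℂ) :
    virtualAct V 1 v = (ω 1 1 : ℂ) • v := by
  apply virtualAct_injective V 1
  rw [h.virtualAct_mul, mul_one, virtualAct_smul, map_one, conjSign_one, RingHom.id_apply]

/-- Conjugating the physical indices by one unitary leaves T unchanged, so `Dominant.gauge` applies
from T to itself: the phase is trivial and r and r sᵀ are preserved. -/
theorem diag_gauge (h : ρ.IsProjectiveAction V ω) (hD : Dominant (transfer ρ.A) l r s) (p : G × K) :
    (∀ i j, leftRight (ρ.onSite p).val (ρ.onSite p).val ρ.A i j =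
      (V (diagElt p))⁻¹.val * ρ.A i j * (V (diagElt p)).val) ∧
    (∃ c : ℂ, c ≠ 0 ∧ (V (diagElt p)).val *ᵥ r = c • r) ∧
    (V (diagElt p)).val * Matrix.vecMulVec r s = Matrix.vecMulVec r s * (V (diagElt p)).val := by
  obtain ⟨κ, hκ⟩ := h.gauge
  have h1 := hκ (diagElt p)
  rw [act_diagElt] at h1
  have h2 := opTransfer_gauge h1 1
  rw [opTransfer_leftRight, mul_one, ρ.unitary_mul, opTransfer_one] at h2
  obtain ⟨hκ1, h3, h4⟩ := hD.gauge hD h2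
  refine ⟨fun i j => ?_, h3, h4⟩
  rw [h1, hκ1, Circle.coe_one, one_smul]

theorem herm_gauge (h : ρ.IsProjectiveAction V ω) (hD : Dominant (transfer ρ.A) l r s) :
    (∀ i j, hermTensor ρ.A i j = (1 : ℂ) •
      ((V (hermElt G K))⁻¹.val * ρ.A i j * (V (hermElt G K)).val)) ∧
    ∃ c : ℂ, c ≠ 0 ∧ virtualAct V (hermElt G K) r = c • r := by
  obtain ⟨κ, hκ⟩ := h.gauge
  have h1 := hκ (hermElt G K)
  rw [act_hermElt] at h1
  have h2 := opTransfer_gauge h1 1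
  rw [opTransfer_hermTensor, Matrix.conjTranspose_one, opTransfer_one] at h2
  obtain ⟨hκ1, h3, -⟩ := hD.gauge hD.map_conj h2
  refine ⟨fun i j => ?_, ?_⟩
  · rw [h1, hκ1, Circle.coe_one]
  · simpa only [virtualAct_hermElt] using h3

/-- The gauge transformation of an element of the strong symmetry on transfer matrices. -/
theorem exists_ket_gauge (h : ρ.IsProjectiveAction V ω) (g : G) :
    ∃ κ : Circle, ∀ O, opTransfer ρ.A (O * (ρ.U g).val) = (κ : ℂ) •
      ((V (ketElt (g, 1)))⁻¹.val * opTransfer ρ.A O * (V (ketElt (g, 1))).val) := by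
  obtain ⟨κ, hκ⟩ := h.gauge
  refine ⟨κ (ketElt (g, 1)), fun O => ?_⟩
  have h1 := hκ (ketElt (g, 1))
  rw [act_ketElt] at h1
  have h2 := opTransfer_gauge h1 O
  rwa [opTransfer_leftRight, Matrix.conjTranspose_one, one_mul] at h2

theorem hermElt_ketElt_sq (g : G) :
    hermElt G K * (ketElt (g, 1) * (hermElt G K * ketElt (g, 1))) = diagElt (g, 1) := by
  rw [← ketElt_mul_braElt, ← hermElt_ketElt_hermElt, ← mul_assoc (ketElt _) (hermElt _ _),
    ← mul_assoc (hermElt _ _) _ (ketElt _), hermElt_ketElt_hermElt, ketElt_braElt_comm]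

/-- Every choice of R gives a nonnegative string value. Taking R with transfer matrix V_x⁻¹ makes
the value equal to |e|²/(t l²), where e is the eigenvalue of H on r and t that of (H g_l)²; hence t
> 0. -/
theorem pos (h : ρ.IsProjectiveAction V ω) (hD : Dominant (transfer ρ.A) l r s) (g : G) :
    ∃ t : ℝ, 0 < t ∧ virtualAct V (hermElt G K) (virtualAct V (ketElt (g, 1))
      (virtualAct V (hermElt G K) (virtualAct V (ketElt (g, 1)) r))) = (t : ℂ) • r := by
  have hinj := ρ.strongInjective
  set H := hermElt G K with hH
  set x : DoubledGroup G K := ketElt (g, 1) with hx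
  have hx1 : antiSign G K x = 1 := antiSign_ketElt _
  have hH1 : antiSign G K H = -1 := antiSign_hermElt
  obtain ⟨t, ht0, ht⟩ : ∃ t : ℂ, t ≠ 0 ∧ virtualAct V H (virtualAct V x (virtualAct V H
      (virtualAct V x r))) = t • r := by
    obtain ⟨-, ⟨c, hc, h1⟩, -⟩ := h.diag_gauge hD (g, 1)
    refine ⟨starRingEnd ℂ (ω H x * ω x (H * x)) * (ω H (x * (H * x)) * c), ?_, ?_⟩
    · simp [hc]
    · rw [h.virtualAct_mul H x r, virtualAct_smul, hx1, conjSign_one, RingHom.id_apply,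
        h.virtualAct_mul x, smul_smul, virtualAct_smul, hH1, conjSign_neg_one, h.virtualAct_mul H,
        hH, hx, hermElt_ketElt_sq,
        virtualAct_of_linear V (show antiSign G K (diagElt (g, 1)) = 1 from rfl), h1, smul_smul,
        smul_smul, mul_assoc]
  obtain ⟨hherm, e, he, hHr⟩ := h.herm_gauge hD
  obtain ⟨κ, hκ⟩ := h.exists_ket_gauge g
  have hκ0 : (κ : ℂ) ≠ 0 := Circle.coe_ne_zero κ
  -- Absorbing κ⁻¹ into the string keeps it unitary and removes the oscillating factor κ^n, as the
  -- Gram argument requires.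
  set u : Matrix (Fin ρ.d) (Fin ρ.d) ℂ := (κ : ℂ)⁻¹ • (ρ.U g).val with hu
  have huu : uᴴ * u = 1 := by
    rw [hu, Matrix.conjTranspose_smul, smul_mul_smul_comm, ρ.unitary_mul]
    have : star (κ : ℂ)⁻¹ * (κ : ℂ)⁻¹ = 1 := by
      rw [← starRingEnd_apply, Complex.conj_mul', norm_inv, Circle.norm_coe]
      simp
    rw [this, one_smul]
  have hku : ∀ O, opTransfer ρ.A (O * u) =
      (V x)⁻¹.val * opTransfer ρ.A O * (V x).val := by
    intro O
    rw [hu, mul_smul_comm, opTransfer_smul, hκ, smul_smul, inv_mul_cancel₀ hκ0, one_smul]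
  have hu1 : opTransfer ρ.A u = (V x)⁻¹.val * transfer ρ.A * (V x).val := by
    rw [← opTransfer_one, ← hku, one_mul]
  set R := liftOp hinj (V x)⁻¹.val with hR
  have hTR : opTransfer ρ.A R = (V x)⁻¹.val := opTransfer_liftOp _ _
  set Z := (V x)⁻¹.val *ᵥ (opTransfer ρ.A Rᴴ *ᵥ r) with hZ
  have hsv : stringValue ρ.A l r s (V x) (Rᴴ * u) R = (s ⬝ᵥ Z) / l ^ 2 := by
    rw [stringValue, hku, hTR, Units.mul_inv, Matrix.one_mulVec, hD.dot, mul_one, hZ,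
      Matrix.mulVec_mulVec, mul_assoc _ (V x).val, Units.mul_inv, mul_one]
  have hxZ : virtualAct V x Z = opTransfer ρ.A Rᴴ *ᵥ r := by
    rw [virtualAct_of_linear V hx1, hZ, Matrix.mulVec_mulVec, Units.mul_inv, Matrix.one_mulVec]
  have hHY : virtualAct V H (opTransfer ρ.A Rᴴ *ᵥ r) = e • ((V x)⁻¹.val *ᵥ r) := by
    have h1 := opTransfer_hermTensor ρ.A R
    rw [opTransfer_gauge hherm, one_smul, hTR] at h1
    have h2 : (fun i => starRingEnd ℂ ((opTransfer ρ.A Rᴴ *ᵥ r) i)) =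
        (opTransfer ρ.A Rᴴ).map (starRingEnd ℂ) *ᵥ fun i => starRingEnd ℂ (r i) := by
      ext i
      simp [Matrix.mulVec, dotProduct]
    rw [virtualAct_hermElt, h2, ← h1, ← Matrix.mulVec_mulVec, ← virtualAct_hermElt, ← hH, hHr,
      Matrix.mulVec_smul, Matrix.mulVec_smul, Matrix.mulVec_mulVec, ← mul_assoc, Units.mul_inv,
      one_mul]
  -- Apply the linear injective map (H x)² to both sides: Z goes successively to T_{Rᴴ} r, e V_x⁻¹
  -- r, e r and |e|² r, while r is multiplied by t.
  have hZr : Z = ((‖e‖ ^ 2 : ℝ) / t : ℂ) • r := by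
    apply virtualAct_injective V x
    apply virtualAct_injective V H
    apply virtualAct_injective V x
    apply virtualAct_injective V H
    rw [hxZ, hHY]
    simp only [virtualAct_smul, hx1, hH1, conjSign_one, conjSign_neg_one, RingHom.id_apply,
      Complex.conj_conj]
    rw [ht, virtualAct_of_linear V hx1, Matrix.mulVec_mulVec, Units.mul_inv, Matrix.one_mulVec, hHr,
      smul_smul, smul_smul, div_mul_cancel₀ _ ht0, Complex.conj_mul']
    push_cast
    rfl
  have hpos := norm_stringValue_le_re ρ.posSemidef hD huu hu1 R
  rw [hsv, hZr, dotProduct_smul, hD.dot, smul_eq_mul, mul_one] at hpos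
  have hl := hD.pos
  have hq : ((‖e‖ ^ 2 : ℝ) / t / l ^ 2 : ℂ) = ((‖e‖ ^ 2 / l ^ 2 : ℝ) : ℂ) * t⁻¹ := by
    push_cast
    field_simp
  have he2 : 0 < ‖e‖ ^ 2 / l ^ 2 := by have := norm_pos_iff.2 he; positivity
  rw [hq, norm_mul, Complex.norm_real, Real.norm_of_nonneg he2.le, Complex.re_ofReal_mul,
    mul_le_mul_iff_right₀ he2] at hpos
  have h5 : (t⁻¹ : ℂ) = ((‖t⁻¹‖ : ℝ) : ℂ) :=
    Complex.eq_coe_norm_of_nonneg (Complex.re_eq_norm.1 (le_antisymm (Complex.re_le_norm _) hpos))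
  refine ⟨‖t‖, norm_pos_iff.2 ht0, ?_⟩
  rw [ht]
  congr 1
  rw [norm_inv, Complex.ofReal_inv] at h5
  exact inv_injective h5

theorem positiveRep (h : ρ.IsProjectiveAction V ω) (hD : Dominant (transfer ρ.A) l r s) :
    PositiveRep (virtualAct V) ω r where
  map_smul := virtualAct_smul V
  map_mul := h.virtualAct_mul
  map_one := h.virtualAct_one
  ne_zero := hD.right_ne_zero
  diag p := by
    obtain ⟨-, h1, -⟩ := h.diag_gauge hD p
    simpa only [virtualAct_of_linear V (show antiSign G K (diagElt p) = 1 from rfl)] using h1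
  herm := (h.herm_gauge hD).2
  pos := h.pos hD

theorem mul_comm_slant (h : ρ.IsProjectiveAction V ω) {x y : DoubledGroup G K}
    (hx : antiSign G K x = 1) (hy : antiSign G K y = 1) (hxy : x * y = y * x) :
    (V y).val * (V x).val = (slant ω x y : ℂ) • ((V x).val * (V y).val) := by
  have h1 := h.projective x y
  have h2 := h.projective y x
  rw [twist, if_pos hx, Units.val_mul] at h1
  rw [twist, if_pos hy, Units.val_mul] at h2
  rw [h1, h2, smul_smul, ← Circle.coe_mul, slant, div_mul_cancel, hxy]

/-! ### Selection rule and its saturation -/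

section StringOrder

variable {H : Type*} [Group H] (j : H →* G × K) {g : G}

theorem diag_mul_ket (h : ρ.IsProjectiveAction V ω) (hD : Dominant (transfer ρ.A) l r s)
    {p : G × K} (hgp : g * p.1 = p.1 * g) :
    (V (diagElt p)).val * (V (ketElt (g, 1))).val =
      (slant ω (ketElt (g, 1)) (ketElt p) : ℂ) •
        ((V (ketElt (g, 1))).val * (V (diagElt p)).val) := by
  rw [← (h.positiveRep hD).slant_diagElt g p hgp]
  refine h.mul_comm_slant rfl rfl ?_
  rw [← ketElt_mul_braElt, ← mul_assoc, ketElt_mul, mul_assoc, ← ketElt_braElt_comm, ← mul_assoc,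
    ketElt_mul]
  congr 2
  ext <;> simp [hgp]

/-- Conjugation by V of the diagonal element fixes r sᵀ, multiplies V_g by the slant phase and the
transfer matrix of R by α(p). The right end-point factor is a trace, hence equals itself times the
product of these phases, and vanishes if that product is not 1. -/
theorem stringOrderVanishes (h : ρ.IsProjectiveAction V ω)
    (hg : ∀ p, g * (j p).1 = (j p).1 * g) {α : H →* Circle}
    (hα : ∃ p, (α p)⁻¹ ≠ slant ω (ketElt (g, 1)) (ketElt (j p))) :
    ρ.StringOrderVanishes (ρ.onSite.comp j) g α := by
  obtain ⟨l, r, s, hD⟩ := ρ.exists_dominant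
  obtain ⟨p, hp⟩ := hα
  intro R' R _ hR
  obtain ⟨κ, hκ⟩ := h.exists_ket_gauge g
  have hU := hκ 1
  rw [one_mul, opTransfer_one] at hU
  have hlim := stringLimit_norm_stringValue hD (Circle.norm_coe κ) hU R' R
  suffices hz : s ⬝ᵥ (((V (ketElt (g, 1))).val * opTransfer ρ.A R) *ᵥ r) = 0 by
    rwa [stringValue, hz, mul_zero, zero_div, norm_zero] at hlim
  obtain ⟨hgauge, -, hP⟩ := h.diag_gauge hD (j p)
  set X := V (diagElt (j p)) with hX
  set Vg := V (ketElt (g, 1)) with hVg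
  set b := slant ω (ketElt (g, 1)) (ketElt (j p)) with hb
  have hXg : X.val * Vg.val = (b : ℂ) • (Vg.val * X.val) := h.diag_mul_ket hD (hg p)
  have hXR : X.val * opTransfer ρ.A R = (α p : ℂ) • (opTransfer ρ.A R * X.val) := by
    have hgauge' : ∀ i k, leftRight (ρ.onSite (j p)).val (ρ.onSite (j p)).val ρ.A i k =
        (1 : ℂ) • (X⁻¹.val * ρ.A i k * X.val) := by simpa using hgauge
    have h1 := opTransfer_gauge hgauge' ((α p : ℂ) • R)
    have hRp := hR p
    rw [MonoidHom.comp_apply] at hRp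
    rw [opTransfer_leftRight, ← hRp, one_smul] at h1
    have h2 : ((ρ.onSite (j p)).val)ᴴ * ((ρ.onSite (j p)).val * R * ((ρ.onSite (j p)).val)ᴴ) *
        (ρ.onSite (j p)).val = R := by
      calc _ = (((ρ.onSite (j p)).val)ᴴ * (ρ.onSite (j p)).val) * R *
            (((ρ.onSite (j p)).val)ᴴ * (ρ.onSite (j p)).val) := by simp only [mul_assoc]
        _ = R := by rw [ρ.unitary_mul, one_mul, mul_one]
    rw [h2, hRp, opTransfer_smul] at h1
    conv_lhs => rw [h1]
    rw [← mul_assoc, ← mul_assoc, Units.mul_inv, one_mul, smul_mul_assoc]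
  rw [← trace_vecMulVec_mul']
  set P := Matrix.vecMulVec r s with hPdef
  set w := (P * (Vg.val * opTransfer ρ.A R)).trace with hw
  have h1 : X.val * (P * (Vg.val * opTransfer ρ.A R)) * X⁻¹.val =
      ((b * α p : Circle) : ℂ) • (P * (Vg.val * opTransfer ρ.A R)) := by
    calc _ = P * (X.val * Vg.val) * opTransfer ρ.A R * X⁻¹.val := by
          rw [← mul_assoc X.val P, hP]; simp only [mul_assoc]
      _ = (b : ℂ) • (P * Vg.val * (X.val * opTransfer ρ.A R) * X⁻¹.val) := by
          rw [hXg]; simp only [mul_assoc, smul_mul_assoc, mul_smul_comm]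
      _ = _ := by
          rw [hXR]
          simp only [mul_assoc, smul_mul_assoc, mul_smul_comm, Units.mul_inv, mul_one, smul_smul,
            Circle.coe_mul]
  have h2 : w = ((b * α p : Circle) : ℂ) * w := by
    have h3 := congrArg Matrix.trace h1
    rw [Matrix.trace_mul_comm, ← mul_assoc, Units.inv_mul, one_mul, Matrix.trace_smul] at h3
    exact h3
  by_contra hw0
  refine hp (inv_eq_of_mul_eq_one_left (Circle.ext ?_))
  exact (mul_right_cancel₀ hw0 (h2.symm.trans (one_mul w).symm))

/-- End operators with transfer matrices V_g and V_g⁻¹ cancel the gauge matrices, so both factors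
reduce to s·r = 1 and the limit is 1/l². By `liftOp_charge` their charges are those of V_g and V_g⁻¹
under conjugation. -/
theorem hasStringOrder (h : ρ.IsProjectiveAction V ω)
    (hg : ∀ p, g * (j p).1 = (j p).1 * g) {α : H →* Circle}
    (hα : ∀ p, (α p)⁻¹ = slant ω (ketElt (g, 1)) (ketElt (j p))) :
    ρ.HasStringOrder (ρ.onSite.comp j) g α := by
  obtain ⟨l, r, s, hD⟩ := ρ.exists_dominant
  have hinj := ρ.strongInjective
  set Vg := V (ketElt (g, 1)) with hVg
  have hXg : ∀ p, (V (diagElt (j p))).val * Vg.val * (V (diagElt (j p)))⁻¹.val =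
      (((α p)⁻¹ : Circle) : ℂ) • Vg.val := by
    intro p
    rw [h.diag_mul_ket hD (hg p), hα p, smul_mul_assoc, mul_assoc, Units.mul_inv, mul_one]
  have hXg' : ∀ p, (V (diagElt (j p))).val * Vg⁻¹.val * (V (diagElt (j p)))⁻¹.val =
      (α p : ℂ) • Vg⁻¹.val := by
    intro p
    have h1 : (V (diagElt (j p)) * Vg * (V (diagElt (j p)))⁻¹)⁻¹.val = (α p : ℂ) • Vg⁻¹.val := by
      refine Units.inv_eq_of_mul_eq_one_right ?_
      rw [Units.val_mul, Units.val_mul, hXg, smul_mul_smul_comm, Units.mul_inv, ← Circle.coe_mul,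
        inv_mul_cancel, Circle.coe_one, one_smul]
    rw [← h1, mul_inv_rev, mul_inv_rev, inv_inv]
    simp only [Units.val_mul, mul_assoc]
  refine ⟨liftOp hinj Vg.val, liftOp hinj Vg⁻¹.val, fun p => ?_, fun p => ?_,
    ‖stringValue ρ.A l r s Vg (liftOp hinj Vg.val) (liftOp hinj Vg⁻¹.val)‖, ?_, ?_⟩
  · exact liftOp_charge hinj (ρ.unitary_mul _) (h.diag_gauge hD (j p)).1 (hXg p)
  · exact liftOp_charge hinj (ρ.unitary_mul _) (h.diag_gauge hD (j p)).1 (hXg' p)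
  · have hl : (l : ℂ) ≠ 0 := by exact_mod_cast hD.pos.ne'
    rw [norm_pos_iff, stringValue, opTransfer_liftOp, opTransfer_liftOp, Units.mul_inv,
      Matrix.one_mulVec, hD.dot, mul_one]
    exact div_ne_zero one_ne_zero (pow_ne_zero 2 hl)
  · obtain ⟨κ, hκ⟩ := h.exists_ket_gauge g
    have hU := hκ 1
    rw [one_mul, opTransfer_one] at hU
    exact stringLimit_norm_stringValue hD (Circle.norm_coe κ) hU _ _

end StringOrder

end IsProjectiveAction

theorem not_hasStringOrder_of_vanishes {ρ : SymmetricMPDO G K} {H : Type*} [Group H]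
    {u : H →* Matrix.unitaryGroup (Fin ρ.d) ℂ} {g : G} {α : H →* Circle}
    (h : ρ.StringOrderVanishes u g α) : ¬ ρ.HasStringOrder u g α := by
  rintro ⟨R', R, h1, h2, c, hc, h3⟩
  exact hc.ne' (h3.unique (h R' R h1 h2))

end SymmetricMPDO

/-! ### Symmetric cocycles on Abelian groups split -/

section SymmetricCocycle

/-- Roots are obtained by dividing the argument; divisibility makes U(1) an injective ℤ-module. -/
noncomputable instance : DivisibleBy (Additive Circle) ℤ :=
  divisibleByOfSMulRightSurj _ _ fun {n} hn z => by
    refine ⟨Additive.ofMul (Circle.exp (Complex.arg (z.toMul : ℂ) / n)), ?_⟩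
    apply Additive.toMul.injective
    have hn' : (n : ℝ) ≠ 0 := by exact_mod_cast hn
    rw [toMul_zsmul, toMul_ofMul, ← Circle.exp_zsmul, zsmul_eq_mul, mul_div_cancel₀ _ hn', Circle.exp_arg]

/-- The central extension of an abelian group by the circle that is defined by a 2-cocycle. -/
@[ext] structure CircleExtension {G : Type*} [Group G] (η : G → G → Circle) where
  phase : Circle
  base : G

variable {G : Type*} [Group G] {η : G → G → Circle}

/-- The commutative group structure on the extension by a symmetric cocycle. -/
noncomputable abbrev CircleExtension.commGroup (hG : ∀ a b : G, a * b = b * a)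
    (hc : ∀ x y z, η x y * η (x * y) z = η y z * η x (y * z)) (hs : ∀ x y, η x y = η y x) :
    CommGroup (CircleExtension η) :=
  have h1 : ∀ x, η 1 x = η 1 1 := fun x => by
    have := hc 1 1 x
    simp only [one_mul] at this
    exact (mul_right_cancel this).symm
  { mul := fun x y => ⟨x.phase * y.phase * η x.base y.base, x.base * y.base⟩
    one := ⟨(η 1 1)⁻¹, 1⟩
    inv := fun x => ⟨x.phase⁻¹ * (η 1 1)⁻¹ * (η x.base⁻¹ x.base)⁻¹, x.base⁻¹⟩
    mul_assoc := fun x y z => CircleExtension.ext (by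
      change x.phase * y.phase * η x.base y.base * z.phase * η (x.base * y.base) z.base =
        x.phase * (y.phase * z.phase * η y.base z.base) * η x.base (y.base * z.base)
      have := hc x.base y.base z.base
      calc _ = x.phase * y.phase * z.phase * (η x.base y.base * η (x.base * y.base) z.base) := by
            simp only [mul_left_comm, mul_comm]
        _ = _ := by rw [this]; simp only [mul_left_comm, mul_comm]) (mul_assoc _ _ _)
    one_mul := fun x => CircleExtension.ext (by
      change (η 1 1)⁻¹ * x.phase * η 1 x.base = x.phase
      rw [h1 x.base, mul_right_comm, inv_mul_cancel, one_mul]) (one_mul _)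
    mul_one := fun x => CircleExtension.ext (by
      change x.phase * (η 1 1)⁻¹ * η x.base 1 = x.phase
      rw [hs x.base, h1 x.base, inv_mul_cancel_right]) (mul_one _)
    inv_mul_cancel := fun x => CircleExtension.ext (by
      change x.phase⁻¹ * (η 1 1)⁻¹ * (η x.base⁻¹ x.base)⁻¹ * x.phase * η x.base⁻¹ x.base = (η 1 1)⁻¹
      rw [mul_right_comm, inv_mul_cancel_right, mul_right_comm, inv_mul_cancel, one_mul])
      (inv_mul_cancel _)
    mul_comm := fun x y => CircleExtension.ext (by
      change x.phase * y.phase * η x.base y.base = y.phase * x.phase * η y.base x.base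
      rw [hs, mul_comm x.phase]) (hG _ _) }

/-- A symmetric 2-cocycle on an abelian group with values in the circle is a coboundary. -/
theorem exists_coboundary_of_symmetric (hG : ∀ a b : G, a * b = b * a)
    (hc : ∀ x y z, η x y * η (x * y) z = η y z * η x (y * z)) (hs : ∀ x y, η x y = η y x) :
    ∃ f : G → Circle, ∀ x y, η x y = f (x * y) / (f x * f y) := by
  let _ := CircleExtension.commGroup hG hc hs
  have h1 : ∀ x, η 1 x = η 1 1 := fun x => by
    have := hc 1 1 x
    simp only [one_mul] at this
    exact (mul_right_cancel this).symm
  have hmul : ∀ x y : CircleExtension η,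
      x * y = ⟨x.phase * y.phase * η x.base y.base, x.base * y.base⟩ := fun _ _ => rfl
  -- The cocycle is not normalized, so the identity has phase η(1,1)⁻¹ and the embedding carries
  -- that factor.
  let ι : Circle →* CircleExtension η :=
    { toFun := fun z => ⟨z * (η 1 1)⁻¹, 1⟩
      map_one' := by rw [one_mul]; rfl
      map_mul' := fun z w => by
        rw [hmul]
        ext1
        · change z * w * (η 1 1)⁻¹ = z * (η 1 1)⁻¹ * (w * (η 1 1)⁻¹) * η 1 1
          rw [mul_assoc (z * _), inv_mul_cancel_right, mul_right_comm]
        · simp }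
  have hι : Function.Injective ι := fun z w hzw =>
    mul_right_cancel (congrArg CircleExtension.phase hzw)
  -- Injectivity of the divisible group extends the identity of U(1) to a retraction of the
  -- extension; its values on the set-theoretic section (1, x) give the splitting cochain.
  obtain ⟨ψ, hψ⟩ := (Module.Baer.of_divisible (Additive Circle)).extension_property_addMonoidHom
    (MonoidHom.toAdditive ι) hι (AddMonoidHom.id (Additive Circle))
  let π : CircleExtension η →* Circle := MonoidHom.toAdditive.symm ψ
  have hπ : ∀ z, π (ι z) = z := fun z => DFunLike.congr_fun hψ (Additive.ofMul z)
  refine ⟨fun x => (π ⟨1, x⟩)⁻¹, fun x y => ?_⟩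
  have h2 : (⟨1, x⟩ : CircleExtension η) * ⟨1, y⟩ = ι (η x y) * ⟨1, x * y⟩ := by
    rw [hmul, hmul]
    ext1
    · simp only [one_mul, mul_one]
      change η x y = η x y * (η 1 1)⁻¹ * η 1 (x * y)
      rw [h1 (x * y), inv_mul_cancel_right]
    · exact (one_mul _).symm
  have h3 := congrArg π h2
  rw [map_mul, map_mul, hπ] at h3
  rw [eq_div_iff_mul_eq', ← mul_inv, h3]
  simp

end SymmetricCocycle

/-! ### Detection of SPT phases by string order -/

section StringOrder

variable {G K : Type*} [Group G] [Group K]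

theorem ketElt_comm {p q : G × K} (h : p * q = q * p) : ketElt p * ketElt q = ketElt q * ketElt p := by
  rw [ketElt_mul, ketElt_mul, h]

theorem ketElt_one : ketElt (1 : G × K) = 1 := map_one SemidirectProduct.inl

theorem strong_mul_comm {g : G} {p : G × K} (h : g * p.1 = p.1 * g) :
    (g, (1 : K)) * p = p * (g, 1) :=
  Prod.ext h (by simp)

namespace SymmetricMPDO

theorem onSite_comp_inl (ρ : SymmetricMPDO G K) : ρ.onSite.comp (MonoidHom.inl G K) = ρ.U :=
  MonoidHom.noncommCoprod_comp_inl _ _ _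

theorem onSite_comp_inr (ρ : SymmetricMPDO G K) : ρ.onSite.comp (MonoidHom.inr G K) = ρ.W :=
  MonoidHom.noncommCoprod_comp_inr _ _ _

namespace IsProjectiveAction

/-- Stated for homomorphisms i and j so that a pair of subgroups, G with itself and G with K are all
instances. -/
theorem exists_pairing {ρ : SymmetricMPDO G K} {V : DoubledGroup G K → GL (Fin ρ.χ) ℂ}
    {ω : DoubledGroup G K → DoubledGroup G K → Circle} (h : ρ.IsProjectiveAction V ω)
    {G₁ H : Type*} [Group G₁] [Group H] (i : G₁ →* G) (j : H →* G × K)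
    (hij : ∀ g p, i g * (j p).1 = (j p).1 * i g) :
    ∃ Ω : G₁ →* (H →* Circle),
      (∀ g p, Ω g p = slant ω (ketElt (i g, 1)) (ketElt (j p))) ∧
      ∀ (g : G₁) (α : H →* Circle),
        (α⁻¹ = Ω g → ρ.HasStringOrder (ρ.onSite.comp j) (i g) α) ∧
        (α⁻¹ ≠ Ω g → ρ.StringOrderVanishes (ρ.onSite.comp j) (i g) α) := by
  obtain ⟨l, r, s, hD⟩ := ρ.exists_dominant
  have hP := h.positiveRep hD
  have hcomm : ∀ g p, ketElt (i g, (1 : K)) * ketElt (j p) = ketElt (j p) * ketElt (i g, 1) :=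
    fun g p => ketElt_comm (strong_mul_comm (hij g p))
  let Ω : G₁ →* (H →* Circle) := MonoidHom.mk'
    (fun g => MonoidHom.mk' (fun p => slant ω (ketElt (i g, 1)) (ketElt (j p))) fun p q => by
      rw [map_mul, ← ketElt_mul]
      exact hP.slant_mul_right rfl rfl (hcomm g p) (hcomm g q))
    fun g g' => MonoidHom.ext fun p => by
      have h1 : ketElt (i (g * g'), (1 : K)) = ketElt (i g, 1) * ketElt (i g', 1) := by
        rw [ketElt_mul, Prod.mk_mul_mk, mul_one, map_mul]
      change slant ω (ketElt (i (g * g'), 1)) (ketElt (j p)) = _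
      rw [h1]
      exact hP.slant_mul_left rfl (hcomm g p) (hcomm g' p) rfl
  refine ⟨Ω, fun _ _ => rfl, fun g α => ⟨fun hα => ?_, fun hα => ?_⟩⟩
  · exact h.hasStringOrder j (hij g) fun p => DFunLike.congr_fun hα p
  · exact h.stringOrderVanishes j (hij g) (DFunLike.ne_iff.1 hα)

/-- Two pairings agree if and only if the same string orders are present. -/
theorem slant_eq_iff_hasStringOrder {ρ₁ ρ₂ : SymmetricMPDO G K}
    {V₁ : DoubledGroup G K → GL (Fin ρ₁.χ) ℂ} {V₂ : DoubledGroup G K → GL (Fin ρ₂.χ) ℂ}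
    {ω₁ ω₂ : DoubledGroup G K → DoubledGroup G K → Circle}
    (h₁ : ρ₁.IsProjectiveAction V₁ ω₁) (h₂ : ρ₂.IsProjectiveAction V₂ ω₂)
    {H : Type*} [Group H] (j : H →* G × K) (hj : ∀ g p, g * (j p).1 = (j p).1 * g) :
    (∀ g p, slant ω₁ (ketElt (g, 1)) (ketElt (j p)) = slant ω₂ (ketElt (g, 1)) (ketElt (j p))) ↔
      ∀ (g : G) (α : H →* Circle), ρ₁.HasStringOrder (ρ₁.onSite.comp j) g α ↔
        ρ₂.HasStringOrder (ρ₂.onSite.comp j) g α := by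
  obtain ⟨Ω₁, hΩ₁, hs₁⟩ := h₁.exists_pairing (MonoidHom.id G) j hj
  obtain ⟨Ω₂, hΩ₂, hs₂⟩ := h₂.exists_pairing (MonoidHom.id G) j hj
  -- A vanishing limit excludes a positive one, so presence of string order is equivalent to the
  -- charge condition.
  have e₁ : ∀ g α, ρ₁.HasStringOrder (ρ₁.onSite.comp j) g α ↔ α⁻¹ = Ω₁ g := fun g α =>
    ⟨not_imp_not.1 fun hn => not_hasStringOrder_of_vanishes ((hs₁ g α).2 hn), (hs₁ g α).1⟩
  have e₂ : ∀ g α, ρ₂.HasStringOrder (ρ₂.onSite.comp j) g α ↔ α⁻¹ = Ω₂ g := fun g α =>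
    ⟨not_imp_not.1 fun hn => not_hasStringOrder_of_vanishes ((hs₂ g α).2 hn), (hs₂ g α).1⟩
  simp only [e₁, e₂]
  constructor
  · intro hs g α
    have : Ω₁ g = Ω₂ g := MonoidHom.ext fun p => (hΩ₁ g p).trans ((hs g p).trans (hΩ₂ g p).symm)
    rw [this]
  · intro hs g p
    -- The charge at which the first state has string order must also be that of the second.
    have h3 := (hs g (Ω₁ g)⁻¹).1 (inv_inv _)
    rw [inv_inv] at h3
    exact (hΩ₁ g p).symm.trans ((DFunLike.congr_fun h3 p).trans (hΩ₂ g p))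

/-- Both cocycles are cohomologous to their normal forms, which are built from ω_L and the pairing
only; conversely the pairing is a class invariant. -/
theorem cohomologous_iff_pairing_eq {ρ₁ ρ₂ : SymmetricMPDO G K}
    {V₁ : DoubledGroup G K → GL (Fin ρ₁.χ) ℂ} {V₂ : DoubledGroup G K → GL (Fin ρ₂.χ) ℂ}
    {ω₁ ω₂ : DoubledGroup G K → DoubledGroup G K → Circle}
    (h₁ : ρ₁.IsProjectiveAction V₁ ω₁) (h₂ : ρ₂.IsProjectiveAction V₂ ω₂)
    (hc : Cohomologous 1 (ketCocycle ω₁) (ketCocycle ω₂)) :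
    Cohomologous (antiSign G K) ω₁ ω₂ ↔ ∀ (g : G) (k : K),
      slant ω₁ (ketElt (g, 1)) (ketElt (1, k)) = slant ω₂ (ketElt (g, 1)) (ketElt (1, k)) := by
  refine ⟨fun h g k => h.slant_eq rfl rfl (ketElt_comm (by simp)), fun h => ?_⟩
  obtain ⟨_, _, _, hD₁⟩ := ρ₁.exists_dominant
  obtain ⟨_, _, _, hD₂⟩ := ρ₂.exists_dominant
  have hp : PositiveRep.pairing ω₁ = PositiveRep.pairing ω₂ := funext fun g => funext (h g)
  refine (h₁.positiveRep hD₁).cohomologous_normalCocycle.symm.trans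
    (Cohomologous.trans ?_ (h₂.positiveRep hD₂).cohomologous_normalCocycle)
  rw [hp]
  exact normalCocycle_cohomologous _ hc

theorem ketCocycle_cocycle {ρ : SymmetricMPDO G K} {V : DoubledGroup G K → GL (Fin ρ.χ) ℂ}
    {ω : DoubledGroup G K → DoubledGroup G K → Circle} (h : ρ.IsProjectiveAction V ω) (x y z : G) :
    ketCocycle ω x y * ketCocycle ω (x * y) z = ketCocycle ω y z * ketCocycle ω x (y * z) := by
  obtain ⟨_, _, _, hD⟩ := ρ.exists_dominant
  have h1 := (h.positiveRep hD).cocycle (antiSign_ketElt (x, 1)) (ketElt (y, 1)) (ketElt (z, 1))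
  simp only [ketElt_mul, Prod.mk_mul_mk, mul_one] at h1
  exact h1

/-- Equal slant products say that the quotient of the two cocycles is symmetric, hence a coboundary.
-/
theorem cohomologous_ketCocycle_of_slant_eq (hG : ∀ a b : G, a * b = b * a)
    {ρ₁ ρ₂ : SymmetricMPDO G K}
    {V₁ : DoubledGroup G K → GL (Fin ρ₁.χ) ℂ} {V₂ : DoubledGroup G K → GL (Fin ρ₂.χ) ℂ}
    {ω₁ ω₂ : DoubledGroup G K → DoubledGroup G K → Circle}
    (h₁ : ρ₁.IsProjectiveAction V₁ ω₁) (h₂ : ρ₂.IsProjectiveAction V₂ ω₂)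
    (hs : ∀ g h : G,
      slant ω₁ (ketElt (g, 1)) (ketElt (h, 1)) = slant ω₂ (ketElt (g, 1)) (ketElt (h, 1))) :
    Cohomologous 1 (ketCocycle ω₁) (ketCocycle ω₂) := by
  obtain ⟨f, hf⟩ := exists_coboundary_of_symmetric
    (η := fun x y => ketCocycle ω₂ x y / ketCocycle ω₁ x y) hG
    (fun x y z => by
      rw [div_mul_div_comm, div_mul_div_comm, h₁.ketCocycle_cocycle, h₂.ketCocycle_cocycle])
    (fun x y => by
      have h3 : ketCocycle ω₁ y x / ketCocycle ω₁ x y = ketCocycle ω₂ y x / ketCocycle ω₂ x y :=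
        hs x y
      rw [div_eq_div_iff_mul_eq_mul] at h3 ⊢
      rw [mul_comm (ketCocycle ω₂ x y), h3])
  refine ⟨f, fun x y => ?_⟩
  rw [MonoidHom.one_apply, Units.val_one, zpow_one, ← hf, mul_div_cancel]

theorem cohomologous_iff_slant_eq (hG : ∀ a b : G, a * b = b * a)
    {ρ₁ ρ₂ : SymmetricMPDO G Unit}
    {V₁ : DoubledGroup G Unit → GL (Fin ρ₁.χ) ℂ} {V₂ : DoubledGroup G Unit → GL (Fin ρ₂.χ) ℂ}
    {ω₁ ω₂ : DoubledGroup G Unit → DoubledGroup G Unit → Circle}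
    (h₁ : ρ₁.IsProjectiveAction V₁ ω₁) (h₂ : ρ₂.IsProjectiveAction V₂ ω₂) :
    Cohomologous (antiSign G Unit) ω₁ ω₂ ↔ ∀ g h : G,
      slant ω₁ (ketElt (g, 1)) (ketElt (h, 1)) = slant ω₂ (ketElt (g, 1)) (ketElt (h, 1)) := by
  refine ⟨fun h g g' => h.slant_eq rfl rfl (ketElt_comm (by simp [hG])), fun h => ?_⟩
  refine (h₁.cohomologous_iff_pairing_eq h₂ (h₁.cohomologous_ketCocycle_of_slant_eq hG h₂ h)).2
    fun g _ => ?_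
  obtain ⟨_, _, _, hD₁⟩ := ρ₁.exists_dominant
  obtain ⟨_, _, _, hD₂⟩ := ρ₂.exists_dominant
  -- With trivial K the pairing is a slant product with the identity, which is 1.
  rw [show ketElt ((1 : G), _) = (1 : DoubledGroup G Unit) from ketElt_one,
    (h₁.positiveRep hD₁).slant_one_right rfl, (h₂.positiveRep hD₂).slant_one_right rfl]

end IsProjectiveAction

end SymmetricMPDO

end StringOrder

end MixedSPT

theorem mainTheorem5 {G K : Type*} [Group G] [Group K] :
    -- the projective representation and the cocycle that define the SPT phase exist
    (∀ ρ : MixedSPT.SymmetricMPDO G K, ∃ V ω, ρ.IsProjectiveAction V ω) ∧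
    -- string order for a strong symmetry `G₁` and a symmetry `G'` that commutes with it
    (∀ (ρ : MixedSPT.SymmetricMPDO G K) V ω, ρ.IsProjectiveAction V ω →
      ∀ (G₁ : Subgroup G) (G' : Subgroup (G × K)),
        (∀ g ∈ G₁, ∀ p ∈ G', g * p.1 = p.1 * g) →
        ∃ Ω : G₁ →* (G' →* Circle),
          (∀ (g : G₁) (p : G'),
            Ω g p = MixedSPT.slant ω (MixedSPT.ketElt (g, 1)) (MixedSPT.ketElt p)) ∧
          ∀ (g : G₁) (α : G' →* Circle),
            (α⁻¹ = Ω g → ρ.HasStringOrder (ρ.onSite.comp G'.subtype) (g : G) α) ∧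
            (α⁻¹ ≠ Ω g → ρ.StringOrderVanishes (ρ.onSite.comp G'.subtype) (g : G) α)) ∧
    -- strong Abelian symmetry
    ((∀ a b : G, a * b = b * a) →
      (∀ (ρ : MixedSPT.SymmetricMPDO G K) V ω, ρ.IsProjectiveAction V ω →
        ∃ Ω : G →* (G →* Circle),
          (∀ g h : G,
            Ω g h = MixedSPT.slant ω (MixedSPT.ketElt (g, 1)) (MixedSPT.ketElt (h, 1))) ∧
          ∀ (g : G) (α : G →* Circle),
            (α⁻¹ = Ω g → ρ.HasStringOrder ρ.U g α) ∧
            (α⁻¹ ≠ Ω g → ρ.StringOrderVanishes ρ.U g α)) ∧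
      (∀ (ρ₁ ρ₂ : MixedSPT.SymmetricMPDO G Unit) V₁ ω₁ V₂ ω₂,
        ρ₁.IsProjectiveAction V₁ ω₁ → ρ₂.IsProjectiveAction V₂ ω₂ →
        (MixedSPT.Cohomologous (MixedSPT.antiSign G Unit) ω₁ ω₂ ↔
          ∀ (g : G) (α : G →* Circle),
            ρ₁.HasStringOrder ρ₁.U g α ↔ ρ₂.HasStringOrder ρ₂.U g α))) ∧
    -- strong `G` and weak `K`, the component in `H¹(G, H¹(K, U(1))) = Hom(G, Hom(K, U(1)))`
    (∀ (ρ : MixedSPT.SymmetricMPDO G K) V ω, ρ.IsProjectiveAction V ω →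
      ∃ Ω : G →* (K →* Circle),
        (∀ (g : G) (k : K),
          Ω g k = MixedSPT.slant ω (MixedSPT.ketElt (g, 1)) (MixedSPT.ketElt (1, k))) ∧
        ∀ (g : G) (α : K →* Circle),
          (α⁻¹ = Ω g → ρ.HasStringOrder ρ.W g α) ∧
          (α⁻¹ ≠ Ω g → ρ.StringOrderVanishes ρ.W g α)) ∧
    (∀ (ρ₁ ρ₂ : MixedSPT.SymmetricMPDO G K) V₁ ω₁ V₂ ω₂,
      ρ₁.IsProjectiveAction V₁ ω₁ → ρ₂.IsProjectiveAction V₂ ω₂ →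
      ((∀ (g : G) (k : K),
          MixedSPT.slant ω₁ (MixedSPT.ketElt (g, 1)) (MixedSPT.ketElt (1, k)) =
            MixedSPT.slant ω₂ (MixedSPT.ketElt (g, 1)) (MixedSPT.ketElt (1, k))) ↔
        ∀ (g : G) (α : K →* Circle),
          ρ₁.HasStringOrder ρ₁.W g α ↔ ρ₂.HasStringOrder ρ₂.W g α) ∧
      (MixedSPT.Cohomologous 1 (MixedSPT.ketCocycle ω₁) (MixedSPT.ketCocycle ω₂) →
        (MixedSPT.Cohomologous (MixedSPT.antiSign G K) ω₁ ω₂ ↔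
          ∀ (g : G) (α : K →* Circle),
            ρ₁.HasStringOrder ρ₁.W g α ↔ ρ₂.HasStringOrder ρ₂.W g α))) := by
  refine ⟨fun ρ => ρ.exists_isProjectiveAction, ?_, ?_, ?_, ?_⟩
  · intro ρ V ω h G₁ G' hcomm
    exact h.exists_pairing G₁.subtype G'.subtype fun g p => hcomm g g.2 p p.2
  · intro hG
    refine ⟨fun ρ V ω h => ?_, fun ρ₁ ρ₂ V₁ ω₁ V₂ ω₂ h₁ h₂ => ?_⟩
    · have h1 := h.exists_pairing (MonoidHom.id G) (MonoidHom.inl G K) fun _ _ => hG _ _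
      rwa [ρ.onSite_comp_inl] at h1
    · have h1 := h₁.slant_eq_iff_hasStringOrder h₂ (MonoidHom.inl G Unit) fun _ _ => hG _ _
      rw [ρ₁.onSite_comp_inl, ρ₂.onSite_comp_inl] at h1
      exact (h₁.cohomologous_iff_slant_eq hG h₂).trans h1
  · intro ρ V ω h
    have h1 := h.exists_pairing (MonoidHom.id G) (MonoidHom.inr G K) fun _ _ => by simp
    rwa [ρ.onSite_comp_inr] at h1
  · intro ρ₁ ρ₂ V₁ ω₁ V₂ ω₂ h₁ h₂
    have h1 := h₁.slant_eq_iff_hasStringOrder h₂ (MonoidHom.inr G K) fun _ _ => by simp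
    rw [ρ₁.onSite_comp_inr, ρ₂.onSite_comp_inr] at h1
    exact ⟨h1, fun hc => (h₁.cohomologous_iff_pairing_eq h₂ hc).trans h1⟩
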